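/- Let $n\ge 1$, write $\langle x\rangle=(1+|x|^2)^{1/2}$ for $x\in\mathbb R^n$, and let $D=-i\nabla$. For $0<\alpha\le 2$ let $H_{\alpha,0}=-\Delta-\langle x\rangle^{\alpha}$ be the operator in $L^2(\mathbb R^n;\mathbb C)$ obtained as the closure of this differential expression on the domain $\{u\in H^2(\mathbb R^n):\ \langle x\rangle^2u\in L^2(\mathbb R^n)\}$ of the harmonic oscillator. A measurable potential $V:\mathbb R^n\to\mathbb R$ is called $H_{\alpha,0}$-compact if $D(H_{\alpha,0})\subset D(V)=\{u\in L^2: Vu\in L^2\}$ and $V(H_{\alpha,0}+i)^{-1}$ is a compact operator on $L^2(\mathbb R^n)$; in that case let $H_\alpha=H_{\alpha,0}+V$, with domain $D(H_{\alpha,0})$. Then: 1. If $0<\alpha<2$ and $V$ is $H_{\alpha,0}$-compact, then $\sigma(H_\alpha)=\mathbb R$. 2. For $\alpha=2$: - (a) the spectrum of $H_{2,0}$ is purely absolutely continuous: $H_{2,0}$ has a spectral measure $E$, and for every $u\in L^2(\mathbb R^n)$ the measure $\mu_u(\cdot)=\|E(\cdot)u\|^2$ is absolutely continuous with respect to Lebesgue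 measure; - (b) $H_{2,0}$ is unitarily equivalent to the shifted dilation generator $\widetilde H_{2,0}=D\cdot x+x\cdot D-1$, taken with domain $\{u\in L^2:\ (D\cdot x+x\cdot D)u\in L^2\}$ in the sense of distributions: there is a unitary operator $U$ on $L^2(\mathbb R^n)$ which on Schwartz functions $u$ is given by $$Uu(x)=\frac1{(\sqrt2\,\pi)^{n/2}}\,e^{-i|x|^2/2}\int_{\mathbb R^n}e^{i\sqrt2\,x\cdot y}\,e^{-i|y|^2/2}\,u(y)\,dy,$$ and $H_{2,0}=U\widetilde H_{2,0}U^{-1}$, domains included; - (c) if $V$ is $H_{2,0}$-compact, then $\sigma(H_2)=\mathbb R$. -/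

import Mathlib

open MeasureTheory Complex
open scoped SchwartzMap Laplacian LineDeriv ENNReal

noncomputable section

namespace RepulsiveSchrodinger

/-! ### Unbounded operators on a Hilbert space -/

section Abstract

variable {H : Type*} [NormedAddCommGroup H] [InnerProductSpace ℂ H]

/-- The resolvent set of an unbounded operator `A`: the `z ∈ ℂ` for which `A - z : D(A) → H` is a
bijection with bounded inverse `R`. -/
def resolventSet (A : H →ₗ.[ℂ] H) : Set ℂ :=
  {z | ∃ R : H →L[ℂ] H,
    (∀ f : H, ∃ h : R f ∈ A.domain, A ⟨R f, h⟩ - z • R f = f) ∧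
    (∀ u : A.domain, R (A u - z • (u : H)) = u)}

/-- The spectrum of an unbounded operator, a subset of `ℂ`. -/
def opSpectrum (A : H →ₗ.[ℂ] H) : Set ℂ :=
  (resolventSet A)ᶜ

/-- `C` is `A`-compact: `D(A) ⊆ D(C)` and `C (A + i)⁻¹` is a compact operator `T`, i.e.
`C u = T ((A + i) u)` for all `u ∈ D(A)`. It is used for self-adjoint `A`, for which `A + i` is a
bijection from `D(A)` onto `H`. -/
def RelativelyCompact (A C : H →ₗ.[ℂ] H) : Prop :=
  ∃ T : H →L[ℂ] H, IsCompactOperator T ∧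
    ∀ u : A.domain, ∃ h : (u : H) ∈ C.domain, C ⟨u, h⟩ = T (A u + I • (u : H))

/-- The unitary operator `U` conjugates `A` to `B`: `B = U A U⁻¹`, domains included. -/
def Conjugates (U : H ≃ₗᵢ[ℂ] H) (A B : H →ₗ.[ℂ] H) : Prop :=
  ∀ u f : H, (u, f) ∈ A.graph ↔ (U u, U f) ∈ B.graph

variable [CompleteSpace H]

variable (H) in
/-- A projection-valued measure (resolution of the identity) on the Borel sets of `ℝ`. -/
structure ProjectionMeasure where
  /-- The projection attached to a set; only its values on Borel sets matter. -/
  proj : Set ℝ → H →L[ℂ] H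
  isStarProjection : ∀ s, MeasurableSet s → IsStarProjection (proj s)
  proj_empty : proj ∅ = 0
  proj_univ : proj Set.univ = 1
  proj_inter : ∀ s t, MeasurableSet s → MeasurableSet t → proj (s ∩ t) = proj s * proj t
  hasSum_proj : ∀ s : ℕ → Set ℝ, (∀ k, MeasurableSet (s k)) →
    Pairwise (Function.onFun Disjoint s) → ∀ u, HasSum (fun k => proj (s k) u) (proj (⋃ k, s k) u)

theorem ProjectionMeasure.norm_sq_eq (E : ProjectionMeasure H) (u : H) {s : Set ℝ}
    (hs : MeasurableSet s) : ‖E.proj s u‖ ^ 2 = (inner ℂ u (E.proj s u)).re := by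
  have h := E.isStarProjection s hs
  have h1 : inner ℂ (E.proj s u) (E.proj s u) = inner ℂ u (E.proj s u) := by
    have h2 := h.isSelfAdjoint
    have h3 : E.proj s (E.proj s u) = E.proj s u := by
      have := h.isIdempotentElem
      exact congrArg (fun T : H →L[ℂ] H => T u) this
    rw [ContinuousLinearMap.isSelfAdjoint_iff_isSymmetric] at h2
    have h4 := h2 u (E.proj s u)
    simp only [ContinuousLinearMap.coe_coe] at h4
    rw [h4, h3]
  rw [← h1]
  have := inner_self_eq_norm_sq (𝕜 := ℂ) (E.proj s u)
  simpa using this.symm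

/-- The scalar spectral measure `μ_u(s) = ‖E(s) u‖² = ⟨u, E(s) u⟩` of a vector `u`. -/
def ProjectionMeasure.scalarMeasure (E : ProjectionMeasure H) (u : H) : Measure ℝ :=
  Measure.ofMeasurable (fun s _ => ENNReal.ofReal (‖E.proj s u‖ ^ 2))
    (by simp [E.proj_empty])
    (by
      intro s hs hd
      have hsum := (E.hasSum_proj s hs hd u).mapL (innerSL ℂ u)
      have hre := hsum.mapL Complex.reCLM
      have hre' : HasSum (fun k => ‖E.proj (s k) u‖ ^ 2) (‖E.proj (⋃ k, s k) u‖ ^ 2) := by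
        rw [E.norm_sq_eq u (MeasurableSet.iUnion hs)]
        simp_rw [fun k => E.norm_sq_eq u (hs k)]
        simpa using hre
      rw [← hre'.tsum_eq, ENNReal.ofReal_tsum_of_nonneg (fun k => by positivity) hre'.summable])

/-- `E` is the spectral measure of `A`, i.e. `A = ∫ t dE(t)`: the domain of `A` consists of the `u`
with `∫ t² dμ_u(t) < ∞`, and `⟨u, A u⟩ = ∫ t dμ_u(t)` for these `u`. -/
def IsSpectralMeasureOf (E : ProjectionMeasure H) (A : H →ₗ.[ℂ] H) : Prop :=
  (∀ u : H, u ∈ A.domain ↔ ∫⁻ t : ℝ, ENNReal.ofReal (t ^ 2) ∂(E.scalarMeasure u) < ∞) ∧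
  (∀ u : A.domain, inner ℂ (u : H) (A u) = ((∫ t : ℝ, t ∂(E.scalarMeasure (u : H)) : ℝ) : ℂ))

/-- `A` has a spectral measure, and all its scalar spectral measures are absolutely continuous with
respect to Lebesgue measure: `A` is self-adjoint with purely absolutely continuous spectrum. -/
def PurelyAbsolutelyContinuous (A : H →ₗ.[ℂ] H) : Prop :=
  ∃ E : ProjectionMeasure H, IsSpectralMeasureOf E A ∧
    ∀ u : H, E.scalarMeasure u ≪ (volume : Measure ℝ)

end Abstract

/-! ### Operators on `L²(ℝⁿ)` -/

/-- Euclidean space `ℝⁿ`. -/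
abbrev Space (n : ℕ) : Type := EuclideanSpace ℝ (Fin n)

/-- The Hilbert space `L²(ℝⁿ; ℂ)`. -/
abbrev L2 (n : ℕ) : Type := Lp ℂ 2 (volume : Measure (Space n))

/-- The tempered distribution defined by an `L²` function. -/
abbrev toDist (n : ℕ) : L2 n →L[ℂ] 𝓢'(Space n, ℂ) :=
  Lp.toTemperedDistributionCLM ℂ volume 2

theorem toDist_injective (n : ℕ) : Function.Injective (toDist n) :=
  LinearMap.ker_eq_bot.mp Lp.ker_toTemperedDistributionCLM_eq_bot

/-- The maximal realization in `L²(ℝⁿ)` of a linear operator `T` on tempered distributions: its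
domain is `{u ∈ L² : T u ∈ L²}`. -/
def maximalRealization (n : ℕ) (T : 𝓢'(Space n, ℂ) →L[ℂ] 𝓢'(Space n, ℂ)) : L2 n →ₗ.[ℂ] L2 n where
  domain := (LinearMap.range (toDist n).toLinearMap).comap (T ∘L toDist n).toLinearMap
  toFun := (LinearEquiv.ofInjective (toDist n).toLinearMap (toDist_injective n)).symm.toLinearMap ∘ₗ
    (((T ∘L toDist n).toLinearMap.comp (Submodule.subtype _)).codRestrict
      (LinearMap.range (toDist n).toLinearMap) (fun u => u.2))

/-- The weight `⟨x⟩ ^ a = (1 + |x|²) ^ (a / 2)`. -/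
def japanese (n : ℕ) (a : ℝ) (x : Space n) : ℝ := (1 + ‖x‖ ^ 2) ^ (a / 2)

theorem mul_coeFn_add (n : ℕ) (V : Space n → ℝ) (u v : L2 n) :
    (fun x => (V x : ℂ) * (u + v : L2 n) x) =ᵐ[volume]
      (fun x => (V x : ℂ) * u x) + fun x => (V x : ℂ) * v x := by
  filter_upwards [Lp.coeFn_add u v] with x hx
  simp only [hx, Pi.add_apply, mul_add]

theorem mul_coeFn_smul (n : ℕ) (V : Space n → ℝ) (c : ℂ) (u : L2 n) :
    (fun x => (V x : ℂ) * (c • u : L2 n) x) =ᵐ[volume] c • fun x => (V x : ℂ) * u x := by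
  filter_upwards [Lp.coeFn_smul c u] with x hx
  simp only [hx, Pi.smul_apply, smul_eq_mul, mul_left_comm]

/-- The subspace `{u ∈ L² : V u ∈ L²}`. -/
def mulDomain (n : ℕ) (V : Space n → ℝ) : Submodule ℂ (L2 n) where
  carrier := {u | MemLp (fun x => (V x : ℂ) * u x) 2 volume}
  zero_mem' := by
    refine (memLp_congr_ae ?_).mpr (MemLp.zero' (ε := ℂ) (α := Space n))
    filter_upwards [Lp.coeFn_zero ℂ 2 (volume : Measure (Space n))] with x hx
    simp only [hx, Pi.zero_apply, mul_zero]
  add_mem' := fun {u v} hu hv => (memLp_congr_ae (mul_coeFn_add n V u v)).mpr (MemLp.add hu hv)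
  smul_mem' := fun c u hu => (memLp_congr_ae (mul_coeFn_smul n V c u)).mpr (MemLp.const_smul hu c)

theorem mem_mulDomain {n : ℕ} {V : Space n → ℝ} {u : L2 n} :
    u ∈ mulDomain n V ↔ MemLp (fun x => (V x : ℂ) * u x) 2 volume := Iff.rfl

/-- The product `V u` as an element of `L²`. -/
def mulFun (n : ℕ) (V : Space n → ℝ) (u : mulDomain n V) : L2 n :=
  MemLp.toLp (fun x => (V x : ℂ) * (u : L2 n) x) (mem_mulDomain.mp u.2)

theorem coeFn_mulFun (n : ℕ) (V : Space n → ℝ) (u : mulDomain n V) :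
    mulFun n V u =ᵐ[volume] fun x => (V x : ℂ) * (u : L2 n) x :=
  MemLp.coeFn_toLp _

/-- Multiplication by the real function `V` in `L²(ℝⁿ)`, with its maximal domain
`{u ∈ L² : V u ∈ L²}`. -/
def mulOp (n : ℕ) (V : Space n → ℝ) : L2 n →ₗ.[ℂ] L2 n where
  domain := mulDomain n V
  toFun :=
    { toFun := mulFun n V
      map_add' := by
        intro u v
        refine Lp.ext ?_
        filter_upwards [coeFn_mulFun n V (u + v), coeFn_mulFun n V u, coeFn_mulFun n V v,
          mul_coeFn_add n V u v, Lp.coeFn_add (mulFun n V u) (mulFun n V v)] with x h1 h2 h3 h4 h5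
        rw [h1, h5, Pi.add_apply, h2, h3]
        exact h4
      map_smul' := by
        intro c u
        refine Lp.ext ?_
        filter_upwards [coeFn_mulFun n V (c • u), coeFn_mulFun n V u,
          mul_coeFn_smul n V c u, Lp.coeFn_smul c (mulFun n V u)] with x h1 h2 h3 h4
        rw [RingHom.id_apply, h1, h4, Pi.smul_apply, h2]
        exact h3 }

/-- The Sobolev space `H²(ℝⁿ)` as a subspace of `L²(ℝⁿ)`. -/
def sobolevTwo (n : ℕ) : Submodule ℂ (L2 n) where
  carrier := {u | TemperedDistribution.MemSobolev 2 2 (toDist n u)}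
  zero_mem' := by
    change TemperedDistribution.MemSobolev 2 2 (toDist n 0)
    rw [map_zero]
    exact TemperedDistribution.memSobolev_fun_zero (Space n) ℂ 2 2
  add_mem' := fun {u v} hu hv => by
    change TemperedDistribution.MemSobolev 2 2 (toDist n (u + v))
    rw [map_add]
    exact TemperedDistribution.MemSobolev.add hu hv
  smul_mem' := fun c u hu => by
    change TemperedDistribution.MemSobolev 2 2 (toDist n (c • u))
    rw [map_smul]
    exact TemperedDistribution.MemSobolev.smul c hu

/-- The domain `{u ∈ H²(ℝⁿ) : ⟨x⟩² u ∈ L²(ℝⁿ)}` of the harmonic oscillator. -/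
def oscillatorDomain (n : ℕ) : Submodule ℂ (L2 n) :=
  sobolevTwo n ⊓ mulDomain n (japanese n 2)

/-- The expression `-Δ - ⟨x⟩ ^ α` acting on tempered distributions. -/
def freeExpr (n : ℕ) (α : ℝ) : 𝓢'(Space n, ℂ) →L[ℂ] 𝓢'(Space n, ℂ) :=
  -LineDeriv.laplacianCLM ℂ (Space n) 𝓢'(Space n, ℂ)
    - TemperedDistribution.smulLeftCLM ℂ (fun x => (japanese n α x : ℂ))

/-- The free Hamiltonian `-Δ - ⟨x⟩ ^ α`, `0 < α ≤ 2`: the closure of the operator given by this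
expression on the domain of the harmonic oscillator. -/
def freeHamiltonian (n : ℕ) (α : ℝ) : L2 n →ₗ.[ℂ] L2 n :=
  ((maximalRealization n (freeExpr n α)).domRestrict (oscillatorDomain n)).closure

/-- The perturbed Hamiltonian `-Δ - ⟨x⟩ ^ α + V`, an operator sum: its domain is the intersection of
the domains of the free Hamiltonian and of the multiplication by `V`. -/
def hamiltonian (n : ℕ) (α : ℝ) (V : Space n → ℝ) : L2 n →ₗ.[ℂ] L2 n :=
  freeHamiltonian n α + mulOp n V

/-- The expression `D · x + x · D = -i ∑ⱼ (∂ⱼ xⱼ + xⱼ ∂ⱼ)` acting on tempered distributions;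
`D · x + x · D` is twice the generator of the unitary dilations `u ↦ e^{ns/2} u(e^s x)`. -/
def dilationExpr (n : ℕ) : 𝓢'(Space n, ℂ) →L[ℂ] 𝓢'(Space n, ℂ) :=
  -I • ∑ j : Fin n,
    (LineDeriv.lineDerivOpCLM ℂ 𝓢'(Space n, ℂ) (EuclideanSpace.single j (1 : ℝ)) ∘L
        TemperedDistribution.smulLeftCLM ℂ (fun x : Space n => (x j : ℂ)) +
      TemperedDistribution.smulLeftCLM ℂ (fun x : Space n => (x j : ℂ)) ∘L
        LineDeriv.lineDerivOpCLM ℂ 𝓢'(Space n, ℂ) (EuclideanSpace.single j (1 : ℝ)))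

/-- The shifted dilation generator `D · x + x · D - 1` in `L²(ℝⁿ)`, with its maximal domain (on
which it is self-adjoint). -/
def shiftedDilation (n : ℕ) : L2 n →ₗ.[ℂ] L2 n :=
  maximalRealization n (dilationExpr n - ContinuousLinearMap.id ℂ _)

/-- The oscillatory integral
`(√2 π)^{-n/2} e^{-i|x|²/2} ∫ e^{i √2 x·y} e^{-i|y|²/2} f(y) dy`. -/
def rotationIntegral (n : ℕ) (f : Space n → ℂ) (x : Space n) : ℂ :=
  (((√2 * Real.pi) ^ (-(n : ℝ) / 2) : ℝ) : ℂ) * cexp (-I * (‖x‖ ^ 2 / 2 : ℝ)) *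
    ∫ y : Space n, cexp (I * (√2 * inner ℝ x y : ℝ)) * cexp (-I * (‖y‖ ^ 2 / 2 : ℝ)) * f y

end RepulsiveSchrodinger

end

open RepulsiveSchrodinger

/-! The spectral statements rest on two facts about A = -Δ - ⟨x⟩^α. It is self-adjoint, and every
real t has a singular sequence: orthonormal vectors u_k in the domain with (A - t)u_k → 0. If V is
relatively compact, then V(A - z)⁻¹ is compact for nonreal z, so the Fredholm alternative and the
symmetry of A + V make A + V - z invertible. A compact operator sends an orthonormal sequence to
zero along a subsequence, so singular sequences of A survive the perturbation. Hence the spectrum of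
A + V is exactly ℝ (`IsSelfAdjointOp.opSpectrum_add`).

Self-adjointness holds because a vector u orthogonal to (A - z)g for all Schwartz g vanishes when Im
z ≠ 0 (`deficiency_eq_zero`). Test with the symmetric Gaussian kernel K(x, y) = exp(-ε²|x|² - ε²|y|²
- ε⁻²|x - y|²), multiply by conj u(y), integrate, and subtract the conjugate identity with x and y
exchanged. This expresses 2i Im z ∫∫ K u(x) conj u(y) through a commutator in which the singular
terms cancel. What remains is at most 13·||x|² - |y|²|, precisely because α ≤ 2, and after the
substitution y = x + εw it tends to zero by dominated convergence, while the left side tends to a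
positive multiple of Im z ‖u‖². The same lemma excludes nonreal eigenvalues of the maximal
realization. So the maximal realization, the closure from Schwartz functions and `freeHamiltonian`
coincide (`freeHamiltonian_eq`), and all domain questions reduce to duality with Schwartz functions.

For α < 2 the singular sequences are radial WKB functions χ(|x|²/R) e^{iG(|x|²)}, where G solves the
eikonal equation at energy t. The errors are of order 1/R and G', and G' → 0 exactly because α < 2
(`exists_phase`, `exists_singular_sequence_of_lt_two`).

For α = 2 the operator U rotates phase space by 45 degrees and carries D² - x² to D·x + x·D
(`freeSchwartz_rotationSchwartz`). In logarithmic coordinates on each of the 2ⁿ orthants the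
dilation generator is a constant vector field, so a Fourier transform turns it into multiplication
by the affine function 4π(ξ₁ + ⋯ + ξₙ) - 1. This diagonalization (`mem_graph_free_two_iff`) gives
the spectral measure, its absolute continuity and the singular sequences. -/

noncomputable section

namespace RepulsiveSchrodinger

/-! ### Self-adjointness through symmetric operators with full range -/

section SelfAdjointness

open Filter Topology

variable {H : Type*} [NormedAddCommGroup H] [InnerProductSpace ℂ H]

/-- A symmetric operator, given by its graph `G`. -/
def IsSymmetricGraph (G : Submodule ℂ (H × H)) : Prop :=
  ∀ p ∈ G, ∀ q ∈ G, inner ℂ p.2 q.1 = inner ℂ p.1 q.2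

/-- A symmetric operator `A` with `A - z` onto for all nonreal `z`. -/
structure IsSelfAdjointOp (A : H →ₗ.[ℂ] H) : Prop where
  symm : IsSymmetricGraph A.graph
  surj : ∀ z : ℂ, z.im ≠ 0 → ∀ f : H, ∃ p ∈ A.graph, p.2 - z • p.1 = f

/-- By symmetry ⟨p.1, p.2⟩ is real, so the imaginary part of ⟨p.1, p.2 - z p.1⟩ is -Im z ‖p.1‖²;
then Cauchy–Schwarz. The bound gives both injectivity and closed range. -/
theorem IsSymmetricGraph.im_mul_norm_le {G : Submodule ℂ (H × H)} (hG : IsSymmetricGraph G)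
    {p : H × H} (hp : p ∈ G) (z : ℂ) : |z.im| * ‖p.1‖ ≤ ‖p.2 - z • p.1‖ := by
  have h1 : (inner ℂ p.1 p.2).im = 0 := by
    have h := hG p hp p hp
    have h2 := inner_conj_symm (𝕜 := ℂ) p.1 p.2
    rw [h] at h2
    exact Complex.conj_eq_iff_im.mp h2
  have h2 : (inner ℂ p.1 (p.2 - z • p.1)).im = - z.im * ‖p.1‖ ^ 2 := by
    rw [inner_sub_right, inner_smul_right, inner_self_eq_norm_sq_to_K, Complex.sub_im, h1]
    have : (((‖p.1‖ : ℝ) : ℂ) ^ 2) = ((‖p.1‖ ^ 2 : ℝ) : ℂ) := by push_cast; rfl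
    simp only [coe_algebraMap, this, Complex.im_mul_ofReal]
    ring
  have h3 : |z.im| * ‖p.1‖ ^ 2 ≤ ‖p.1‖ * ‖p.2 - z • p.1‖ := by
    calc |z.im| * ‖p.1‖ ^ 2 = |(inner ℂ p.1 (p.2 - z • p.1)).im| := by
          rw [h2, abs_mul, abs_neg, abs_of_nonneg (sq_nonneg ‖p.1‖)]
      _ ≤ ‖inner ℂ p.1 (p.2 - z • p.1)‖ := Complex.abs_im_le_norm _
      _ ≤ _ := norm_inner_le_norm _ _
  rcases (norm_nonneg p.1).eq_or_lt with h0 | h0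
  · rw [← h0, mul_zero]; exact norm_nonneg _
  · refine le_of_mul_le_mul_left ?_ h0
    calc ‖p.1‖ * (|z.im| * ‖p.1‖) = |z.im| * ‖p.1‖ ^ 2 := by ring
      _ ≤ _ := h3

theorem IsSymmetricGraph.closure {G : Submodule ℂ (H × H)} (hG : IsSymmetricGraph G) :
    IsSymmetricGraph G.topologicalClosure := by
  intro p hp q hq
  have hp' : p ∈ _root_.closure (G : Set (H × H)) := hp
  have hq' : q ∈ _root_.closure (G : Set (H × H)) := hq
  refine closure_minimal (t := {p : H × H | inner ℂ p.2 q.1 = inner ℂ p.1 q.2}) ?_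
    (isClosed_eq (by fun_prop) (by fun_prop)) hp'
  intro p hp
  exact closure_minimal (t := {q : H × H | inner ℂ p.2 q.1 = inner ℂ p.1 q.2})
    (fun q hq => hG p hp q hq) (isClosed_eq (by fun_prop) (by fun_prop)) hq'

/-- A closed symmetric graph with trivial deficiency spaces has full range. -/
theorem IsSymmetricGraph.exists_mem_closure [CompleteSpace H] {G : Submodule ℂ (H × H)}
    (hG : IsSymmetricGraph G) {z : ℂ} (hz : z.im ≠ 0)
    (hdef : ∀ h : H, (∀ p ∈ G, inner ℂ h (p.2 - z • p.1) = 0) → h = 0) (f : H) :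
    ∃ p ∈ G.topologicalClosure, p.2 - z • p.1 = f := by
  set K := G.topologicalClosure with hK
  let Λ : H × H →L[ℂ] H := ContinuousLinearMap.snd ℂ H H - z • ContinuousLinearMap.fst ℂ H H
  have hΛ : ∀ p : H × H, Λ p = p.2 - z • p.1 := fun p => rfl
  let S : K →L[ℂ] H := Λ.comp K.subtypeL
  have hz' : 0 < |z.im| := abs_pos.mpr hz
  -- The first component is at most ‖S p‖ / |Im z|, the second at most ‖S p‖ plus ‖z‖ times the
  -- first. The constant adds the two bounds. With K complete, S then has closed range.
  have hbound : ∀ p : K, ‖p‖ ≤ (1 + (1 + ‖z‖) / |z.im|) * ‖S p‖ := by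
    intro p
    have h1 := hG.closure.im_mul_norm_le p.2 z
    have h1' : ‖(p : H × H).1‖ ≤ ‖S p‖ / |z.im| := by
      rw [le_div_iff₀ hz', mul_comm]; exact h1
    have h2 : ‖(p : H × H).2‖ ≤ ‖S p‖ + ‖z‖ * ‖(p : H × H).1‖ := by
      have : (p : H × H).2 = S p + z • (p : H × H).1 := by simp [S, hΛ]
      calc ‖(p : H × H).2‖ = ‖S p + z • (p : H × H).1‖ := by rw [← this]
        _ ≤ ‖S p‖ + ‖z • (p : H × H).1‖ := norm_add_le _ _
        _ = _ := by rw [norm_smul]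
    have h3 : ‖z‖ * ‖(p : H × H).1‖ ≤ ‖z‖ * (‖S p‖ / |z.im|) :=
      mul_le_mul_of_nonneg_left h1' (norm_nonneg z)
    have h4 : (1 + (1 + ‖z‖) / |z.im|) * ‖S p‖ =
        ‖S p‖ + ‖S p‖ / |z.im| + ‖z‖ * (‖S p‖ / |z.im|) := by ring
    have h5 : 0 ≤ ‖S p‖ / |z.im| := by positivity
    have h6 : 0 ≤ ‖z‖ * (‖S p‖ / |z.im|) := by positivity
    have h7 := norm_nonneg (S p)
    rw [h4]
    refine (Prod.norm_def (p : H × H)).le.trans (max_le ?_ ?_) <;> linarith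
  have hanti : AntilipschitzWith (Real.toNNReal (1 + (1 + ‖z‖) / |z.im|)) S := by
    refine AddMonoidHomClass.antilipschitz_of_bound S fun p => ?_
    rw [Real.coe_toNNReal _ (by positivity)]
    exact hbound p
  have : CompleteSpace K := G.isClosed_topologicalClosure.completeSpace_coe
  have hclosed : IsClosed (Set.range S) := hanti.isClosed_range S.uniformContinuous
  have hrange : S.range = ⊤ := by
    have hc : IsClosed (S.range : Set H) := by
      rw [LinearMap.coe_range]; exact hclosed
    have : S.range.HasOrthogonalProjection := by
      have : CompleteSpace S.range := hc.completeSpace_coe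
      infer_instance
    rw [← Submodule.orthogonal_eq_bot_iff, Submodule.eq_bot_iff]
    intro h hh
    refine hdef h fun p hp => ?_
    have := (Submodule.mem_orthogonal' _ _).mp hh (S ⟨p, G.le_topologicalClosure hp⟩) ⟨_, rfl⟩
    exact this
  obtain ⟨p, hp⟩ : f ∈ S.range := by rw [hrange]; trivial
  exact ⟨p, p.2, hp⟩

/-- Essential self-adjointness: if the closed operator `A` extends a symmetric graph `G` with trivial
deficiency spaces and has no nonreal eigenvalues, then `A` is the closure of `G`. -/
theorem graph_eq_closure_of_core [CompleteSpace H] {A : H →ₗ.[ℂ] H} (hA : A.IsClosed)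
    {G : Submodule ℂ (H × H)} (hGA : G ≤ A.graph) (hG : IsSymmetricGraph G)
    (hdef : ∀ z : ℂ, z.im ≠ 0 → ∀ h : H, (∀ p ∈ G, inner ℂ h (p.2 - z • p.1) = 0) → h = 0)
    (hinj : ∀ z : ℂ, z.im ≠ 0 → ∀ u : H, (u, z • u) ∈ A.graph → u = 0) :
    A.graph = G.topologicalClosure := by
  have hle : G.topologicalClosure ≤ A.graph := Submodule.topologicalClosure_minimal _ hGA hA
  refine le_antisymm ?_ hle
  intro p hp
  have hI : (I : ℂ).im ≠ 0 := by simp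
  -- Solve (A - i)q = (A - i)p within the closure of G. Then p - q would be an eigenvector for the
  -- eigenvalue i, which `hinj` excludes.
  obtain ⟨q, hq, hqp⟩ := hG.exists_mem_closure hI (hdef I hI) (p.2 - I • p.1)
  have hd : p - q ∈ A.graph := A.graph.sub_mem hp (hle hq)
  have h2 : p.2 - q.2 = I • (p.1 - q.1) := by
    have : p.2 - q.2 = (p.2 - I • p.1) - (q.2 - I • q.1) + I • (p.1 - q.1) := by
      rw [smul_sub]; abel
    rw [this, hqp, sub_self, zero_add]
  have h3 : p.1 - q.1 = 0 := hinj I hI _ (by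
    have : p - q = (p.1 - q.1, p.2 - q.2) := rfl
    rw [this, h2] at hd
    exact hd)
  have h4 : p = q := by
    refine Prod.ext (sub_eq_zero.mp h3) (sub_eq_zero.mp ?_)
    rw [h2, h3, smul_zero]
  rw [h4]; exact hq

theorem isSelfAdjointOp_of_core [CompleteSpace H] {A : H →ₗ.[ℂ] H} (hA : A.IsClosed)
    {G : Submodule ℂ (H × H)} (hGA : G ≤ A.graph) (hG : IsSymmetricGraph G)
    (hdef : ∀ z : ℂ, z.im ≠ 0 → ∀ h : H, (∀ p ∈ G, inner ℂ h (p.2 - z • p.1) = 0) → h = 0)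
    (hinj : ∀ z : ℂ, z.im ≠ 0 → ∀ u : H, (u, z • u) ∈ A.graph → u = 0) :
    IsSelfAdjointOp A := by
  have h := graph_eq_closure_of_core hA hGA hG hdef hinj
  refine ⟨?_, fun z hz f => ?_⟩
  · rw [h]; exact hG.closure
  · rw [h]; exact hG.exists_mem_closure hz (hdef z hz) f

theorem IsSelfAdjointOp.exists_resolvent {A : H →ₗ.[ℂ] H} (hA : IsSelfAdjointOp A) {z : ℂ}
    (hz : z.im ≠ 0) : ∃ R : H →L[ℂ] H,
      (∀ f : H, ∃ h : R f ∈ A.domain, A ⟨R f, h⟩ - z • R f = f) ∧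
      (∀ u : A.domain, R (A u - z • (u : H)) = u) := by
  have hz' : 0 < |z.im| := abs_pos.mpr hz
  let T : A.domain →ₗ[ℂ] H := A.toFun - z • A.domain.subtype
  have hT : ∀ u : A.domain, T u = A u - z • (u : H) := fun u => rfl
  have hb : ∀ u : A.domain, |z.im| * ‖(u : H)‖ ≤ ‖T u‖ := fun u =>
    hA.symm.im_mul_norm_le (p := ((u : H), A u)) (A.mem_graph u) z
  have hinj : Function.Injective T := by
    rw [← LinearMap.ker_eq_bot, LinearMap.ker_eq_bot']
    intro u hu
    have := hb u
    rw [hu, norm_zero] at this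
    have h0 : ‖(u : H)‖ = 0 := by
      by_contra hne
      have : 0 < |z.im| * ‖(u : H)‖ := mul_pos hz' (lt_of_le_of_ne (norm_nonneg _) (Ne.symm hne))
      linarith
    exact Subtype.ext (norm_eq_zero.mp h0)
  have hsurj : Function.Surjective T := by
    intro f
    obtain ⟨p, hp, hpf⟩ := hA.surj z hz f
    obtain ⟨u, hu1, hu2⟩ := (A.mem_graph_iff).mp hp
    exact ⟨u, by rw [hT, hu1, hu2, hpf]⟩
  let e := LinearEquiv.ofBijective T ⟨hinj, hsurj⟩
  have he : ∀ f, T (e.symm f) = f := fun f => e.apply_symm_apply f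
  let R : H →L[ℂ] H := LinearMap.mkContinuous (A.domain.subtype ∘ₗ e.symm.toLinearMap) (|z.im|⁻¹)
    (fun f => by
      have := hb (e.symm f)
      rw [he] at this
      rw [inv_mul_eq_div, le_div_iff₀ hz', mul_comm]
      exact this)
  have hR : ∀ f, R f = (e.symm f : H) := fun f => rfl
  refine ⟨R, fun f => ?_, fun u => ?_⟩
  · refine ⟨by rw [hR]; exact (e.symm f).2, ?_⟩
    have := he f
    rw [hT] at this
    exact this
  · rw [hR, ← hT]
    have : e.symm (T u) = u := e.symm_apply_apply u
    rw [this]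

end SelfAdjointness

/-! ### Relatively compact perturbations and Weyl's criterion. -/

section RelativelyCompact

open Filter Topology

variable {H : Type*} [NormedAddCommGroup H] [InnerProductSpace ℂ H]

theorem RelativelyCompact.domain_add {A C : H →ₗ.[ℂ] H} (h : RelativelyCompact A C) :
    (A + C).domain = A.domain := by
  obtain ⟨T, -, hT⟩ := h
  rw [LinearPMap.add_domain]
  exact inf_eq_left.mpr fun u hu => (hT ⟨u, hu⟩).1

/-- A relatively compact symmetric perturbation of a self-adjoint operator has no nonreal
spectrum. -/
theorem IsSelfAdjointOp.mem_resolventSet_add [CompleteSpace H] {A C : H →ₗ.[ℂ] H}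
    (hA : IsSelfAdjointOp A) (hC : IsSymmetricGraph C.graph) (hAC : RelativelyCompact A C) {z : ℂ}
    (hz : z.im ≠ 0) : z ∈ resolventSet (A + C) := by
  have hdom := hAC.domain_add
  obtain ⟨T, hTc, hT⟩ := hAC
  obtain ⟨R, hR1, hR2⟩ := hA.exists_resolvent hz
  -- K is C(A - z)⁻¹, because (A + i)(A - z)⁻¹ = 1 + (z + i)(A - z)⁻¹. Consequently (A + C - z)R = 1
  -- + K.
  let K : H →L[ℂ] H := T ∘L (ContinuousLinearMap.id ℂ H + (z + I) • R)
  have hKc : IsCompactOperator K := hTc.comp_clm _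
  have hK : ∀ f, K f = T (f + (z + I) • R f) := fun f => rfl
  have hCR : ∀ f (h : R f ∈ C.domain), C ⟨R f, h⟩ = K f := by
    intro f h
    obtain ⟨h1, h2⟩ := hR1 f
    obtain ⟨h3, h4⟩ := hT ⟨R f, h1⟩
    have h5 : A ⟨R f, h1⟩ + I • R f = f + (z + I) • R f := by
      rw [add_smul]
      nth_rewrite 3 [← h2]
      abel
    rw [hK, ← h5]
    exact h4
  have hdomC : ∀ f, R f ∈ C.domain := fun f => by
    obtain ⟨h1, h2⟩ := hR1 f
    exact (hT ⟨R f, h1⟩).1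
  have hsum : ∀ f, ∃ h : R f ∈ (A + C).domain, (A + C) ⟨R f, h⟩ - z • R f = f + K f := by
    intro f
    obtain ⟨h1, h2⟩ := hR1 f
    refine ⟨⟨h1, hdomC f⟩, ?_⟩
    have h3 := hCR f (hdomC f)
    change A ⟨R f, h1⟩ + C ⟨R f, hdomC f⟩ - z • R f = f + K f
    rw [h3]
    calc A ⟨R f, h1⟩ + K f - z • R f = (A ⟨R f, h1⟩ - z • R f) + K f := by abel
      _ = _ := by rw [h2]
  -- If K v = -v, then (A + C)R v = z R v. A symmetric operator has no nonreal eigenvalue, so R v =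
  -- 0 and v = (A - z)R v = 0.
  have hne : ¬ Module.End.HasEigenvalue (K : Module.End ℂ H) (-1) := by
    intro hev
    obtain ⟨v, hv⟩ := hev.exists_hasEigenvector
    have hv1 : K v = -v := by simpa using hv.apply_eq_smul
    obtain ⟨h1, h2⟩ := hR1 v
    have h3 : C ⟨R v, hdomC v⟩ = -v := by rw [hCR, hv1]
    have hs1 : (inner ℂ (A ⟨R v, h1⟩ + C ⟨R v, hdomC v⟩) (R v) : ℂ) =
        inner ℂ (R v) (A ⟨R v, h1⟩ + C ⟨R v, hdomC v⟩) := by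
      rw [inner_add_left, inner_add_right]
      congr 1
      · exact hA.symm _ (A.mem_graph ⟨R v, h1⟩) _ (A.mem_graph ⟨R v, h1⟩)
      · exact hC _ (C.mem_graph ⟨R v, hdomC v⟩) _ (C.mem_graph ⟨R v, hdomC v⟩)
    have hs2 : A ⟨R v, h1⟩ + C ⟨R v, hdomC v⟩ = z • R v := by
      rw [h3]
      nth_rewrite 2 [← h2]
      abel
    rw [hs2, inner_smul_left, inner_smul_right] at hs1
    have hRv : R v = 0 := by
      by_contra hne
      have h0 : (inner ℂ (R v) (R v) : ℂ) ≠ 0 := inner_self_ne_zero.mpr hne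
      have := mul_right_cancel₀ h0 hs1
      exact hz (Complex.conj_eq_iff_im.mp this)
    have hv0 : v = 0 := by
      rw [← h2]
      have : (⟨R v, h1⟩ : A.domain) = 0 := Subtype.ext hRv
      rw [this, hRv]; simp
    exact hv.2 hv0
  -- Fredholm alternative at -1. The unit w obtained from it is -(1 + K), so B is (1 + K)⁻¹ and the
  -- resolvent of A + C is R B.
  have hres := (IsCompactOperator.hasEigenvalue_or_mem_resolventSet hKc
    (by norm_num : (-1 : ℂ) ≠ 0)).resolve_left hne
  rw [spectrum.mem_resolventSet_iff] at hres
  obtain ⟨w, hw⟩ := hres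
  let B : H →L[ℂ] H := -(↑w⁻¹ : H →L[ℂ] H)
  have hw' : ∀ f, (w : H →L[ℂ] H) f = -(f + K f) := by
    intro f; rw [hw]; simp [sub_eq_add_neg, add_comm]
  have hB1 : ∀ f, B f + K (B f) = f := by
    intro f
    have h1 : (w : H →L[ℂ] H) ((↑w⁻¹ : H →L[ℂ] H) f) = f := by
      exact congrArg (fun S : H →L[ℂ] H => S f) w.mul_inv
    have h2 : (↑w⁻¹ : H →L[ℂ] H) f = - B f := by simp [B]
    rw [h2, hw'] at h1
    rw [map_neg] at h1
    rw [← neg_add, neg_neg] at h1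
    exact h1
  have hB2 : ∀ f, B (f + K f) = f := by
    intro f
    have h1 : (↑w⁻¹ : H →L[ℂ] H) ((w : H →L[ℂ] H) f) = f := by
      exact congrArg (fun S : H →L[ℂ] H => S f) w.inv_mul
    rw [hw', map_neg] at h1
    exact h1
  refine ⟨R ∘L B, fun f => ?_, fun u => ?_⟩
  · obtain ⟨h1, h2⟩ := hsum (B f)
    refine ⟨h1, ?_⟩
    change (A + C) ⟨R (B f), h1⟩ - z • R (B f) = f
    rw [h2, hB1]
  · have hu : (u : H) ∈ A.domain := by rw [← hdom]; exact u.2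
    let g := A ⟨u, hu⟩ - z • (u : H)
    have hRg : R g = u := hR2 ⟨u, hu⟩
    obtain ⟨h1, h2⟩ := hsum g
    have h3 : (⟨R g, h1⟩ : (A + C).domain) = u := Subtype.ext hRg
    rw [h3, hRg] at h2
    rw [h2]
    change R (B (g + K g)) = u
    rw [hB2, hRg]

/-- Compact operators map orthonormal sequences to null sequences, along a subsequence. -/
theorem exists_subseq_tendsto_zero [CompleteSpace H] {T : H →L[ℂ] H}
    (hT : IsCompactOperator T) {u : ℕ → H} (hu : Orthonormal ℂ u) :
    ∃ φ : ℕ → ℕ, StrictMono φ ∧ Tendsto (fun k => T (u (φ k))) atTop (𝓝 0) := by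
  have hc : IsCompact (closure (T '' Metric.closedBall 0 1)) := by
    simpa using hT.isCompact_closure_image_closedBall 1
  obtain ⟨y, -, φ, hφ, hy⟩ := hc.tendsto_subseq (x := fun k => T (u k))
    (fun k => subset_closure ⟨u k, by simp [hu.1 k], rfl⟩)
  refine ⟨φ, hφ, ?_⟩
  -- Bessel's inequality: orthonormal sequences tend weakly to zero. Moving T to its adjoint then
  -- forces the strong limit y to satisfy ⟨y, y⟩ = 0.
  have hweak : ∀ w : H, Tendsto (fun k => (inner ℂ (u k) w : ℂ)) atTop (𝓝 0) := by
    intro w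
    have hs : Summable (fun k => ‖(inner ℂ (u k) w : ℂ)‖ ^ 2) := hu.inner_products_summable w
    have h0 := hs.tendsto_atTop_zero
    rw [tendsto_zero_iff_norm_tendsto_zero]
    have := (Real.continuous_sqrt.tendsto 0).comp h0
    simpa [Function.comp_def, Real.sqrt_sq (norm_nonneg _)] using this
  have hy0 : (inner ℂ y y : ℂ) = 0 := by
    have h1 : Tendsto (fun k => (inner ℂ (T (u (φ k))) y : ℂ)) atTop (𝓝 (inner ℂ y y)) :=
      hy.inner tendsto_const_nhds
    have h2 : Tendsto (fun k => (inner ℂ (T (u (φ k))) y : ℂ)) atTop (𝓝 0) := by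
      have := (hweak (ContinuousLinearMap.adjoint T y)).comp hφ.tendsto_atTop
      refine this.congr fun k => ?_
      simp [ContinuousLinearMap.adjoint_inner_right]
    exact tendsto_nhds_unique h1 h2
  rw [inner_self_eq_zero.mp hy0] at hy
  exact hy

/-- Weyl's criterion for relatively compact perturbations. -/
theorem RelativelyCompact.not_mem_resolventSet_add [CompleteSpace H] {A C : H →ₗ.[ℂ] H}
    (hAC : RelativelyCompact A C) {z : ℂ} {u f : ℕ → H} (hu : Orthonormal ℂ u)
    (hf : ∀ k, (u k, f k) ∈ A.graph) (hlim : Tendsto (fun k => f k - z • u k) atTop (𝓝 0)) :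
    z ∉ resolventSet (A + C) := by
  rintro ⟨R, -, hR⟩
  have hdom := hAC.domain_add
  obtain ⟨T, hTc, hT⟩ := hAC
  obtain ⟨φ, hφ, hφT⟩ := exists_subseq_tendsto_zero hTc hu
  have hlimφ := hlim.comp hφ.tendsto_atTop
  -- The argument of R is (A + C - z)u_k, since C u_k = T(A + i)u_k. Along the subsequence all three
  -- terms tend to zero, which contradicts ‖u_k‖ = 1.
  have key : ∀ k, R ((f k - z • u k) + (T (f k - z • u k) + (z + I) • T (u k))) = u k := by
    intro k
    obtain ⟨v, hv1, hv2⟩ := A.mem_graph_iff.mp (hf k)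
    simp only at hv1 hv2
    obtain ⟨h1, h2⟩ := hT v
    have hv : (v : H) ∈ (A + C).domain := ⟨v.2, h1⟩
    have h3 := hR ⟨v, hv⟩
    rw [LinearPMap.add_apply] at h3
    have h4 : C ⟨(v : H), h1⟩ = T (f k - z • u k) + (z + I) • T (u k) := by
      rw [h2, hv2, hv1, ← map_smul, ← map_add]
      congr 1
      rw [add_smul]; abel
    have h5 : A ⟨(v : H), v.2⟩ = f k := hv2
    rw [← h4]
    rw [← hv1] at *
    rw [← h5]
    nth_rewrite 4 [← h3]
    congr 1
    change _ = A ⟨(v : H), v.2⟩ + C ⟨(v : H), h1⟩ - z • (v : H)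
    abel
  have hlim0 : Tendsto (fun k => u (φ k)) atTop (𝓝 0) := by
    have h1 : Tendsto (fun k => T (f (φ k) - z • u (φ k))) atTop (𝓝 0) := by
      have := (T.continuous.tendsto 0).comp hlimφ
      simpa [Function.comp_def] using this
    have h2 := hlimφ.add (h1.add (hφT.const_smul (z + I)))
    have h3 := (R.continuous.tendsto _).comp h2
    simp only [smul_zero, add_zero, map_zero] at h3
    refine h3.congr fun k => ?_
    exact key (φ k)
  have h1 : Tendsto (fun k => ‖u (φ k)‖) atTop (𝓝 0) := by simpa using hlim0.norm
  simp only [hu.1] at h1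
  exact one_ne_zero (tendsto_nhds_unique tendsto_const_nhds h1)

/-- Singular sequences at every real point force the spectrum of a relatively compact symmetric
perturbation to be the real line. -/
theorem IsSelfAdjointOp.opSpectrum_add [CompleteSpace H] {A C : H →ₗ.[ℂ] H}
    (hA : IsSelfAdjointOp A) (hC : IsSymmetricGraph C.graph) (hAC : RelativelyCompact A C)
    (hsing : ∀ t : ℝ, ∃ u f : ℕ → H, Orthonormal ℂ u ∧ (∀ k, (u k, f k) ∈ A.graph) ∧
      Tendsto (fun k => f k - (t : ℂ) • u k) atTop (𝓝 0)) :
    opSpectrum (A + C) = Set.range ((↑) : ℝ → ℂ) := by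
  ext z
  constructor
  · intro hz
    by_contra hne
    refine hz (hA.mem_resolventSet_add hC hAC fun h0 => hne ⟨z.re, ?_⟩)
    exact Complex.ext (by simp) (by simp [h0])
  · rintro ⟨t, rfl⟩
    obtain ⟨u, f, hu, hf, hlim⟩ := hsing t
    exact hAC.not_mem_resolventSet_add hu hf hlim

end RelativelyCompact

/-! ### Maximal realizations -/

section MaximalRealization

open ComplexConjugate

variable {n : ℕ}

/-- Injectivity of `toDist` reduces membership in the graph to one equation whose two sides are
continuous in (u, f). Closedness of the realization follows at once. -/
theorem mem_graph_maximalRealization {T : 𝓢'(Space n, ℂ) →L[ℂ] 𝓢'(Space n, ℂ)} {u f : L2 n} :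
    (u, f) ∈ (maximalRealization n T).graph ↔ T (toDist n u) = toDist n f := by
  have key : ∀ v : (maximalRealization n T).domain,
      toDist n (maximalRealization n T v) = T (toDist n (v : L2 n)) := by
    intro v
    have h := LinearEquiv.apply_symm_apply
      (LinearEquiv.ofInjective (toDist n).toLinearMap (toDist_injective n))
      (((T ∘L toDist n).toLinearMap.comp (Submodule.subtype _)).codRestrict
        (LinearMap.range (toDist n).toLinearMap) (fun u => u.2) v)
    exact congrArg Subtype.val h
  rw [LinearPMap.mem_graph_iff]
  constructor
  · rintro ⟨v, hv, hf⟩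
    simp only at hv hf
    rw [← hv, ← hf, key]
  · intro h
    have hu : u ∈ (maximalRealization n T).domain := ⟨f, h.symm⟩
    refine ⟨⟨u, hu⟩, rfl, toDist_injective n ?_⟩
    rw [key]
    exact h

theorem isClosed_maximalRealization (T : 𝓢'(Space n, ℂ) →L[ℂ] 𝓢'(Space n, ℂ)) :
    (maximalRealization n T).IsClosed := by
  have : ((maximalRealization n T).graph : Set (L2 n × L2 n)) =
      {p | T (toDist n p.1) = toDist n p.2} := by
    ext p
    exact mem_graph_maximalRealization
  rw [LinearPMap.IsClosed, this]
  exact isClosed_eq (T.continuous.comp ((toDist n).continuous.comp continuous_fst))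
    ((toDist n).continuous.comp continuous_snd)

/-- The class in `L²` of a Schwartz function. -/
def schwartzL2 (n : ℕ) : 𝓢(Space n, ℂ) →L[ℂ] L2 n := SchwartzMap.toLpCLM ℂ ℂ 2 volume

theorem schwartzL2_apply (g : 𝓢(Space n, ℂ)) : schwartzL2 n g = g.toLp 2 volume := rfl

theorem coeFn_schwartzL2 (g : 𝓢(Space n, ℂ)) : schwartzL2 n g =ᵐ[volume] g :=
  g.coeFn_toLp 2 volume

theorem denseRange_schwartzL2 : DenseRange (schwartzL2 n) :=
  SchwartzMap.denseRange_toLpCLM (F := ℂ) (E := Space n) (p := 2) (μ := volume) (by simp)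

theorem toDist_schwartzL2 (g : 𝓢(Space n, ℂ)) :
    toDist n (schwartzL2 n g) = SchwartzMap.toTemperedDistributionCLM (Space n) ℂ volume g :=
  Lp.toTemperedDistribution_toLp_eq g

/-- Complex conjugation of Schwartz functions. -/
def schwartzConj (g : 𝓢(Space n, ℂ)) : 𝓢(Space n, ℂ) :=
  g.postcompCLM (conjCLE : ℂ →L[ℝ] ℂ)

@[simp]
theorem schwartzConj_apply (g : 𝓢(Space n, ℂ)) (x : Space n) :
    schwartzConj g x = conj (g x) := rfl

@[simp]
theorem schwartzConj_schwartzConj (g : 𝓢(Space n, ℂ)) : schwartzConj (schwartzConj g) = g := by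
  ext x; simp

/-- The distributional pairing is bilinear while the inner product is conjugate linear on the left;
conjugating the test function reconciles them. -/
theorem toDist_apply_schwartzConj (u : L2 n) (g : 𝓢(Space n, ℂ)) :
    toDist n u (schwartzConj g) = inner ℂ (schwartzL2 n g) u := by
  rw [L2.inner_def]
  change Lp.toTemperedDistribution u (schwartzConj g) = _
  rw [Lp.toTemperedDistribution_apply]
  refine integral_congr_ae ?_
  filter_upwards [coeFn_schwartzL2 g] with x hx
  rw [hx, schwartzConj_apply, smul_eq_mul, RCLike.inner_apply, mul_comm]

/-- `A` acts on Schwartz functions as the formal adjoint of the operator `T` on distributions. -/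
def IsFormalAdjoint (T : 𝓢'(Space n, ℂ) →L[ℂ] 𝓢'(Space n, ℂ))
    (A : 𝓢(Space n, ℂ) →L[ℂ] 𝓢(Space n, ℂ)) : Prop :=
  ∀ (φ : 𝓢'(Space n, ℂ)) (g : 𝓢(Space n, ℂ)), T φ (schwartzConj g) = φ (schwartzConj (A g))

/-- The maximal realization of T is the Hilbert space adjoint of A on Schwartz functions. Symmetry,
deficiency and unitary equivalence can therefore all be checked on Schwartz functions. -/
theorem IsFormalAdjoint.mem_graph_iff {T : 𝓢'(Space n, ℂ) →L[ℂ] 𝓢'(Space n, ℂ)}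
    {A : 𝓢(Space n, ℂ) →L[ℂ] 𝓢(Space n, ℂ)} (h : IsFormalAdjoint T A) {u f : L2 n} :
    (u, f) ∈ (maximalRealization n T).graph ↔
      ∀ g, inner ℂ (schwartzL2 n (A g)) u = inner ℂ (schwartzL2 n g) f := by
  rw [mem_graph_maximalRealization]
  constructor
  · intro hT g
    rw [← toDist_apply_schwartzConj, ← h, hT, toDist_apply_schwartzConj]
  · intro hT
    ext g
    have := hT (schwartzConj g)
    rw [← toDist_apply_schwartzConj, ← toDist_apply_schwartzConj, ← h,
      schwartzConj_schwartzConj] at this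
    exact this

theorem schwartzConj_add (f g : 𝓢(Space n, ℂ)) :
    schwartzConj (f + g) = schwartzConj f + schwartzConj g := by ext x; simp

theorem schwartzConj_sub (f g : 𝓢(Space n, ℂ)) :
    schwartzConj (f - g) = schwartzConj f - schwartzConj g := by ext x; simp

theorem schwartzConj_neg (f : 𝓢(Space n, ℂ)) :
    schwartzConj (-f) = -schwartzConj f := by ext x; simp

theorem schwartzConj_smul (c : ℂ) (f : 𝓢(Space n, ℂ)) :
    schwartzConj (c • f) = conj c • schwartzConj f := by ext x; simp

theorem schwartzConj_sum {ι : Type*} (s : Finset ι) (f : ι → 𝓢(Space n, ℂ)) :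
    schwartzConj (∑ i ∈ s, f i) = ∑ i ∈ s, schwartzConj (f i) :=
  map_sum (AddMonoidHom.mk' (schwartzConj (n := n)) schwartzConj_add) f s

open LineDeriv in
theorem schwartzConj_lineDerivOp (v : Space n) (f : 𝓢(Space n, ℂ)) :
    schwartzConj (∂_{v} f) = ∂_{v} (schwartzConj f) := by
  ext x
  have h : HasFDerivAt (schwartzConj f) ((conjCLE : ℂ →L[ℝ] ℂ) ∘L fderiv ℝ f x) x :=
    (conjCLE : ℂ →L[ℝ] ℂ).hasFDerivAt.comp x f.differentiableAt.hasFDerivAt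
  rw [schwartzConj_apply, SchwartzMap.lineDerivOp_apply_eq_fderiv,
    SchwartzMap.lineDerivOp_apply_eq_fderiv, h.fderiv]
  rfl

theorem schwartzConj_laplacian (f : 𝓢(Space n, ℂ)) :
    schwartzConj (Δ f) = Δ (schwartzConj f) := by
  rw [SchwartzMap.laplacian_eq_sum (EuclideanSpace.basisFun (Fin n) ℝ),
    SchwartzMap.laplacian_eq_sum (EuclideanSpace.basisFun (Fin n) ℝ), schwartzConj_sum]
  simp only [schwartzConj_lineDerivOp]

theorem schwartzConj_smulLeftCLM {V : Space n → ℝ}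
    (hV : (fun x => (V x : ℂ)).HasTemperateGrowth) (f : 𝓢(Space n, ℂ)) :
    schwartzConj (SchwartzMap.smulLeftCLM ℂ (fun x => (V x : ℂ)) f) =
      SchwartzMap.smulLeftCLM ℂ (fun x => (V x : ℂ)) (schwartzConj f) := by
  ext x
  simp [SchwartzMap.smulLeftCLM_apply_apply hV]

theorem smulLeftCLM_toTemperedDistributionCLM {V : Space n → ℂ} (hV : V.HasTemperateGrowth)
    (f : 𝓢(Space n, ℂ)) :
    TemperedDistribution.smulLeftCLM ℂ V
        (SchwartzMap.toTemperedDistributionCLM (Space n) ℂ volume f) =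
      SchwartzMap.toTemperedDistributionCLM (Space n) ℂ volume (SchwartzMap.smulLeftCLM ℂ V f) := by
  ext g
  simp only [TemperedDistribution.smulLeftCLM_apply_apply,
    SchwartzMap.toTemperedDistributionCLM_apply_apply]
  refine integral_congr_ae (Filter.Eventually.of_forall fun x => ?_)
  simp [SchwartzMap.smulLeftCLM_apply_apply hV, mul_comm, mul_left_comm]

end MaximalRealization

/-! ### The free expression on Schwartz functions -/

section FreeExpression

open ComplexConjugate

variable {n : ℕ}

theorem hasTemperateGrowth_japanese (n : ℕ) (α : ℝ) :
    (fun x : Space n => (japanese n α x : ℂ)).HasTemperateGrowth :=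
  Function.HasTemperateGrowth.comp Function.Complex.hasTemperateGrowth_ofReal
    (Function.hasTemperateGrowth_one_add_norm_sq_rpow _ _)

/-- The expression `-Δ - ⟨x⟩ ^ α` acting on Schwartz functions. -/
def freeSchwartz (n : ℕ) (α : ℝ) : 𝓢(Space n, ℂ) →L[ℂ] 𝓢(Space n, ℂ) :=
  -LineDeriv.laplacianCLM ℂ (Space n) 𝓢(Space n, ℂ)
    - SchwartzMap.smulLeftCLM ℂ (fun x => (japanese n α x : ℂ))

theorem freeSchwartz_eq (α : ℝ) (g : 𝓢(Space n, ℂ)) : freeSchwartz n α g =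
    -Δ g - SchwartzMap.smulLeftCLM ℂ (fun x => (japanese n α x : ℂ)) g := by
  have : LineDeriv.laplacianCLM ℂ (Space n) 𝓢(Space n, ℂ) g = Δ g := by
    rw [SchwartzMap.laplacian_eq_sum (stdOrthonormalBasis ℝ (Space n))]
    simp [LineDeriv.laplacianCLM]
  rw [← this]; rfl

theorem freeExpr_eq (α : ℝ) (φ : 𝓢'(Space n, ℂ)) : freeExpr n α φ =
    -Δ φ - TemperedDistribution.smulLeftCLM ℂ (fun x => (japanese n α x : ℂ)) φ := by
  rw [← TemperedDistribution.laplacianCLM_apply]; rfl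

theorem isFormalAdjoint_freeExpr (n : ℕ) (α : ℝ) :
    IsFormalAdjoint (freeExpr n α) (freeSchwartz n α) := by
  intro φ g
  rw [freeExpr_eq, freeSchwartz_eq, schwartzConj_sub, schwartzConj_neg, schwartzConj_laplacian,
    schwartzConj_smulLeftCLM (hasTemperateGrowth_japanese n α), map_sub, map_neg]
  rw [← TemperedDistribution.laplacian_apply_apply, ← TemperedDistribution.smulLeftCLM_apply_apply]
  rfl

theorem schwartz_mem_graph_free (α : ℝ) (g : 𝓢(Space n, ℂ)) :
    (schwartzL2 n g, schwartzL2 n (freeSchwartz n α g)) ∈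
      (maximalRealization n (freeExpr n α)).graph := by
  rw [mem_graph_maximalRealization, toDist_schwartzL2, toDist_schwartzL2, freeExpr_eq,
    freeSchwartz_eq, TemperedDistribution.laplacian_toTemperedDistributionCLM_eq,
    smulLeftCLM_toTemperedDistributionCLM (hasTemperateGrowth_japanese n α), map_sub, map_neg]

theorem schwartz_mem_oscillatorDomain (g : 𝓢(Space n, ℂ)) :
    schwartzL2 n g ∈ oscillatorDomain n := by
  constructor
  · change TemperedDistribution.MemSobolev 2 2 (toDist n (schwartzL2 n g))
    rw [toDist_schwartzL2]
    exact g.memSobolev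
  · refine mem_mulDomain.mpr ?_
    have h := (SchwartzMap.smulLeftCLM ℂ (fun x => (japanese n 2 x : ℂ)) g).memLp 2 volume
    refine (memLp_congr_ae ?_).mpr h
    filter_upwards [coeFn_schwartzL2 g] with x hx
    rw [hx, SchwartzMap.smulLeftCLM_apply_apply (hasTemperateGrowth_japanese n 2), smul_eq_mul]

end FreeExpression

open scoped ContDiff FourierTransform

/-! ### Schwartz functions of Gaussian type. -/

section Gaussian

variable {E : Type*} [NormedAddCommGroup E] [NormedSpace ℝ E]

/-- Use y^N / N! ≤ e^y at y = p(1 + r²), together with 1 + r ≤ 2(1 + r²). -/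
theorem exists_one_add_pow_le_exp_sq {p : ℝ} (hp : 0 < p) (N : ℕ) :
    ∃ C : ℝ, 0 ≤ C ∧ ∀ r : ℝ, 0 ≤ r → (1 + r) ^ N ≤ C * Real.exp (p * r ^ 2) := by
  refine ⟨2 ^ N * (N.factorial * Real.exp p / p ^ N), by positivity, fun r hr => ?_⟩
  have h1 := Real.pow_div_factorial_le_exp (p * (1 + r ^ 2)) (by positivity) N
  have h2 : 1 + r ≤ 2 * (1 + r ^ 2) := by nlinarith [sq_nonneg (r - 1)]
  have h3 : (1 + r ^ 2) ^ N ≤ N.factorial * Real.exp p / p ^ N * Real.exp (p * r ^ 2) := by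
    rw [div_le_iff₀ (by positivity), mul_pow, mul_add, mul_one, Real.exp_add] at h1
    rw [div_mul_eq_mul_div, le_div_iff₀ (by positivity)]
    linarith
  calc (1 + r) ^ N ≤ (2 * (1 + r ^ 2)) ^ N := by gcongr
    _ = 2 ^ N * (1 + r ^ 2) ^ N := mul_pow _ _ _
    _ ≤ 2 ^ N * (N.factorial * Real.exp p / p ^ N * Real.exp (p * r ^ 2)) := by gcongr
    _ = _ := by ring

/-- The Schwartz function `exp (-Q)` for a smooth `Q` of temperate growth that is bounded below by a
positive multiple of the squared norm. -/
def schwartzExpNeg (Q : E → ℝ) (hQ : Q.HasTemperateGrowth) (p : ℝ) (hp : 0 < p)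
    (hpQ : ∀ x, p * ‖x‖ ^ 2 ≤ Q x) : 𝓢(E, ℝ) where
  toFun x := Real.exp (-Q x)
  smooth' := Real.contDiff_exp.comp hQ.1.neg
  decay' k m := by
    have hsm : ContDiff ℝ ∞ (fun x => -Q x) := hQ.1.neg
    obtain ⟨l, C, hC, hb⟩ := hQ.neg.norm_iteratedFDeriv_le_uniform m
    obtain ⟨C', hC', hexp⟩ := exists_one_add_pow_le_exp_sq hp (k + l * m)
    refine ⟨m.factorial * (1 + C) ^ m * C', fun x => ?_⟩
    -- The Faà di Bruno bound requires the i-th derivative of Q to be dominated by the i-th power of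
    -- a single base. Taking 1 + C in place of C keeps that base at least 1.
    have h1 : ‖iteratedFDeriv ℝ m (Real.exp ∘ fun x => -Q x) x‖ ≤
        m.factorial * Real.exp (-Q x) * ((1 + C) * (1 + ‖x‖) ^ l) ^ m := by
      refine norm_iteratedFDeriv_comp_le Real.contDiff_exp hsm (by exact_mod_cast le_top) x
        (fun i _ => ?_) (fun i hi hi' => ?_)
      · rw [norm_iteratedFDeriv_eq_norm_iteratedDeriv, iteratedDeriv_eq_iterate,
          Real.iter_deriv_exp, Real.norm_eq_abs, abs_of_pos (Real.exp_pos _)]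
      · have h2 : 1 ≤ (1 + ‖x‖) ^ l := one_le_pow₀ (by linarith [norm_nonneg x])
        calc ‖iteratedFDeriv ℝ i (fun x => -Q x) x‖ ≤ C * (1 + ‖x‖) ^ l := hb i hi' x
          _ ≤ (1 + C) * (1 + ‖x‖) ^ l := by gcongr; linarith
          _ ≤ _ := le_self_pow₀ (by nlinarith) (by omega)
    have h3 : Real.exp (-Q x) ≤ Real.exp (-(p * ‖x‖ ^ 2)) := Real.exp_le_exp.mpr (by linarith [hpQ x])
    have h4 : ‖x‖ ^ k ≤ (1 + ‖x‖) ^ k := by gcongr; linarith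
    calc ‖x‖ ^ k * ‖iteratedFDeriv ℝ m (Real.exp ∘ fun x => -Q x) x‖
        ≤ (1 + ‖x‖) ^ k * (m.factorial * Real.exp (-(p * ‖x‖ ^ 2)) *
          ((1 + C) * (1 + ‖x‖) ^ l) ^ m) := by
          refine mul_le_mul h4 (h1.trans ?_) (norm_nonneg _) (by positivity)
          gcongr
      _ = m.factorial * (1 + C) ^ m * ((1 + ‖x‖) ^ (k + l * m) * Real.exp (-(p * ‖x‖ ^ 2))) := by
          rw [mul_pow, pow_add, pow_mul]; ring
      _ ≤ m.factorial * (1 + C) ^ m * (C' * Real.exp (p * ‖x‖ ^ 2) * Real.exp (-(p * ‖x‖ ^ 2))) := by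
          gcongr
          exact hexp _ (norm_nonneg x)
      _ = _ := by rw [mul_assoc C', ← Real.exp_add, add_neg_cancel, Real.exp_zero, mul_one]

end Gaussian

/-! ### Essential self-adjointness -/

section Kernel

variable {n : ℕ}

/-- The exponent of the regularizing Gaussian kernel. -/
def kernelExponent (p q : ℝ) (x y : Space n) : ℝ :=
  p * ‖x‖ ^ 2 + p * ‖y‖ ^ 2 + q * ‖x - y‖ ^ 2

theorem kernelExponent_comm (p q : ℝ) (x y : Space n) :
    kernelExponent p q x y = kernelExponent p q y x := by
  rw [kernelExponent, kernelExponent, norm_sub_rev]; ring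

/-- The regularizing Gaussian kernel. -/
def kernel (p q : ℝ) (x y : Space n) : ℝ := Real.exp (-kernelExponent p q x y)

theorem kernel_comm (p q : ℝ) (x y : Space n) : kernel p q x y = kernel p q y x := by
  rw [kernel, kernel, kernelExponent_comm]

theorem hasTemperateGrowth_kernelExponent (p q : ℝ) (y : Space n) :
    (fun x => kernelExponent p q x y).HasTemperateGrowth := by
  have h : (fun x : Space n => ‖x - y‖ ^ 2).HasTemperateGrowth :=
    (Function.hasTemperateGrowth_norm_sq (Space n)).comp (f := fun x => x - y) (by fun_prop)
  unfold kernelExponent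
  have h1 := Function.hasTemperateGrowth_norm_sq (Space n)
  fun_prop

/-- The kernel as a Schwartz function of its first variable. -/
def kernelSchwartz {p q : ℝ} (hp : 0 < p) (hq : 0 < q) (y : Space n) : 𝓢(Space n, ℂ) :=
  (schwartzExpNeg (fun x => kernelExponent p q x y) (hasTemperateGrowth_kernelExponent p q y) p hp
    (fun x => by
      rw [kernelExponent]
      have h1 : 0 ≤ p * ‖y‖ ^ 2 := by positivity
      have h2 : 0 ≤ q * ‖x - y‖ ^ 2 := by positivity
      linarith)).postcompCLM ofRealCLM

theorem kernelSchwartz_apply {p q : ℝ} (hp : 0 < p) (hq : 0 < q) (x y : Space n) :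
    kernelSchwartz hp hq y x = (kernel p q x y : ℂ) := rfl

theorem hasFDerivAt_kernelExponent (p q : ℝ) (x y : Space n) :
    HasFDerivAt (fun x => kernelExponent p q x y)
      (innerSL ℝ ((2 * p) • x + (2 * q) • (x - y))) x := by
  have h1 : HasFDerivAt (fun x : Space n => ‖x‖ ^ 2) (2 • innerSL ℝ x) x :=
    (hasStrictFDerivAt_norm_sq x).hasFDerivAt
  have h2 : HasFDerivAt (fun x : Space n => ‖x - y‖ ^ 2) (2 • innerSL ℝ (x - y)) x := by
    have := (hasStrictFDerivAt_norm_sq (x - y)).hasFDerivAt.comp x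
      ((hasFDerivAt_id x).sub_const y)
    simpa using! this
  have h3 := ((h1.const_mul p).add_const (p * ‖y‖ ^ 2)).add (h2.const_mul q)
  refine h3.congr_fderiv ?_
  ext v
  simp
  ring

open LineDeriv in
theorem lineDerivOp_kernelSchwartz {p q : ℝ} (hp : 0 < p) (hq : 0 < q) (x y v : Space n) :
    (∂_{v} (kernelSchwartz hp hq y)) x =
      ((-inner ℝ ((2 * p) • x + (2 * q) • (x - y)) v : ℝ) : ℂ) * kernelSchwartz hp hq y x := by
  have h1 : HasFDerivAt (fun x => kernel p q x y)
      (kernel p q x y • (-innerSL ℝ ((2 * p) • x + (2 * q) • (x - y)))) x :=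
    (hasFDerivAt_kernelExponent p q x y).neg.exp
  have h2 : HasFDerivAt (kernelSchwartz hp hq y)
      (ofRealCLM ∘L (kernel p q x y • (-innerSL ℝ ((2 * p) • x + (2 * q) • (x - y))))) x :=
    ofRealCLM.hasFDerivAt.comp x h1
  rw [SchwartzMap.lineDerivOp_apply_eq_fderiv, h2.fderiv, kernelSchwartz_apply]
  generalize (2 * p) • x + (2 * q) • (x - y) = w
  simp [mul_comm]

open LineDeriv in
theorem lineDerivOp_lineDerivOp_kernelSchwartz {p q : ℝ} (hp : 0 < p) (hq : 0 < q)
    (x y v : Space n) :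
    (∂_{v} (∂_{v} (kernelSchwartz hp hq y))) x =
      (((inner ℝ ((2 * p) • x + (2 * q) • (x - y)) v) ^ 2 - (2 * p + 2 * q) * ‖v‖ ^ 2 : ℝ) : ℂ) *
        kernelSchwartz hp hq y x := by
  have h0 : ⇑(∂_{v} (kernelSchwartz hp hq y) : 𝓢(Space n, ℂ)) = fun x =>
      ((-inner ℝ ((2 * p) • x + (2 * q) • (x - y)) v : ℝ) : ℂ) * kernelSchwartz hp hq y x :=
    funext fun x => lineDerivOp_kernelSchwartz hp hq x y v
  rw [SchwartzMap.lineDerivOp_apply_eq_fderiv, h0]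
  have h1 : HasFDerivAt (fun x : Space n => (-inner ℝ ((2 * p) • x + (2 * q) • (x - y)) v : ℝ))
      (-((2 * p + 2 * q) • innerSL ℝ v)) x := by
    have : (fun x : Space n => (-inner ℝ ((2 * p) • x + (2 * q) • (x - y)) v : ℝ)) =
        fun x => (-((2 * p + 2 * q) • innerSL ℝ v)) x + (2 * q) * inner ℝ y v := by
      funext x
      simp [inner_add_left, inner_sub_left, inner_smul_left, real_inner_comm v x]
      ring
    rw [this]
    exact (ContinuousLinearMap.hasFDerivAt _).add_const _
  have h2 := (ofRealCLM.hasFDerivAt.comp x h1).mul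
    (kernelSchwartz hp hq y).differentiableAt.hasFDerivAt
  have h3 := lineDerivOp_kernelSchwartz hp hq x y v
  rw [SchwartzMap.lineDerivOp_apply_eq_fderiv] at h3
  have h4 := h2.fderiv
  simp only [Function.comp_def, ofRealCLM_apply] at h4
  change fderiv ℝ (fun x => ((-inner ℝ ((2 * p) • x + (2 * q) • (x - y)) v : ℝ) : ℂ) *
    kernelSchwartz hp hq y x) x v = _
  erw [h4]
  simp [h3]
  ring

/-- The symbol of the free expression conjugated by the Gaussian kernel, up to a constant. -/
def kernelSymbol (α p q : ℝ) (x y : Space n) : ℝ :=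
  ‖(2 * p) • x + (2 * q) • (x - y)‖ ^ 2 + japanese n α x

/-- Δe^{-Q} = (|∇Q|² - ΔQ)e^{-Q}, and for the quadratic exponent ΔQ is the constant (2p + 2q)n,
which will cancel in the commutator. -/
theorem freeSchwartz_kernelSchwartz (α : ℝ) {p q : ℝ} (hp : 0 < p) (hq : 0 < q) (x y : Space n) :
    freeSchwartz n α (kernelSchwartz hp hq y) x =
      ((-(kernelSymbol α p q x y - (2 * p + 2 * q) * n) * kernel p q x y : ℝ) : ℂ) := by
  rw [freeSchwartz_eq, SchwartzMap.laplacian_eq_sum (EuclideanSpace.basisFun (Fin n) ℝ)]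
  have h := (EuclideanSpace.basisFun (Fin n) ℝ).sum_sq_norm_inner_left
    ((2 * p) • x + (2 * q) • (x - y))
  simp only [sub_apply, neg_apply, sum_apply,
    SchwartzMap.smulLeftCLM_apply_apply (hasTemperateGrowth_japanese n α),
    lineDerivOp_lineDerivOp_kernelSchwartz]
  rw [← Finset.sum_mul, kernelSchwartz_apply, ← ofReal_sum, Finset.sum_sub_distrib, kernelSymbol]
  simp only [Real.norm_eq_abs, sq_abs] at h
  rw [h]
  simp
  ring

/-- Antisymmetrization removes the terms in q². With pq = 1 and p ≤ 1 the remaining coefficients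
stay bounded, however sharply the kernel concentrates on the diagonal. -/
theorem kernelSymbol_sub (α p q : ℝ) (x y : Space n) :
    kernelSymbol α p q x y - kernelSymbol α p q y x =
      (4 * p ^ 2 + 8 * p * q) * (‖x‖ ^ 2 - ‖y‖ ^ 2) + (japanese n α x - japanese n α y) := by
  simp only [kernelSymbol, ← real_inner_self_eq_norm_sq, inner_add_left, inner_add_right,
    inner_sub_left, inner_sub_right, real_inner_smul_left, real_inner_smul_right,
    real_inner_comm y x]
  ring

/-- The power s^(α/2) is 1-Lipschitz on [1, ∞) because α/2 ≤ 1. This is the decisive use of α ≤ 2 in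
the proof of self-adjointness. -/
theorem abs_japanese_sub_le {α : ℝ} (hα : 0 < α) (hα2 : α ≤ 2) (x y : Space n) :
    |japanese n α x - japanese n α y| ≤ |‖x‖ ^ 2 - ‖y‖ ^ 2| := by
  have key : ∀ a b : ℝ, 1 ≤ a → a ≤ b → b ^ (α / 2) - a ^ (α / 2) ≤ b - a := by
    intro a b ha hab
    have h0 : 0 < a := by linarith
    have h1 : (b / a) ^ (α / 2) ≤ b / a := by
      have : 1 ≤ b / a := (one_le_div h0).mpr hab
      calc (b / a) ^ (α / 2) ≤ (b / a) ^ (1 : ℝ) :=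
            Real.rpow_le_rpow_of_exponent_le this (by linarith)
        _ = b / a := Real.rpow_one _
    have h2 : a ^ (α / 2) ≤ a := by
      calc a ^ (α / 2) ≤ a ^ (1 : ℝ) := Real.rpow_le_rpow_of_exponent_le ha (by linarith)
        _ = a := Real.rpow_one _
    have h3 : b ^ (α / 2) = a ^ (α / 2) * (b / a) ^ (α / 2) := by
      rw [← Real.mul_rpow h0.le (div_nonneg (by linarith) h0.le), mul_div_cancel₀ _ h0.ne']
    have h4 : 0 ≤ a ^ (α / 2) := Real.rpow_nonneg h0.le _
    have h5 : 0 ≤ b / a - 1 := by linarith [(one_le_div h0).mpr hab]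
    calc b ^ (α / 2) - a ^ (α / 2) = a ^ (α / 2) * ((b / a) ^ (α / 2) - 1) := by rw [h3]; ring
      _ ≤ a ^ (α / 2) * (b / a - 1) := by gcongr
      _ ≤ a * (b / a - 1) := by gcongr
      _ = b - a := by field_simp
  have mono : ∀ a b : ℝ, 1 ≤ a → a ≤ b → a ^ (α / 2) ≤ b ^ (α / 2) := fun a b ha hab =>
    Real.rpow_le_rpow (by linarith) hab (by linarith)
  have hx : 1 ≤ 1 + ‖x‖ ^ 2 := by nlinarith [norm_nonneg x]
  have hy : 1 ≤ 1 + ‖y‖ ^ 2 := by nlinarith [norm_nonneg y]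
  unfold japanese
  rcases le_total (‖x‖ ^ 2) (‖y‖ ^ 2) with h | h
  · have h1 := key _ _ hx (by linarith : 1 + ‖x‖ ^ 2 ≤ 1 + ‖y‖ ^ 2)
    have h2 := mono _ _ hx (by linarith : 1 + ‖x‖ ^ 2 ≤ 1 + ‖y‖ ^ 2)
    rw [abs_of_nonpos (by linarith), abs_of_nonpos (by linarith)]
    linarith
  · have h1 := key _ _ hy (by linarith : 1 + ‖y‖ ^ 2 ≤ 1 + ‖x‖ ^ 2)
    have h2 := mono _ _ hy (by linarith : 1 + ‖y‖ ^ 2 ≤ 1 + ‖x‖ ^ 2)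
    rw [abs_of_nonneg (by linarith), abs_of_nonneg (by linarith)]
    linarith

theorem abs_kernelSymbol_sub_le {α : ℝ} (hα : 0 < α) (hα2 : α ≤ 2) {p q : ℝ} (hp : 0 < p)
    (hp1 : p ≤ 1) (hpq : p * q = 1) (x y : Space n) :
    |kernelSymbol α p q x y - kernelSymbol α p q y x| ≤ 13 * |‖x‖ ^ 2 - ‖y‖ ^ 2| := by
  rw [kernelSymbol_sub]
  have h1 := abs_japanese_sub_le hα hα2 x y
  -- 4 from p ≤ 1 and 8 from pq = 1; the potential adds 1, which makes 13.
  have h2 : 4 * p ^ 2 + 8 * p * q ≤ 12 := by nlinarith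
  have h3 : 0 ≤ 4 * p ^ 2 + 8 * p * q := by nlinarith
  calc _ ≤ |(4 * p ^ 2 + 8 * p * q) * (‖x‖ ^ 2 - ‖y‖ ^ 2)| + |japanese n α x - japanese n α y| :=
        abs_add_le _ _
    _ ≤ 12 * |‖x‖ ^ 2 - ‖y‖ ^ 2| + |‖x‖ ^ 2 - ‖y‖ ^ 2| := by
        rw [abs_mul, abs_of_nonneg h3]; gcongr
    _ = _ := by ring

end Kernel

/-! ### Integrability against the Gaussian kernel. -/

section KernelIntegrals

open Filter Topology ComplexConjugate

variable {n : ℕ}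

theorem integrable_exp_neg_mul_norm_sq {p : ℝ} (hp : 0 < p) :
    Integrable (fun x : Space n => Real.exp (-(p * ‖x‖ ^ 2))) :=
  (schwartzExpNeg (fun x : Space n => p * ‖x‖ ^ 2)
    (by have := Function.hasTemperateGrowth_norm_sq (Space n); fun_prop) p hp
    (fun _ => le_rfl)).integrable

theorem memLp_exp_neg_mul_norm_sq {p : ℝ} (hp : 0 < p) :
    MemLp (fun x : Space n => Real.exp (-(p * ‖x‖ ^ 2))) 2 volume :=
  (schwartzExpNeg (fun x : Space n => p * ‖x‖ ^ 2)
    (by have := Function.hasTemperateGrowth_norm_sq (Space n); fun_prop) p hp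
    (fun _ => le_rfl)).memLp 2 volume

theorem continuous_kernel (p q : ℝ) :
    Continuous (fun z : Space n × Space n => kernel p q z.1 z.2) := by
  unfold kernel kernelExponent; fun_prop

theorem kernel_pos (p q : ℝ) (x y : Space n) : 0 < kernel p q x y := Real.exp_pos _

theorem kernel_le {p q : ℝ} (hq : 0 < q) (x y : Space n) :
    kernel p q x y ≤ Real.exp (-(p * ‖x‖ ^ 2)) * Real.exp (-(p * ‖y‖ ^ 2)) := by
  rw [kernel, kernelExponent, ← Real.exp_add]
  refine Real.exp_le_exp.mpr ?_
  have : 0 ≤ q * ‖x - y‖ ^ 2 := by positivity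
  linarith

/-- A weight that the Gaussian kernel dominates. -/
def IsKernelWeight (p : ℝ) (M : Space n × Space n → ℝ) : Prop :=
  Continuous M ∧ ∃ C, 0 ≤ C ∧
    ∀ z, |M z| ≤ C * (Real.exp (p / 2 * ‖z.1‖ ^ 2) * Real.exp (p / 2 * ‖z.2‖ ^ 2))

theorem IsKernelWeight.of_pow {p : ℝ} (hp : 0 < p) {M : Space n × Space n → ℝ} (hM : Continuous M)
    {C : ℝ} (hC : 0 ≤ C) (h : ∀ z, |M z| ≤ C * ((1 + ‖z.1‖) ^ 2 * (1 + ‖z.2‖) ^ 2)) :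
    IsKernelWeight p M := by
  obtain ⟨C', hC', hb⟩ := exists_one_add_pow_le_exp_sq (half_pos hp) 2
  refine ⟨hM, C * (C' * C'), by positivity, fun z => (h z).trans ?_⟩
  rw [mul_assoc]
  refine mul_le_mul_of_nonneg_left ?_ hC
  calc _ ≤ (C' * Real.exp (p / 2 * ‖z.1‖ ^ 2)) * (C' * Real.exp (p / 2 * ‖z.2‖ ^ 2)) :=
        mul_le_mul (hb _ (norm_nonneg _)) (hb _ (norm_nonneg _)) (by positivity) (by positivity)
    _ = _ := by ring

theorem IsKernelWeight.abs_mul_kernel_le {p q : ℝ} (hq : 0 < q) {M : Space n × Space n → ℝ}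
    {C : ℝ} (hC : 0 ≤ C)
    (h : ∀ z, |M z| ≤ C * (Real.exp (p / 2 * ‖z.1‖ ^ 2) * Real.exp (p / 2 * ‖z.2‖ ^ 2)))
    (z : Space n × Space n) :
    |M z * kernel p q z.1 z.2| ≤
      C * (Real.exp (-(p / 2 * ‖z.1‖ ^ 2)) * Real.exp (-(p / 2 * ‖z.2‖ ^ 2))) := by
  rw [abs_mul, abs_of_pos (kernel_pos _ _ _ _)]
  -- Half of the Gaussian decay pays for the weight; the other half is kept for integrability.
  calc _ ≤ (C * (Real.exp (p / 2 * ‖z.1‖ ^ 2) * Real.exp (p / 2 * ‖z.2‖ ^ 2))) *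
        (Real.exp (-(p * ‖z.1‖ ^ 2)) * Real.exp (-(p * ‖z.2‖ ^ 2))) :=
        mul_le_mul (h z) (kernel_le hq _ _) (kernel_pos _ _ _ _).le (by positivity)
    _ = C * (Real.exp (p / 2 * ‖z.1‖ ^ 2 + -(p * ‖z.1‖ ^ 2)) *
        Real.exp (p / 2 * ‖z.2‖ ^ 2 + -(p * ‖z.2‖ ^ 2))) := by
        rw [Real.exp_add, Real.exp_add]; ring
    _ = _ := by congr 3 <;> ring

theorem IsKernelWeight.integrable_mul {p q : ℝ} (hp : 0 < p) (hq : 0 < q)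
    {M : Space n × Space n → ℝ} (hM : IsKernelWeight p M) (u : L2 n) :
    Integrable (fun z : Space n × Space n =>
      ((M z * kernel p q z.1 z.2 : ℝ) : ℂ) * (u z.1 * conj (u z.2))) (volume.prod volume) := by
  obtain ⟨hMc, C, hC, h⟩ := hM
  have hG : Integrable (fun x : Space n => Real.exp (-(p / 2 * ‖x‖ ^ 2)) * ‖u x‖) :=
    (memLp_exp_neg_mul_norm_sq (half_pos hp)).integrable_mul (Lp.memLp u).norm
  have hGG := (hG.mul_prod hG).const_mul C
  have hu := Lp.stronglyMeasurable u
  have hu1 : StronglyMeasurable (fun z : Space n × Space n => u z.1) :=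
    hu.comp_measurable measurable_fst
  have hu2 : StronglyMeasurable (fun z : Space n × Space n => conj (u z.2)) :=
    continuous_conj.comp_stronglyMeasurable (hu.comp_measurable measurable_snd)
  refine hGG.mono' ?_ (Eventually.of_forall fun z => ?_)
  · refine StronglyMeasurable.aestronglyMeasurable ?_
    have hK : Continuous (fun z : Space n × Space n => ((M z * kernel p q z.1 z.2 : ℝ) : ℂ)) :=
      continuous_ofReal.comp (hMc.mul (continuous_kernel p q))
    exact hK.stronglyMeasurable.mul (hu1.mul hu2)
  · rw [norm_mul, norm_mul, RCLike.norm_conj, norm_real, Real.norm_eq_abs]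
    have := IsKernelWeight.abs_mul_kernel_le hq hC h z
    calc _ ≤ C * (Real.exp (-(p / 2 * ‖z.1‖ ^ 2)) * Real.exp (-(p / 2 * ‖z.2‖ ^ 2))) *
          (‖u z.1‖ * ‖u z.2‖) := by gcongr
      _ = _ := by ring

theorem integrable_norm_sq (u : L2 n) : Integrable (fun x => ‖u x‖ ^ 2) :=
  (Lp.memLp u).integrable_norm_pow (by norm_num)

theorem integral_norm_sq (u : L2 n) : ∫ x, ‖u x‖ ^ 2 = ‖u‖ ^ 2 := by
  have h := L2.inner_def (𝕜 := ℂ) u u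
  rw [inner_self_eq_norm_sq_to_K] at h
  have h2 : ∀ x, (inner ℂ (u x) (u x) : ℂ) = ((‖u x‖ ^ 2 : ℝ) : ℂ) := fun x => by
    rw [inner_self_eq_norm_sq_to_K]; push_cast; rfl
  simp only [h2] at h
  rw [integral_complex_ofReal] at h
  exact Complex.ofReal_injective (by rw [← h]; push_cast; rfl)

theorem IsKernelWeight.integrable_mul_sq {p q : ℝ} (hp : 0 < p) (hq : 0 < q)
    {M : Space n × Space n → ℝ} (hM : IsKernelWeight p M) (u : L2 n) :
    Integrable (fun z : Space n × Space n => (M z * kernel p q z.1 z.2) * ‖u z.1‖ ^ 2)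
      (volume.prod volume) := by
  obtain ⟨hMc, C, hC, h⟩ := hM
  have hGG := ((integrable_norm_sq u).mul_prod
    (integrable_exp_neg_mul_norm_sq (n := n) (half_pos hp))).const_mul C
  have hu1 : StronglyMeasurable (fun z : Space n × Space n => u z.1) :=
    (Lp.stronglyMeasurable u).comp_measurable measurable_fst
  refine hGG.mono' ?_ (Eventually.of_forall fun z => ?_)
  · refine StronglyMeasurable.aestronglyMeasurable ?_
    exact (hMc.mul (continuous_kernel p q)).stronglyMeasurable.mul (hu1.norm.pow 2)
  · rw [norm_mul, Real.norm_eq_abs, Real.norm_eq_abs, abs_of_nonneg (sq_nonneg ‖u z.1‖)]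
    have := IsKernelWeight.abs_mul_kernel_le hq hC h z
    have h1 : Real.exp (-(p / 2 * ‖z.1‖ ^ 2)) ≤ 1 :=
      Real.exp_le_one_iff.mpr (by have : 0 ≤ p / 2 * ‖z.1‖ ^ 2 := by positivity
                                  linarith)
    calc _ ≤ C * (Real.exp (-(p / 2 * ‖z.1‖ ^ 2)) * Real.exp (-(p / 2 * ‖z.2‖ ^ 2))) *
          ‖u z.1‖ ^ 2 := by gcongr
      _ ≤ C * (1 * Real.exp (-(p / 2 * ‖z.2‖ ^ 2))) * ‖u z.1‖ ^ 2 := by gcongr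
      _ = _ := by ring

theorem IsKernelWeight.const {p : ℝ} (hp : 0 < p) (c : ℝ) :
    IsKernelWeight p (fun _ : Space n × Space n => c) := by
  refine .of_pow hp continuous_const (abs_nonneg c) fun z => ?_
  have h1 : 1 ≤ (1 + ‖z.1‖) ^ 2 := one_le_pow₀ (by linarith [norm_nonneg z.1])
  have h2 : 1 ≤ (1 + ‖z.2‖) ^ 2 := one_le_pow₀ (by linarith [norm_nonneg z.2])
  exact le_mul_of_one_le_right (abs_nonneg c) (one_le_mul_of_one_le_of_one_le h1 h2)

theorem IsKernelWeight.add {p : ℝ} {M N : Space n × Space n → ℝ} (hM : IsKernelWeight p M)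
    (hN : IsKernelWeight p N) : IsKernelWeight p (fun z => M z + N z) := by
  obtain ⟨h1, C, hC, h2⟩ := hM
  obtain ⟨h3, D, hD, h4⟩ := hN
  refine ⟨h1.add h3, C + D, by positivity, fun z => (abs_add_le _ _).trans ?_⟩
  rw [add_mul]
  exact add_le_add (h2 z) (h4 z)

theorem IsKernelWeight.neg {p : ℝ} {M : Space n × Space n → ℝ} (hM : IsKernelWeight p M) :
    IsKernelWeight p (fun z => -M z) := by
  obtain ⟨h1, C, hC, h2⟩ := hM
  exact ⟨h1.neg, C, hC, fun z => by rw [abs_neg]; exact h2 z⟩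

theorem IsKernelWeight.swap {p : ℝ} {M : Space n × Space n → ℝ} (hM : IsKernelWeight p M) :
    IsKernelWeight p (fun z => M z.swap) := by
  obtain ⟨h1, C, hC, h2⟩ := hM
  exact ⟨h1.comp continuous_swap, C, hC, fun z => by
    rw [mul_comm (Real.exp _)]; exact h2 z.swap⟩

theorem continuous_japanese (n : ℕ) (α : ℝ) : Continuous (japanese n α) := by
  unfold japanese
  exact Continuous.rpow_const (by fun_prop) fun x => Or.inl (by positivity)

theorem japanese_nonneg (α : ℝ) (x : Space n) : 0 ≤ japanese n α x :=
  Real.rpow_nonneg (by positivity) _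

theorem japanese_le {α : ℝ} (hα2 : α ≤ 2) (x : Space n) : japanese n α x ≤ 1 + ‖x‖ ^ 2 := by
  unfold japanese
  calc (1 + ‖x‖ ^ 2) ^ (α / 2) ≤ (1 + ‖x‖ ^ 2) ^ (1 : ℝ) :=
        Real.rpow_le_rpow_of_exponent_le (by nlinarith [norm_nonneg x]) (by linarith)
    _ = _ := Real.rpow_one _

theorem isKernelWeight_kernelSymbol {α : ℝ} (hα2 : α ≤ 2) {p q : ℝ} (hp : 0 < p) (hq : 0 < q) :
    IsKernelWeight p (fun z : Space n × Space n => kernelSymbol α p q z.1 z.2) := by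
  refine .of_pow hp (C := (2 * p + 2 * q) ^ 2 + 1) ?_ (by positivity) fun z => ?_
  · unfold kernelSymbol
    have := continuous_japanese n α
    fun_prop
  · have h0 := japanese_nonneg α z.1
    have h1 := japanese_le hα2 z.1
    have hx := norm_nonneg z.1
    have hy := norm_nonneg z.2
    have h2 : ‖(2 * p) • z.1 + (2 * q) • (z.1 - z.2)‖ ≤
        (2 * p + 2 * q) * ((1 + ‖z.1‖) * (1 + ‖z.2‖)) := by
      calc _ ≤ ‖(2 * p) • z.1‖ + ‖(2 * q) • (z.1 - z.2)‖ := norm_add_le _ _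
        _ ≤ 2 * p * ‖z.1‖ + 2 * q * (‖z.1‖ + ‖z.2‖) := by
            rw [norm_smul, norm_smul, Real.norm_of_nonneg (by positivity),
              Real.norm_of_nonneg (by positivity)]
            gcongr
            exact norm_sub_le _ _
        _ ≤ 2 * p * ((1 + ‖z.1‖) * (1 + ‖z.2‖)) + 2 * q * ((1 + ‖z.1‖) * (1 + ‖z.2‖)) := by
            gcongr <;> nlinarith [mul_nonneg hx hy]
        _ = _ := by ring
    have h3 : 1 ≤ (1 + ‖z.2‖) ^ 2 := one_le_pow₀ (by linarith)
    rw [kernelSymbol, abs_of_nonneg (by positivity)]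
    calc _ ≤ ((2 * p + 2 * q) * ((1 + ‖z.1‖) * (1 + ‖z.2‖))) ^ 2 +
          (1 + ‖z.1‖) ^ 2 * (1 + ‖z.2‖) ^ 2 := by
          gcongr
          have : 0 ≤ (1 + ‖z.1‖) ^ 2 := by positivity
          nlinarith
      _ = _ := by ring

end KernelIntegrals

/-! ### The commutator identity for deficiency vectors. -/

section Deficiency

open Filter Topology ComplexConjugate

variable {n : ℕ}

/-- The kernel identity satisfied by a deficiency vector: the commutator with the regularizing kernel
controls the regularized norm. -/
theorem deficiency_identity {α : ℝ} (hα2 : α ≤ 2) {p q : ℝ} (hp : 0 < p)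
    (hq : 0 < q) {z : ℂ} {u : L2 n}
    (hu : ∀ g, inner ℂ (schwartzL2 n (freeSchwartz n α g - z • g)) u = 0) :
    (z - conj z) * ∫ w : Space n × Space n, ((1 * kernel p q w.1 w.2 : ℝ) : ℂ) *
        (u w.1 * conj (u w.2)) ∂(volume.prod volume) =
      ∫ w : Space n × Space n, (((kernelSymbol α p q w.1 w.2 - kernelSymbol α p q w.2 w.1) *
        kernel p q w.1 w.2 : ℝ) : ℂ) * (u w.1 * conj (u w.2)) ∂(volume.prod volume) := by
  set c : ℝ := (2 * p + 2 * q) * n with hc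
  have hS := isKernelWeight_kernelSymbol (n := n) hα2 hp hq
  have hI0 := (IsKernelWeight.const (n := n) hp 1).integrable_mul hp hq u
  have hS1 := hS.add (IsKernelWeight.const hp (-c))
  have hI1 := hS1.integrable_mul hp hq u
  have hI2 := hS1.swap.integrable_mul hp hq u
  set k0 : Space n × Space n → ℂ := fun w => ((1 * kernel p q w.1 w.2 : ℝ) : ℂ) *
        (u w.1 * conj (u w.2)) with hk0
  set k1 : Space n × Space n → ℂ := fun w =>
    (((kernelSymbol α p q w.1 w.2 + -c) * kernel p q w.1 w.2 : ℝ) : ℂ) *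
        (u w.1 * conj (u w.2)) with hk1
  set k2 : Space n × Space n → ℂ := fun w =>
    (((kernelSymbol α p q w.2 w.1 + -c) * kernel p q w.1 w.2 : ℝ) : ℂ) *
        (u w.1 * conj (u w.2)) with hk2
  have hI2' : Integrable k2 (volume.prod volume) := hI2
  -- For each fixed y the kernel is an admissible test function in x; multiply the resulting
  -- identity by -conj (u y) and integrate over y.
  have hJ1 : ∫ w, (k1 w + conj z * k0 w) ∂(volume.prod volume) = 0 := by
    rw [integral_prod_symm (fun w => k1 w + conj z * k0 w) (hI1.add (hI0.const_mul _))]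
    refine integral_eq_zero_of_ae (Eventually.of_forall fun y => ?_)
    have h := hu (kernelSchwartz hp hq y)
    rw [L2.inner_def] at h
    have h2 : ∫ x, (-((kernelSymbol α p q x y + -c : ℝ) : ℂ) - conj z) * kernel p q x y * u x
        = 0 := by
      rw [← h]
      refine integral_congr_ae ?_
      filter_upwards [coeFn_schwartzL2 (freeSchwartz n α (kernelSchwartz hp hq y) -
        z • kernelSchwartz hp hq y)] with x hx
      rw [hx]
      simp only [sub_apply, smul_apply, freeSchwartz_kernelSchwartz, kernelSchwartz_apply,
        RCLike.inner_apply, smul_eq_mul, map_sub, map_mul, conj_ofReal, ← hc]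
      push_cast
      ring
    have h3 : ∀ x, k1 (x, y) + conj z * k0 (x, y) = -conj (u y) *
        ((-((kernelSymbol α p q x y + -c : ℝ) : ℂ) - conj z) * kernel p q x y * u x) := by
      intro x
      simp only [hk1, hk0]
      push_cast
      ring
    simp only [h3]
    rw [integral_const_mul, h2, mul_zero]
    rfl
  -- Conjugation combined with the exchange of x and y fixes `k0` and maps `k1` to `k2`. In the
  -- difference of the two identities the constant c disappears.
  have hJ2 : ∫ w, (k2 w + z * k0 w) ∂(volume.prod volume) = 0 := by
    have h1 : ∀ w : Space n × Space n, k2 w + z * k0 w =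
        (fun w => conj (k1 w + conj z * k0 w)) w.swap := by
      intro w
      simp only [hk2, hk1, hk0, map_add, map_mul, conj_ofReal, Complex.conj_conj, Prod.fst_swap,
        Prod.snd_swap, kernel_comm p q w.2 w.1]
      ring
    simp only [h1]
    rw [integral_prod_swap (fun w => conj (k1 w + conj z * k0 w)), integral_conj, hJ1, map_zero]
  rw [integral_add hI1 (hI0.const_mul _), integral_const_mul] at hJ1
  rw [integral_add hI2' (hI0.const_mul _), integral_const_mul] at hJ2
  have h4 : ∀ w : Space n × Space n,
      (((kernelSymbol α p q w.1 w.2 - kernelSymbol α p q w.2 w.1) *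
        kernel p q w.1 w.2 : ℝ) : ℂ) * (u w.1 * conj (u w.2)) = k1 w - k2 w := by
    intro w
    simp only [hk1, hk2]
    push_cast
    ring
  simp only [h4]
  rw [integral_sub hI1 hI2']
  linear_combination hJ2 - hJ1

end Deficiency

/-! ### Comparison of the regularized form with the L² norm. -/

section Regularization

open Filter Topology ComplexConjugate

variable {n : ℕ}

/-- Translation of an `L²` function. -/
def translate (v : Space n) (u : L2 n) : L2 n :=
  Lp.compMeasurePreserving (fun x => x + v) (measurePreserving_add_right volume v) u

theorem continuous_translate (u : L2 n) : Continuous fun v => translate v u := by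
  have hg : Continuous fun v : Space n => (⟨fun x => x + v, by fun_prop⟩ : C(Space n, Space n)) :=
    (ContinuousMap.mk (fun a : Space n × Space n => a.2 + a.1) (by fun_prop)).curry.continuous
  exact (continuous_const (y := u)).compMeasurePreservingLp hg
    (fun v => measurePreserving_add_right volume v) (by simp)

theorem translate_zero (u : L2 n) : translate 0 u = u := by
  refine Lp.ext ?_
  filter_upwards [Lp.coeFn_compMeasurePreserving u (measurePreserving_add_right volume 0)] with x hx
  rw [translate, hx]; simp

theorem norm_translate (v : Space n) (u : L2 n) : ‖translate v u‖ = ‖u‖ :=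
  Lp.norm_compMeasurePreserving u _

theorem integral_norm_sub_translate (v : Space n) (u : L2 n) :
    ∫ x, ‖u x - u (x + v)‖ ^ 2 = ‖u - translate v u‖ ^ 2 := by
  rw [← integral_norm_sq]
  refine integral_congr_ae ?_
  filter_upwards [Lp.coeFn_compMeasurePreserving u (measurePreserving_add_right volume v),
    Lp.coeFn_sub u (translate v u)] with x hx hx2
  rw [hx2, Pi.sub_apply, translate, hx]
  rfl

theorem integral_eq_scaled_translate {F : Type*} [NormedAddCommGroup F] [NormedSpace ℝ F]
    (f : Space n → F) (x : Space n) {ε : ℝ} (hε : 0 < ε) :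
    ∫ y, f y = ε ^ n • ∫ w : Space n, f (x + ε • w) := by
  rw [Measure.integral_comp_smul volume (fun y => f (x + y)) ε, finrank_euclideanSpace_fin,
    integral_add_left_eq_self, smul_smul, abs_of_pos (by positivity),
    mul_inv_cancel₀ (by positivity), one_smul]

theorem isKernelWeight_abs_norm_sq_sub {p : ℝ} (hp : 0 < p) :
    IsKernelWeight p (fun z : Space n × Space n => |‖z.1‖ ^ 2 - ‖z.2‖ ^ 2|) := by
  refine .of_pow hp (C := 1) (by fun_prop) zero_le_one fun z => ?_
  have hx := norm_nonneg z.1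
  have hy := norm_nonneg z.2
  rw [abs_abs, one_mul]
  have h1 : ‖z.1‖ ^ 2 ≤ (1 + ‖z.1‖) ^ 2 := by gcongr; linarith
  have h2 : ‖z.2‖ ^ 2 ≤ (1 + ‖z.2‖) ^ 2 := by gcongr; linarith
  have h3 : 1 ≤ (1 + ‖z.1‖) ^ 2 := one_le_pow₀ (by linarith)
  have h4 : 1 ≤ (1 + ‖z.2‖) ^ 2 := one_le_pow₀ (by linarith)
  rw [abs_le]
  constructor <;> nlinarith [sq_nonneg ‖z.1‖, sq_nonneg ‖z.2‖]

/-- The squared translation differences against the kernel. -/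
theorem integral_kernel_mul_sub_sq_le {ε : ℝ} (hε : 0 < ε) {p q : ℝ} (hp : 0 < p) (hq : 0 < q)
    (hqε : q * ε ^ 2 = 1) (u : L2 n)
    (hI : Integrable (fun z : Space n × Space n => kernel p q z.1 z.2 * ‖u z.1 - u z.2‖ ^ 2)
      (volume.prod volume)) :
    ∫ z : Space n × Space n, kernel p q z.1 z.2 * ‖u z.1 - u z.2‖ ^ 2 ∂(volume.prod volume) ≤
      ε ^ n * ∫ w : Space n, Real.exp (-(1 * ‖w‖ ^ 2)) * ‖u - translate (ε • w) u‖ ^ 2 := by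
  -- The shear (x, v) ↦ (x, x + v) turns differences into translations. Dropping the factors with p
  -- leaves e^{-q|v|²}, and v = εw makes it e^{-|w|²}.
  have hsh : MeasurePreserving (MeasurableEquiv.shearAddRight (Space n))
      (volume.prod volume) (volume.prod volume) := measurePreserving_prod_add volume volume
  have hI2 := (hsh.integrable_comp hI.aestronglyMeasurable).mpr hI
  rw [← hsh.integral_comp']
  refine (integral_prod_symm _ hI2).trans_le ?_
  have hω : Continuous fun v : Space n => ‖u - translate v u‖ ^ 2 :=
    ((continuous_const.sub (continuous_translate u)).norm.pow 2)
  have hbd : ∀ v : Space n, ‖u - translate v u‖ ^ 2 ≤ (2 * ‖u‖) ^ 2 := fun v => by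
    gcongr
    calc _ ≤ ‖u‖ + ‖translate v u‖ := norm_sub_le _ _
      _ = _ := by rw [norm_translate]; ring
  have hmaj : Integrable fun v : Space n =>
      Real.exp (-(q * ‖v‖ ^ 2)) * ‖u - translate v u‖ ^ 2 := by
    refine (integrable_exp_neg_mul_norm_sq hq).mul_bdd (c := (2 * ‖u‖) ^ 2)
      hω.aestronglyMeasurable (Eventually.of_forall fun v => ?_)
    rw [Real.norm_of_nonneg (by positivity)]
    exact hbd v
  have hslice : ∀ v : Space n, Integrable fun x => ‖u x - u (x + v)‖ ^ 2 := by
    intro v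
    refine (integrable_norm_sq (u - translate v u)).congr ?_
    filter_upwards [Lp.coeFn_compMeasurePreserving u (measurePreserving_add_right volume v),
      Lp.coeFn_sub u (translate v u)] with x hx hx2
    rw [hx2, Pi.sub_apply, translate, hx]
    rfl
  calc _ ≤ ∫ v : Space n, Real.exp (-(q * ‖v‖ ^ 2)) * ‖u - translate v u‖ ^ 2 := by
        refine integral_mono_of_nonneg (Eventually.of_forall fun v => integral_nonneg fun x => ?_)
          hmaj (Eventually.of_forall fun v => ?_)
        · exact mul_nonneg (kernel_pos _ _ _ _).le (by positivity)
        · simp only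
          rw [← integral_norm_sub_translate, ← integral_const_mul]
          refine integral_mono_of_nonneg (Eventually.of_forall fun x => ?_)
            ((hslice v).const_mul _) (Eventually.of_forall fun x => ?_)
          · exact mul_nonneg (kernel_pos _ _ _ _).le (by positivity)
          · refine mul_le_mul_of_nonneg_right ?_ (by positivity)
            change Real.exp _ ≤ _
            refine Real.exp_le_exp.mpr ?_
            simp only [MeasurableEquiv.shearAddRight, MeasurableEquiv.coe_mk,
              Equiv.prodShear_apply, Equiv.refl_apply, Equiv.coe_addLeft, kernelExponent]
            have h1 : 0 ≤ p * ‖x‖ ^ 2 := by positivity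
            have h2 : 0 ≤ p * ‖x + v‖ ^ 2 := by positivity
            have h3 : ‖x - (x + v)‖ = ‖v‖ := by rw [sub_add_cancel_left, norm_neg]
            rw [h3]
            linarith
    _ = _ := by
        rw [integral_eq_scaled_translate _ 0 hε, smul_eq_mul]
        congr 1
        refine integral_congr_ae (Eventually.of_forall fun w => ?_)
        simp only [zero_add]
        rw [norm_smul, Real.norm_of_nonneg hε.le, mul_pow, ← mul_assoc, hqε]

/-- Polarization: 2 Re u(x) conj u(y) = |u(x)|² + |u(y)|² - |u(x) - u(y)|² bounds the regularized
form from below, with an error governed by translations. The commutator is bounded through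
2|u(x)||u(y)| ≤ |u(x)|² + |u(y)|². In the variables y = x + εw the Jacobian εⁿ occurs on both sides
and cancels. -/
theorem regularized_norm_le {α : ℝ} (hα : 0 < α) (hα2 : α ≤ 2) {ε p q : ℝ} (hε : 0 < ε)
    (hp : 0 < p) (hp1 : p ≤ 1) (hq : 0 < q) (hpq : p * q = 1) (hqε : q * ε ^ 2 = 1) {z : ℂ}
    {u : L2 n} (hu : ∀ g, inner ℂ (schwartzL2 n (freeSchwartz n α g - z • g)) u = 0) :
    2 * |z.im| * ((∫ x, ‖u x‖ ^ 2 * ∫ w : Space n, kernel p q x (x + ε • w)) -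
        1 / 2 * ∫ w : Space n, Real.exp (-(1 * ‖w‖ ^ 2)) * ‖u - translate (ε • w) u‖ ^ 2) ≤
      13 * ∫ x, ‖u x‖ ^ 2 * ∫ w : Space n,
        |‖x‖ ^ 2 - ‖x + ε • w‖ ^ 2| * kernel p q x (x + ε • w) := by
  have hid := deficiency_identity hα2 hp hq hu
  have hone := IsKernelWeight.const (n := n) hp 1
  have hN := isKernelWeight_abs_norm_sq_sub (n := n) hp
  have hS := isKernelWeight_kernelSymbol (n := n) hα2 hp hq
  have hIA := hone.integrable_mul hp hq u
  have hIA2 := hone.integrable_mul_sq hp hq u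
  have hIN2 := hN.integrable_mul_sq hp hq u
  have hswap : ∀ {M : Space n × Space n → ℝ}, (∀ w, M w.swap = M w) →
      Integrable (fun w => (M w * kernel p q w.1 w.2) * ‖u w.1‖ ^ 2) (volume.prod volume) →
      Integrable (fun w => (M w * kernel p q w.1 w.2) * ‖u w.2‖ ^ 2) (volume.prod volume) ∧
      ∫ w, (M w * kernel p q w.1 w.2) * ‖u w.2‖ ^ 2 ∂(volume.prod volume) =
        ∫ w, (M w * kernel p q w.1 w.2) * ‖u w.1‖ ^ 2 ∂(volume.prod volume) := by
    intro M hM hI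
    have h : (fun w : Space n × Space n => (M w * kernel p q w.1 w.2) * ‖u w.2‖ ^ 2) =
        fun w => (fun w => (M w * kernel p q w.1 w.2) * ‖u w.1‖ ^ 2) w.swap := by
      funext w
      simp only [Prod.fst_swap, Prod.snd_swap, hM, kernel_comm p q w.2 w.1]
    rw [h]
    exact ⟨hI.swap, integral_prod_swap
      (fun w : Space n × Space n => (M w * kernel p q w.1 w.2) * ‖u w.1‖ ^ 2)⟩
  obtain ⟨hIA3, hEA⟩ := hswap (M := fun _ => 1) (fun _ => rfl) hIA2
  obtain ⟨hIN3, hEN⟩ := hswap (M := fun z => |‖z.1‖ ^ 2 - ‖z.2‖ ^ 2|)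
    (fun w => abs_sub_comm _ _) hIN2
  -- the lower bound for the regularized norm
  have hre : ∀ w : Space n × Space n, kernel p q w.1 w.2 * ‖u w.1 - u w.2‖ ^ 2 =
      (1 * kernel p q w.1 w.2) * ‖u w.1‖ ^ 2 + (1 * kernel p q w.1 w.2) * ‖u w.2‖ ^ 2 -
        2 * (((1 * kernel p q w.1 w.2 : ℝ) : ℂ) * (u w.1 * conj (u w.2))).re := by
    intro w
    rw [re_ofReal_mul, ← Complex.normSq_eq_norm_sq, ← Complex.normSq_eq_norm_sq,
      ← Complex.normSq_eq_norm_sq, Complex.normSq_sub]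
    ring
  have hIS : Integrable (fun z : Space n × Space n => kernel p q z.1 z.2 * ‖u z.1 - u z.2‖ ^ 2)
      (volume.prod volume) := by
    simp only [hre]
    exact (hIA2.add hIA3).sub (hIA.re.const_mul 2)
  have hSle := integral_kernel_mul_sub_sq_le hε hp hq hqε u hIS
  have hSeq : ∫ z : Space n × Space n, kernel p q z.1 z.2 * ‖u z.1 - u z.2‖ ^ 2
        ∂(volume.prod volume) =
      2 * (∫ w, (1 * kernel p q w.1 w.2) * ‖u w.1‖ ^ 2 ∂(volume.prod volume)) - 2 *
        (∫ w : Space n × Space n, ((1 * kernel p q w.1 w.2 : ℝ) : ℂ) *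
        (u w.1 * conj (u w.2)) ∂(volume.prod volume)).re := by
    simp only [hre]
    have h1 := integral_re hIA
    simp only [RCLike.re_to_complex] at h1
    have h2 := integral_add hIA2 hIA3
    have h3 := integral_sub (hIA2.add hIA3) (hIA.re.const_mul 2)
    rw [hEA] at h2
    simp only [Pi.add_apply, RCLike.re_to_complex] at h2 h3
    rw [h3, h2, integral_const_mul, h1]
    ring
  -- the upper bound for the commutator
  have hB : ‖∫ w : Space n × Space n,
      (((kernelSymbol α p q w.1 w.2 - kernelSymbol α p q w.2 w.1) *
        kernel p q w.1 w.2 : ℝ) : ℂ) * (u w.1 * conj (u w.2)) ∂(volume.prod volume)‖ ≤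
      13 * ∫ w : Space n × Space n, (|‖w.1‖ ^ 2 - ‖w.2‖ ^ 2| * kernel p q w.1 w.2) * ‖u w.1‖ ^ 2
        ∂(volume.prod volume) := by
    have hdom := (hIN2.add hIN3).const_mul (13 / 2)
    refine (norm_integral_le_of_norm_le hdom (Eventually.of_forall fun w => ?_)).trans (le_of_eq ?_)
    · have h1 := abs_kernelSymbol_sub_le hα hα2 hp hp1 hpq w.1 w.2
      have hk := kernel_pos p q w.1 w.2
      rw [norm_mul, norm_mul, RCLike.norm_conj, norm_real, Real.norm_eq_abs, abs_mul,
        abs_of_pos hk]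
      calc _ ≤ (13 * |‖w.1‖ ^ 2 - ‖w.2‖ ^ 2|) * kernel p q w.1 w.2 *
            ((‖u w.1‖ ^ 2 + ‖u w.2‖ ^ 2) / 2) := by
            gcongr
            nlinarith [sq_nonneg (‖u w.1‖ - ‖u w.2‖)]
        _ = _ := by simp only [Pi.add_apply]; ring
    · rw [integral_const_mul]
      have h2 := integral_add hIN2 hIN3
      rw [hEN] at h2
      simp only [Pi.add_apply] at h2 ⊢
      rw [h2]
      ring
  rw [← hid, norm_mul] at hB
  have hzz : ‖z - conj z‖ = 2 * |z.im| := by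
    rw [Complex.sub_conj, norm_mul, norm_I, mul_one, norm_real, Real.norm_eq_abs, abs_mul,
      abs_two]
  rw [hzz] at hB
  -- iterated integrals
  have hiter : ∀ {M : Space n × Space n → ℝ},
      Integrable (fun w => (M w * kernel p q w.1 w.2) * ‖u w.1‖ ^ 2) (volume.prod volume) →
      ∫ w, (M w * kernel p q w.1 w.2) * ‖u w.1‖ ^ 2 ∂(volume.prod volume) =
        ε ^ n * ∫ x, ‖u x‖ ^ 2 * ∫ w : Space n, M (x, x + ε • w) * kernel p q x (x + ε • w) := by
    intro M hI
    rw [integral_prod _ hI, ← integral_const_mul]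
    refine integral_congr_ae (Eventually.of_forall fun x => ?_)
    simp only
    rw [integral_mul_const, integral_eq_scaled_translate _ x hε, smul_eq_mul]
    ring
  have hA1 := hiter (M := fun _ => 1) hIA2
  have hN1 := hiter (M := fun z => |‖z.1‖ ^ 2 - ‖z.2‖ ^ 2|) hIN2
  simp only [one_mul] at hA1
  rw [hN1] at hB
  simp only [one_mul] at hSeq hB
  rw [hA1] at hSeq
  rw [hSeq] at hSle
  have hεn : 0 < ε ^ n := by positivity
  have hnorm := Complex.re_le_norm (∫ w : Space n × Space n, ((kernel p q w.1 w.2 : ℝ) : ℂ) *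
        (u w.1 * conj (u w.2)) ∂(volume.prod volume))
  have him : 0 ≤ 2 * |z.im| := by positivity
  have hfin := (mul_le_mul_of_nonneg_left hnorm him).trans hB
  refine le_of_mul_le_mul_left ?_ hεn
  simp only [one_mul] at hSle ⊢
  generalize (∫ x, ‖u x‖ ^ 2 * ∫ w : Space n, kernel p q x (x + ε • w)) = X at *
  generalize (∫ w : Space n, Real.exp (-(‖w‖ ^ 2)) * ‖u - translate (ε • w) u‖ ^ 2) = Y at *
  generalize (∫ x, ‖u x‖ ^ 2 * ∫ w : Space n,
        |‖x‖ ^ 2 - ‖x + ε • w‖ ^ 2| * kernel p q x (x + ε • w)) = Z at *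
  have h5 : ε ^ n * (X - 1 / 2 * Y) ≤ (∫ w : Space n × Space n, ((kernel p q w.1 w.2 : ℝ) : ℂ) *
        (u w.1 * conj (u w.2)) ∂(volume.prod volume)).re := by linarith
  calc _ = 2 * |z.im| * (ε ^ n * (X - 1 / 2 * Y)) := by ring
    _ ≤ _ := mul_le_mul_of_nonneg_left h5 him
    _ ≤ _ := hfin
    _ = _ := by ring

end Regularization

/-! ### Vanishing of the deficiency spaces and its consequences. -/

section DeficiencyLimit

open Filter Topology ComplexConjugate

variable {n : ℕ}

theorem tendsto_integral_norm_sq_mul_integral (u : L2 n) {F : ℕ → Space n → Space n → ℝ}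
    {B L : Space n → ℝ} (hF : ∀ m, Continuous (Function.uncurry (F m))) (hB : Integrable B)
    (hFB : ∀ m x w, |F m x w| ≤ B w) (hL : ∀ x w, Tendsto (fun m => F m x w) atTop (𝓝 (L w))) :
    Tendsto (fun m => ∫ x, ‖u x‖ ^ 2 * ∫ w, F m x w) atTop (𝓝 (‖u‖ ^ 2 * ∫ w, L w)) := by
  rw [← integral_norm_sq u, ← integral_mul_const]
  refine tendsto_integral_of_dominated_convergence (fun x => ‖u x‖ ^ 2 * ∫ w, B w) (fun m => ?_)
    ((integrable_norm_sq u).mul_const _) (fun m => Eventually.of_forall fun x => ?_)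
    (Eventually.of_forall fun x => ?_)
  · exact (integrable_norm_sq u).aestronglyMeasurable.mul
      (StronglyMeasurable.integral_prod_right (hF m).stronglyMeasurable).aestronglyMeasurable
  · rw [norm_mul, norm_pow, norm_norm]
    refine mul_le_mul_of_nonneg_left ?_ (by positivity)
    exact norm_integral_le_of_norm_le hB (Eventually.of_forall fun w => hFB m x w)
  · refine Tendsto.const_mul _ (tendsto_integral_of_dominated_convergence B (fun m => ?_) hB
      (fun m => Eventually.of_forall fun w => hFB m x w) (Eventually.of_forall fun w => hL x w))
    exact ((hF m).comp (by fun_prop : Continuous fun w => (x, w))).aestronglyMeasurable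

theorem kernel_add_smul {ε : ℝ} (hε : 0 < ε) (x w : Space n) :
    kernel (ε ^ 2) (ε ^ 2)⁻¹ x (x + ε • w) =
      Real.exp (-(ε ^ 2 * ‖x‖ ^ 2 + ε ^ 2 * ‖x + ε • w‖ ^ 2 + 1 * ‖w‖ ^ 2)) := by
  have h : x - (x + ε • w) = -(ε • w) := by abel
  rw [kernel, kernelExponent, h, norm_neg, norm_smul, Real.norm_eq_abs, mul_pow, sq_abs,
    ← mul_assoc (ε ^ 2)⁻¹, inv_mul_cancel₀ (by positivity)]

theorem kernel_add_smul_le {ε : ℝ} (hε : 0 < ε) (x w : Space n) :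
    kernel (ε ^ 2) (ε ^ 2)⁻¹ x (x + ε • w) ≤ Real.exp (-(1 * ‖w‖ ^ 2)) := by
  rw [kernel_add_smul hε]
  refine Real.exp_le_exp.mpr ?_
  have h1 : 0 ≤ ε ^ 2 * ‖x‖ ^ 2 := by positivity
  have h2 : 0 ≤ ε ^ 2 * ‖x + ε • w‖ ^ 2 := by positivity
  linarith

/-- The unbounded factor |x| enters only as s = ε|x|, while the kernel retains e^{-s²}, and s
e^{-s²} ≤ 1. So the majorant depends on w alone, as dominated convergence requires. -/
theorem abs_norm_sq_sub_mul_kernel_le {ε : ℝ} (hε : 0 < ε) (hε1 : ε ≤ 1) (x w : Space n) :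
    |(|‖x‖ ^ 2 - ‖x + ε • w‖ ^ 2| * kernel (ε ^ 2) (ε ^ 2)⁻¹ x (x + ε • w))| ≤
      (2 * ‖w‖ + ‖w‖ ^ 2) * Real.exp (-(1 * ‖w‖ ^ 2)) := by
  have h0 : |‖x‖ ^ 2 - ‖x + ε • w‖ ^ 2| ≤ 2 * (ε * ‖x‖) * ‖w‖ + ‖w‖ ^ 2 := by
    rw [norm_add_sq_real, inner_smul_right, norm_smul, Real.norm_eq_abs, abs_of_pos hε]
    have h1 := abs_real_inner_le_norm x w
    have h2 : (ε * ‖w‖) ^ 2 ≤ ‖w‖ ^ 2 := by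
      refine pow_le_pow_left₀ (by positivity) ?_ 2
      exact mul_le_of_le_one_left (norm_nonneg _) hε1
    have h3 : ε * |inner ℝ x w| ≤ ε * (‖x‖ * ‖w‖) := mul_le_mul_of_nonneg_left h1 hε.le
    have h4 := abs_le.mp (le_refl |inner ℝ x w|)
    have h5 : 0 ≤ (ε * ‖w‖) ^ 2 := by positivity
    have h6 := mul_le_mul_of_nonneg_left h4.1 hε.le
    have h7 := mul_le_mul_of_nonneg_left h4.2 hε.le
    rw [abs_le]
    constructor <;> nlinarith
  have hexp : kernel (ε ^ 2) (ε ^ 2)⁻¹ x (x + ε • w) ≤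
      Real.exp (-((ε * ‖x‖) ^ 2)) * Real.exp (-(1 * ‖w‖ ^ 2)) := by
    rw [kernel_add_smul hε, ← Real.exp_add]
    refine Real.exp_le_exp.mpr ?_
    have h2 : 0 ≤ ε ^ 2 * ‖x + ε • w‖ ^ 2 := by positivity
    rw [mul_pow]
    linarith
  rw [abs_mul, abs_abs, abs_of_pos (kernel_pos _ _ _ _)]
  set s := ε * ‖x‖ with hs
  have hs0 : 0 ≤ s := by positivity
  have h1 : s * Real.exp (-(s ^ 2)) ≤ 1 := by
    have h2 := Real.add_one_le_exp (s ^ 2)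
    rw [Real.exp_neg, ← div_eq_mul_inv, div_le_one (Real.exp_pos _)]
    nlinarith [sq_nonneg (s - 1)]
  have h2 : Real.exp (-(s ^ 2)) ≤ 1 := Real.exp_le_one_iff.mpr (by nlinarith)
  have hk := (kernel_pos (ε ^ 2) (ε ^ 2)⁻¹ x (x + ε • w)).le
  calc _ ≤ (2 * s * ‖w‖ + ‖w‖ ^ 2) * (Real.exp (-(s ^ 2)) * Real.exp (-(1 * ‖w‖ ^ 2))) := by
        gcongr
    _ = (2 * ‖w‖ * (s * Real.exp (-(s ^ 2))) + ‖w‖ ^ 2 * Real.exp (-(s ^ 2))) *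
          Real.exp (-(1 * ‖w‖ ^ 2)) := by ring
    _ ≤ (2 * ‖w‖ * 1 + ‖w‖ ^ 2 * 1) * Real.exp (-(1 * ‖w‖ ^ 2)) := by gcongr
    _ = _ := by ring

theorem integrable_moment :
    Integrable fun w : Space n => (2 * ‖w‖ + ‖w‖ ^ 2) * Real.exp (-(1 * ‖w‖ ^ 2)) := by
  obtain ⟨C, hC, h⟩ := exists_one_add_pow_le_exp_sq (one_half_pos (α := ℝ)) 2
  refine ((integrable_exp_neg_mul_norm_sq (n := n) (one_half_pos (α := ℝ))).const_mul C).mono'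
    (by fun_prop : Continuous fun w : Space n =>
      (2 * ‖w‖ + ‖w‖ ^ 2) * Real.exp (-(1 * ‖w‖ ^ 2))).aestronglyMeasurable
    (Eventually.of_forall fun w => ?_)
  rw [Real.norm_of_nonneg (by positivity)]
  calc _ ≤ (C * Real.exp (1 / 2 * ‖w‖ ^ 2)) * Real.exp (-(1 * ‖w‖ ^ 2)) := by
        gcongr
        refine le_trans ?_ (h ‖w‖ (norm_nonneg w))
        nlinarith
    _ = C * Real.exp (1 / 2 * ‖w‖ ^ 2 + -(1 * ‖w‖ ^ 2)) := by rw [Real.exp_add]; ring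
    _ = _ := by congr 2; ring

theorem integral_gaussian_pos : 0 < ∫ w : Space n, Real.exp (-(1 * ‖w‖ ^ 2)) := by
  rw [integral_pos_iff_support_of_nonneg (fun w => (Real.exp_pos _).le)
    (integrable_exp_neg_mul_norm_sq one_pos)]
  have : (Function.support fun w : Space n => Real.exp (-(1 * ‖w‖ ^ 2))) = Set.univ :=
    Set.eq_univ_of_forall fun w => (Real.exp_pos _).ne'
  rw [this]
  exact isOpen_univ.measure_pos _ Set.univ_nonempty

/-- Let ε → 0 in `regularized_norm_le` with p = ε² and q = ε⁻². The commutator and the translation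
error vanish in the limit, leaving 2|Im z| ‖u‖² ∫ e^{-|w|²} dw ≤ 0. -/
theorem deficiency_eq_zero {α : ℝ} (hα : 0 < α) (hα2 : α ≤ 2) {z : ℂ} (hz : z.im ≠ 0) {u : L2 n}
    (hu : ∀ g, inner ℂ (schwartzL2 n (freeSchwartz n α g - z • g)) u = 0) : u = 0 := by
  set ε : ℕ → ℝ := fun m => 1 / ((m : ℝ) + 1) with hεd
  have hε : ∀ m, 0 < ε m := fun m => by positivity
  have hε1 : ∀ m, ε m ≤ 1 := fun m => by
    rw [hεd]; simp only
    rw [div_le_one (by positivity)]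
    have : (0 : ℝ) ≤ m := m.cast_nonneg
    linarith
  have hε0 : Tendsto ε atTop (𝓝 0) := tendsto_one_div_add_atTop_nhds_zero_nat
  have hker : ∀ m, Continuous (Function.uncurry fun x w : Space n =>
      kernel (ε m ^ 2) (ε m ^ 2)⁻¹ x (x + ε m • w)) := fun m => by
    simp_rw [Function.uncurry_def, kernel_add_smul (hε m)]
    fun_prop
  have hlim : ∀ x w : Space n, Tendsto (fun m => kernel (ε m ^ 2) (ε m ^ 2)⁻¹ x (x + ε m • w))
      atTop (𝓝 (Real.exp (-(1 * ‖w‖ ^ 2)))) := fun x w => by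
    simp_rw [kernel_add_smul (hε _)]
    have hc : Continuous fun e : ℝ =>
        Real.exp (-(e ^ 2 * ‖x‖ ^ 2 + e ^ 2 * ‖x + e • w‖ ^ 2 + 1 * ‖w‖ ^ 2)) := by fun_prop
    have := (hc.tendsto 0).comp hε0
    simpa [Function.comp_def] using this
  have h1 := tendsto_integral_norm_sq_mul_integral u hker (integrable_exp_neg_mul_norm_sq one_pos)
    (fun m x w => by
      rw [abs_of_pos (kernel_pos _ _ _ _)]; exact kernel_add_smul_le (hε m) x w) hlim
  have h2 := tendsto_integral_norm_sq_mul_integral u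
    (F := fun m x w => |‖x‖ ^ 2 - ‖x + ε m • w‖ ^ 2| *
      kernel (ε m ^ 2) (ε m ^ 2)⁻¹ x (x + ε m • w)) (L := fun _ => 0)
    (fun m => by
      refine Continuous.mul (f := fun z : Space n × Space n => |‖z.1‖ ^ 2 - ‖z.1 + ε m • z.2‖ ^ 2|)
        (by fun_prop) (hker m))
    integrable_moment (fun m x w => abs_norm_sq_sub_mul_kernel_le (hε m) (hε1 m) x w)
    (fun x w => by
      have hc : Continuous fun e : ℝ => |‖x‖ ^ 2 - ‖x + e • w‖ ^ 2| := by fun_prop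
      have := ((hc.tendsto 0).comp hε0).mul (hlim x w)
      simpa using this)
  have h3 : Tendsto (fun m => ∫ w : Space n, Real.exp (-(1 * ‖w‖ ^ 2)) *
      ‖u - translate (ε m • w) u‖ ^ 2) atTop (𝓝 (∫ _ : Space n, (0 : ℝ))) := by
    refine tendsto_integral_of_dominated_convergence
      (fun w => Real.exp (-(1 * ‖w‖ ^ 2)) * (2 * ‖u‖) ^ 2) (fun m => ?_)
      ((integrable_exp_neg_mul_norm_sq one_pos).mul_const _)
      (fun m => Eventually.of_forall fun w => ?_) (Eventually.of_forall fun w => ?_)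
    · have hc : Continuous fun w : Space n => translate (ε m • w) u :=
        (continuous_translate u).comp (by fun_prop)
      exact Continuous.aestronglyMeasurable (by fun_prop)
    · rw [Real.norm_of_nonneg (by positivity)]
      gcongr
      refine (norm_sub_le _ _).trans (le_of_eq ?_)
      rw [norm_translate]; ring
    · have hc : Continuous fun e : ℝ => translate (e • w) u :=
        (continuous_translate u).comp (by fun_prop)
      have hc2 : Continuous fun e : ℝ =>
          Real.exp (-(1 * ‖w‖ ^ 2)) * ‖u - translate (e • w) u‖ ^ 2 := by fun_prop
      have := (hc2.tendsto 0).comp hε0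
      simpa [translate_zero, Function.comp_def] using this
  have hle := fun m => regularized_norm_le hα hα2 (hε m) (p := ε m ^ 2) (q := (ε m ^ 2)⁻¹)
    (pow_pos (hε m) 2) (pow_le_one₀ (hε m).le (hε1 m)) (inv_pos.mpr (pow_pos (hε m) 2))
    (mul_inv_cancel₀ (pow_pos (hε m) 2).ne') (inv_mul_cancel₀ (pow_pos (hε m) 2).ne') hu
  have hfin := le_of_tendsto_of_tendsto' ((h1.sub (h3.const_mul (1 / 2))).const_mul (2 * |z.im|))
    (h2.const_mul 13) hle
  simp only [integral_zero, mul_zero, sub_zero] at hfin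
  have hz' : 0 < |z.im| := abs_pos.mpr hz
  have hg := integral_gaussian_pos (n := n)
  by_contra hne
  have : 0 < ‖u‖ := norm_pos_iff.mpr hne
  have : 0 < 2 * |z.im| * (‖u‖ ^ 2 * ∫ w : Space n, Real.exp (-(1 * ‖w‖ ^ 2))) := by positivity
  linarith

/-- The graph of `-Δ - ⟨x⟩ ^ α` on Schwartz functions. -/
def schwartzGraph (n : ℕ) (α : ℝ) : Submodule ℂ (L2 n × L2 n) :=
  LinearMap.range ((schwartzL2 n).toLinearMap.prod
    ((schwartzL2 n).toLinearMap ∘ₗ (freeSchwartz n α).toLinearMap))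

theorem schwartzGraph_le (α : ℝ) :
    schwartzGraph n α ≤ (maximalRealization n (freeExpr n α)).graph := by
  rintro _ ⟨g, rfl⟩
  exact schwartz_mem_graph_free α g

theorem isSymmetricGraph_schwartzGraph (α : ℝ) : IsSymmetricGraph (schwartzGraph n α) := by
  rintro _ ⟨f, rfl⟩ _ ⟨g, rfl⟩
  exact (isFormalAdjoint_freeExpr n α).mem_graph_iff.mp (schwartz_mem_graph_free α g) f

theorem schwartzGraph_deficiency {α : ℝ} (hα : 0 < α) (hα2 : α ≤ 2) (z : ℂ) (hz : z.im ≠ 0)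
    (h : L2 n) (hh : ∀ p ∈ schwartzGraph n α, inner ℂ h (p.2 - z • p.1) = 0) : h = 0 := by
  refine deficiency_eq_zero hα hα2 hz fun g => ?_
  rw [← inner_conj_symm, map_sub, map_smul]
  have := hh _ ⟨g, rfl⟩
  exact (congrArg conj this).trans (map_zero _)

/-- By duality an eigenvector for z is orthogonal to (A - conj z)g for every Schwartz g, so it is a
deficiency vector. -/
theorem eq_zero_of_smul_mem_graph {α : ℝ} (hα : 0 < α) (hα2 : α ≤ 2) (z : ℂ) (hz : z.im ≠ 0)
    (u : L2 n) (hu : (u, z • u) ∈ (maximalRealization n (freeExpr n α)).graph) : u = 0 := by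
  have h := (isFormalAdjoint_freeExpr n α).mem_graph_iff.mp hu
  refine deficiency_eq_zero hα hα2 (z := conj z) (by simpa using hz) fun g => ?_
  rw [map_sub, map_smul, inner_sub_left, inner_smul_left, h g, inner_smul_right,
    RingHomCompTriple.comp_apply]
  simp

theorem maximalRealization_free_graph {α : ℝ} (hα : 0 < α) (hα2 : α ≤ 2) :
    (maximalRealization n (freeExpr n α)).graph = (schwartzGraph n α).topologicalClosure :=
  graph_eq_closure_of_core (isClosed_maximalRealization _) (schwartzGraph_le α)
    (isSymmetricGraph_schwartzGraph α) (schwartzGraph_deficiency hα hα2)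
    (eq_zero_of_smul_mem_graph hα hα2)

theorem isSelfAdjointOp_maximalRealization_free {α : ℝ} (hα : 0 < α) (hα2 : α ≤ 2) :
    IsSelfAdjointOp (maximalRealization n (freeExpr n α)) :=
  isSelfAdjointOp_of_core (isClosed_maximalRealization _) (schwartzGraph_le α)
    (isSymmetricGraph_schwartzGraph α) (schwartzGraph_deficiency hα hα2)
    (eq_zero_of_smul_mem_graph hα hα2)

/-- The operator on the oscillator domain lies between the Schwartz graph and the maximal
realization, and the latter is the closure of the former. -/
theorem freeHamiltonian_eq {α : ℝ} (hα : 0 < α) (hα2 : α ≤ 2) :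
    freeHamiltonian n α = maximalRealization n (freeExpr n α) := by
  set M := maximalRealization n (freeExpr n α) with hM
  have hMc : M.IsClosed := isClosed_maximalRealization _
  have hle : M.domRestrict (oscillatorDomain n) ≤ M := LinearPMap.domRestrict_le
  have hcl : (M.domRestrict (oscillatorDomain n)).IsClosable :=
    hMc.isClosable.leIsClosable hle
  refine LinearPMap.eq_of_eq_graph ?_
  rw [freeHamiltonian, ← hM, ← hcl.graph_closure_eq_closure_graph]
  refine le_antisymm ?_ ?_
  · exact Submodule.topologicalClosure_minimal _ (LinearPMap.le_graph_of_le hle) hMc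
  · rw [hM, maximalRealization_free_graph hα hα2]
    refine Submodule.topologicalClosure_mono ?_
    rintro _ ⟨g, rfl⟩
    have hg := schwartz_mem_graph_free α g
    rw [LinearPMap.mem_graph_iff] at hg
    obtain ⟨y, hy1, hy2⟩ := hg
    have hy : (y : L2 n) ∈ (M.domRestrict (oscillatorDomain n)).domain :=
      ⟨hy1 ▸ schwartz_mem_oscillatorDomain g, y.2⟩
    exact (LinearPMap.mem_graph_iff _).mpr ⟨⟨y, hy⟩, hy1, (LinearPMap.domRestrict_apply rfl).trans hy2⟩

theorem isSymmetricGraph_mulOp (V : Space n → ℝ) : IsSymmetricGraph (mulOp n V).graph := by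
  rintro ⟨p1, p2⟩ hp ⟨q1, q2⟩ hq
  rw [LinearPMap.mem_graph_iff] at hp hq
  obtain ⟨a, rfl, rfl⟩ := hp
  obtain ⟨b, rfl, rfl⟩ := hq
  rw [L2.inner_def, L2.inner_def]
  refine integral_congr_ae ?_
  filter_upwards [coeFn_mulFun n V a, coeFn_mulFun n V b] with x h1 h2
  change inner ℂ (mulFun n V a x) _ = inner ℂ _ (mulFun n V b x)
  rw [h1, h2]
  simp only [RCLike.inner_apply, map_mul, conj_ofReal]
  ring

end DeficiencyLimit

/-! ### The metaplectic rotation -/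

section Rotation

open ComplexConjugate

variable {n : ℕ}

theorem hasTemperateGrowth_cexp_ofReal_mul_I (c : ℝ) :
    (fun t : ℝ => cexp (c * I * t)).HasTemperateGrowth := by
  have h : ∀ k, iteratedDeriv k (fun t : ℝ => cexp (c * I * t)) =
      fun t : ℝ => (c * I) ^ k * cexp (c * I * t) := by
    intro k
    induction k with
    | zero => simp
    | succ k ih =>
      rw [iteratedDeriv_succ, ih]
      funext t
      have h1 : HasDerivAt (fun t : ℝ => (c * I) * (t : ℂ)) (c * I) t := by
        simpa using (ofRealCLM.hasDerivAt (x := t)).const_mul (c * I : ℂ)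
      rw [(h1.cexp.const_mul _).deriv]
      ring
  refine ⟨(contDiff_const.mul ofRealCLM.contDiff).cexp, fun k => ⟨0, |c| ^ k, fun t => ?_⟩⟩
  rw [norm_iteratedFDeriv_eq_norm_iteratedDeriv, h, norm_mul, norm_pow, pow_zero, mul_one]
  have h2 : ‖cexp (c * I * t)‖ = 1 := by
    rw [Complex.norm_exp]
    simp
  simp [h2]

/-- The chirp `x ↦ e^{i c |x|² / 2}`. -/
def chirpFun (n : ℕ) (c : ℝ) (x : Space n) : ℂ := cexp (c * I * ((‖x‖ ^ 2 / 2 : ℝ) : ℂ))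

theorem hasTemperateGrowth_chirpFun (c : ℝ) : (chirpFun n c).HasTemperateGrowth := by
  have h := Function.hasTemperateGrowth_norm_sq (Space n)
  have h1 : (fun x : Space n => ‖x‖ ^ 2 / 2).HasTemperateGrowth := by
    simp_rw [div_eq_mul_inv]
    fun_prop
  exact (hasTemperateGrowth_cexp_ofReal_mul_I c).comp h1

theorem norm_chirpFun (c : ℝ) (x : Space n) : ‖chirpFun n c x‖ = 1 := by
  rw [chirpFun, mul_assoc, mul_comm I, ← mul_assoc, ← ofReal_mul, Complex.norm_exp_ofReal_mul_I]

theorem chirpFun_neg_mul (c : ℝ) (x : Space n) : chirpFun n (-c) x * chirpFun n c x = 1 := by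
  rw [chirpFun, chirpFun, ← Complex.exp_add]
  simp

/-- Multiplication of Schwartz functions by a chirp. -/
def chirp (n : ℕ) (c : ℝ) : 𝓢(Space n, ℂ) →L[ℂ] 𝓢(Space n, ℂ) :=
  SchwartzMap.smulLeftCLM ℂ (chirpFun n c)

theorem chirp_apply (c : ℝ) (g : 𝓢(Space n, ℂ)) (x : Space n) :
    chirp n c g x = chirpFun n c x * g x :=
  SchwartzMap.smulLeftCLM_apply_apply (hasTemperateGrowth_chirpFun c) g x

/-- Multiplication of Schwartz functions by a chirp, as an equivalence. -/
def chirpEquiv (n : ℕ) (c : ℝ) : 𝓢(Space n, ℂ) ≃ₗ[ℂ] 𝓢(Space n, ℂ) :=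
  LinearEquiv.ofLinearMap (chirp n c).toLinearMap (chirp n (-c)).toLinearMap
    (by
      ext g x
      have := chirpFun_neg_mul (-c) x
      rw [neg_neg] at this
      simp [chirp_apply, ← mul_assoc, this])
    (by
      ext g x
      simp [chirp_apply, ← mul_assoc, chirpFun_neg_mul])

/-- Multiplication of Schwartz functions by the linear function `⟨x, v⟩`. -/
def posOp (v : Space n) : 𝓢(Space n, ℂ) →L[ℂ] 𝓢(Space n, ℂ) :=
  SchwartzMap.smulLeftCLM ℂ (fun x => ((inner ℝ x v : ℝ) : ℂ))

theorem posOp_eq (v : Space n) (g : 𝓢(Space n, ℂ)) :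
    posOp v g = SchwartzMap.smulLeftCLM ℂ (fun x => (inner ℝ x v : ℝ)) g :=
  SchwartzMap.smulLeftCLM_ofReal ℂ (Function.hasTemperateGrowth_inner_left v) g

theorem posOp_apply (v : Space n) (g : 𝓢(Space n, ℂ)) (x : Space n) :
    posOp v g x = ((inner ℝ x v : ℝ) : ℂ) * g x := by
  rw [posOp_eq, SchwartzMap.smulLeftCLM_apply_apply (Function.hasTemperateGrowth_inner_left v),
    real_smul]

theorem posOp_chirp (c : ℝ) (v : Space n) (g : 𝓢(Space n, ℂ)) :
    posOp v (chirp n c g) = chirp n c (posOp v g) := by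
  ext x
  simp [posOp_apply, chirp_apply]
  ring

theorem hasFDerivAt_chirpFun (c : ℝ) (x : Space n) :
    HasFDerivAt (chirpFun n c)
      (chirpFun n c x • ((c * I) • (ofRealCLM ∘L innerSL ℝ x))) x := by
  have h1 : HasFDerivAt (fun x : Space n => ‖x‖ ^ 2) (2 • innerSL ℝ x) x :=
    (hasStrictFDerivAt_norm_sq x).hasFDerivAt
  have h2 : HasFDerivAt (fun x : Space n => ‖x‖ ^ 2 / 2) (innerSL ℝ x) x := by
    refine (h1.mul_const (2⁻¹ : ℝ)).congr_fderiv ?_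
    ext v
    simp
  exact ((ofRealCLM.hasFDerivAt.comp x h2).const_mul (c * I : ℂ)).cexp

open LineDeriv in
theorem lineDerivOp_chirp (c : ℝ) (v : Space n) (g : 𝓢(Space n, ℂ)) :
    ∂_{v} (chirp n c g) = chirp n c (∂_{v} g + (c * I) • posOp v g) := by
  ext x
  have h0 : ⇑(chirp n c g) = fun x => chirpFun n c x * g x := funext fun x => chirp_apply c g x
  have h1 := (hasFDerivAt_chirpFun c x).mul g.differentiableAt.hasFDerivAt
  rw [SchwartzMap.lineDerivOp_apply_eq_fderiv, h0]
  have h2 := h1.fderiv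
  change fderiv ℝ (chirpFun n c * ⇑g) x v = _
  rw [h2, chirp_apply]
  simp [posOp_apply, SchwartzMap.lineDerivOp_apply_eq_fderiv]
  ring

/-- The dilation `g ↦ g (c ·)` of Schwartz functions. -/
def dilate {c : ℝ} (hc : c ≠ 0) : 𝓢(Space n, ℂ) →L[ℂ] 𝓢(Space n, ℂ) :=
  SchwartzMap.compCLMOfContinuousLinearEquiv ℂ
    (ContinuousLinearEquiv.smulLeft (Units.mk0 c hc) : Space n ≃L[ℝ] Space n)

theorem dilate_apply {c : ℝ} (hc : c ≠ 0) (g : 𝓢(Space n, ℂ)) (x : Space n) :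
    dilate hc g x = g (c • x) := rfl

/-- The dilation `g ↦ g (c ·)` of Schwartz functions, as an equivalence. -/
def dilateEquiv (n : ℕ) {c : ℝ} (hc : c ≠ 0) : 𝓢(Space n, ℂ) ≃ₗ[ℂ] 𝓢(Space n, ℂ) :=
  LinearEquiv.ofLinearMap (dilate hc).toLinearMap (dilate (inv_ne_zero hc)).toLinearMap
    (by ext g x; simp [dilate_apply, hc])
    (by ext g x; simp [dilate_apply, hc])

open LineDeriv in
theorem lineDerivOp_dilate {c : ℝ} (hc : c ≠ 0) (v : Space n) (g : 𝓢(Space n, ℂ)) :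
    ∂_{v} (dilate hc g) = (c : ℂ) • dilate hc (∂_{v} g) := by
  rw [dilate, SchwartzMap.lineDerivOp_compCLMOfContinuousLinearEquiv]
  ext x
  change (∂_{c • v} g) (c • x) = (c : ℂ) * (∂_{v} g) (c • x)
  simp [SchwartzMap.lineDerivOp_apply_eq_fderiv]

theorem posOp_dilate {c : ℝ} (hc : c ≠ 0) (v : Space n) (g : 𝓢(Space n, ℂ)) :
    posOp v (dilate hc g) = (c⁻¹ : ℂ) • dilate hc (posOp v g) := by
  ext x
  have : (c : ℂ) ≠ 0 := ofReal_ne_zero.mpr hc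
  simp [posOp_apply, dilate_apply, inner_smul_left]
  field_simp

open LineDeriv in
theorem lineDerivOp_fourierInv (v : Space n) (g : 𝓢(Space n, ℂ)) :
    ∂_{v} (𝓕⁻ g) = (2 * Real.pi * I) • 𝓕⁻ (posOp v g) := by
  rw [SchwartzMap.lineDerivOp_fourierInv_eq, FourierTransform.fourierInv_smul, posOp_eq]

open LineDeriv in
theorem posOp_fourierInv (v : Space n) (g : 𝓢(Space n, ℂ)) :
    posOp v (𝓕⁻ g) = (I / (2 * Real.pi)) • 𝓕⁻ (∂_{v} g) := by
  rw [SchwartzMap.fourierInv_lineDerivOp_eq, ← posOp_eq, smul_smul]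
  have h : (Real.pi : ℂ) ≠ 0 := ofReal_ne_zero.mpr Real.pi_ne_zero
  have : I / (2 * Real.pi) * -(2 * Real.pi * I) = 1 := by
    field_simp
    simp
  rw [this, one_smul]

theorem rotationScale_ne_zero : (√2 * Real.pi)⁻¹ ≠ 0 := by positivity

theorem rotationConst_pos (n : ℕ) : 0 < (√2 * Real.pi) ^ (-(n : ℝ) / 2) := by positivity

/-- The unitary operator `U` on Schwartz functions. -/
def rotationSchwartz (n : ℕ) : 𝓢(Space n, ℂ) ≃ₗ[ℂ] 𝓢(Space n, ℂ) :=
  chirpEquiv n (-1) ≪≫ₗ (FourierTransform.fourierEquiv ℂ 𝓢(Space n, ℂ)).symm ≪≫ₗ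
    dilateEquiv n rotationScale_ne_zero ≪≫ₗ chirpEquiv n (-1) ≪≫ₗ
    LinearEquiv.smulOfNeZero ℂ _ (((√2 * Real.pi) ^ (-(n : ℝ) / 2) : ℝ) : ℂ)
      (ofReal_ne_zero.mpr (rotationConst_pos n).ne')

theorem rotationSchwartz_eq (g : 𝓢(Space n, ℂ)) : rotationSchwartz n g =
    (((√2 * Real.pi) ^ (-(n : ℝ) / 2) : ℝ) : ℂ) •
      chirp n (-1) (dilate rotationScale_ne_zero (𝓕⁻ (chirp n (-1) g))) := rfl

theorem sqrt_two_mul_self_complex : (√2 : ℂ) * √2 = 2 := by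
  rw [← ofReal_mul, Real.mul_self_sqrt (by norm_num)]; norm_num

theorem sqrt_two_complex_ne_zero : (√2 : ℂ) ≠ 0 := ofReal_ne_zero.mpr (by positivity)

-- With D = -i∂, this relation and the next say U⁻¹DU = (D + x)/√2 and U⁻¹xU = (x - D)/√2, a
-- rotation of phase space by 45 degrees. It is composed of two chirps, which shear D along x, the
-- inverse Fourier transform, which exchanges D and x up to sign and scale, and a dilation.
open LineDeriv in
theorem lineDerivOp_rotationSchwartz (v : Space n) (g : 𝓢(Space n, ℂ)) :
    ∂_{v} (rotationSchwartz n g) =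
      rotationSchwartz n ((√2 : ℂ)⁻¹ • (∂_{v} g + I • posOp v g)) := by
  have h2 := sqrt_two_mul_self_complex
  have h3 := sqrt_two_complex_ne_zero
  have hpi : (Real.pi : ℂ) ≠ 0 := ofReal_ne_zero.mpr Real.pi_ne_zero
  rw [rotationSchwartz_eq, rotationSchwartz_eq, LineDeriv.lineDerivOp_smul, lineDerivOp_chirp,
    lineDerivOp_dilate, posOp_dilate, lineDerivOp_fourierInv, posOp_fourierInv, posOp_chirp,
    lineDerivOp_chirp]
  congr 2
  simp only [← map_smul, ← map_add, ← FourierTransform.fourierInv_smul,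
    ← FourierTransform.fourierInv_add]
  congr 3
  ext x
  simp
  field_simp
  linear_combination (I ^ 2 * (-(∂_{v} g) x + I * (posOp v g) x)) * h2 +
    2 * (-(∂_{v} g) x + I * (posOp v g) x) * I_sq

open LineDeriv in
theorem posOp_rotationSchwartz (v : Space n) (g : 𝓢(Space n, ℂ)) :
    posOp v (rotationSchwartz n g) =
      rotationSchwartz n ((√2 : ℂ)⁻¹ • (I • ∂_{v} g + posOp v g)) := by
  have h2 := sqrt_two_mul_self_complex
  have h3 := sqrt_two_complex_ne_zero
  have hpi : (Real.pi : ℂ) ≠ 0 := ofReal_ne_zero.mpr Real.pi_ne_zero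
  rw [rotationSchwartz_eq, rotationSchwartz_eq, map_smul, posOp_chirp,
    posOp_dilate, posOp_fourierInv, lineDerivOp_chirp]
  congr 2
  simp only [← map_smul, ← FourierTransform.fourierInv_smul]
  congr 3
  ext x
  simp
  field_simp
  linear_combination (I * ((∂_{v} g) x - I * (posOp v g) x)) * h2 - 2 * (posOp v g) x * I_sq

open LineDeriv in
/-- The shifted dilation generator on Schwartz functions. -/
def dilationSchwartz (n : ℕ) : 𝓢(Space n, ℂ) →L[ℂ] 𝓢(Space n, ℂ) :=
  -I • ∑ j : Fin n,
    (lineDerivOpCLM ℂ 𝓢(Space n, ℂ) (EuclideanSpace.single j (1 : ℝ)) ∘L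
        posOp (EuclideanSpace.single j 1) +
      posOp (EuclideanSpace.single j 1) ∘L
        lineDerivOpCLM ℂ 𝓢(Space n, ℂ) (EuclideanSpace.single j (1 : ℝ))) -
    ContinuousLinearMap.id ℂ _

open LineDeriv in
theorem dilationSchwartz_eq (g : 𝓢(Space n, ℂ)) : dilationSchwartz n g =
    -I • ∑ j : Fin n, (∂_{EuclideanSpace.single j (1 : ℝ)} (posOp (EuclideanSpace.single j 1) g) +
      posOp (EuclideanSpace.single j 1) (∂_{EuclideanSpace.single j (1 : ℝ)} g)) - g := by
  simp [dilationSchwartz]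

open LineDeriv in
theorem freeSchwartz_two_eq (g : 𝓢(Space n, ℂ)) : freeSchwartz n 2 g =
    -∑ j : Fin n,
      (∂_{EuclideanSpace.single j (1 : ℝ)} (∂_{EuclideanSpace.single j (1 : ℝ)} g) +
      posOp (EuclideanSpace.single j 1) (posOp (EuclideanSpace.single j 1) g)) - g := by
  rw [freeSchwartz_eq, SchwartzMap.laplacian_eq_sum (EuclideanSpace.basisFun (Fin n) ℝ)]
  ext x
  simp only [neg_apply, sub_apply, sum_apply, add_apply, posOp_apply,
    SchwartzMap.smulLeftCLM_apply_apply (hasTemperateGrowth_japanese n 2),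
    EuclideanSpace.basisFun_apply, EuclideanSpace.inner_single_right, Finset.sum_add_distrib]
  have h : (japanese n 2 x : ℂ) = 1 + ∑ j, (x j : ℂ) * x j := by
    rw [japanese, EuclideanSpace.real_norm_sq_eq]
    simp [sq]
  rw [h]
  simp [Finset.sum_mul, add_mul, mul_assoc]
  ring

-- In each coordinate D² - x² becomes ((D + x)² - (x - D)²)/2 = Dx + xD. The shift by -1 is the
-- constant in ⟨x⟩² = 1 + |x|².
open LineDeriv in
theorem freeSchwartz_rotationSchwartz (g : 𝓢(Space n, ℂ)) :
    freeSchwartz n 2 (rotationSchwartz n g) = rotationSchwartz n (dilationSchwartz n g) := by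
  rw [freeSchwartz_two_eq, dilationSchwartz_eq, map_sub, map_smul, map_sum, Finset.smul_sum,
    ← Finset.sum_neg_distrib]
  congr 1
  refine Finset.sum_congr rfl fun j _ => ?_
  generalize (EuclideanSpace.single j (1 : ℝ) : Space n) = v
  rw [lineDerivOp_rotationSchwartz, lineDerivOp_rotationSchwartz, posOp_rotationSchwartz,
    posOp_rotationSchwartz, ← map_add, ← map_neg, ← map_smul]
  have h2 := sqrt_two_mul_self_complex
  have h3 := sqrt_two_complex_ne_zero
  simp only [LineDeriv.lineDerivOp_smul, LineDeriv.lineDerivOp_add, map_add, map_smul]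
  ext x
  simp
  field_simp
  linear_combination (I * (rotationSchwartz n (posOp v (∂_{v} g)) x +
    rotationSchwartz n (∂_{v} (posOp v g)) x)) * h2 -
    (rotationSchwartz n (posOp v (posOp v g)) x + rotationSchwartz n (∂_{v} (∂_{v} g)) x) * I_sq

open LineDeriv in
theorem isFormalAdjoint_dilationExpr (n : ℕ) :
    IsFormalAdjoint (dilationExpr n - ContinuousLinearMap.id ℂ _) (dilationSchwartz n) := by
  intro φ g
  have hpos : ∀ (j : Fin n) (f : 𝓢(Space n, ℂ)),
      SchwartzMap.smulLeftCLM ℂ (fun x : Space n => (x j : ℂ)) f =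
        posOp (EuclideanSpace.single j 1) f := by
    intro j f
    have h : (fun x : Space n => (x j : ℂ)).HasTemperateGrowth :=
      ((ofRealCLM ∘L (EuclideanSpace.proj j : Space n →L[ℝ] ℝ)).hasTemperateGrowth)
    ext x
    simp [posOp_apply, SchwartzMap.smulLeftCLM_apply_apply h, EuclideanSpace.inner_single_right]
  have hconj : ∀ (v : Space n) (f : 𝓢(Space n, ℂ)),
      schwartzConj (posOp v f) = posOp v (schwartzConj f) := by
    intro v f
    ext x
    simp [posOp_apply]
  rw [dilationSchwartz_eq, schwartzConj_sub, schwartzConj_smul, schwartzConj_sum, map_sub,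
    map_smul, map_sum]
  have hT : ∀ h, (dilationExpr n - ContinuousLinearMap.id ℂ 𝓢'(Space n, ℂ)) φ h =
      -I • ∑ j : Fin n, ((∂_{EuclideanSpace.single j (1 : ℝ)}
        (TemperedDistribution.smulLeftCLM ℂ (fun x : Space n => (x j : ℂ)) φ)) h +
        (TemperedDistribution.smulLeftCLM ℂ (fun x : Space n => (x j : ℂ))
          (∂_{EuclideanSpace.single j (1 : ℝ)} φ)) h) - φ h := by
    intro h
    simp [dilationExpr]
  rw [hT]
  congr 1
  rw [Finset.smul_sum, Finset.smul_sum]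
  refine Finset.sum_congr rfl fun j _ => ?_
  rw [schwartzConj_add, schwartzConj_lineDerivOp, hconj, hconj, schwartzConj_lineDerivOp]
  simp only [TemperedDistribution.smulLeftCLM_apply_apply,
    TemperedDistribution.lineDerivOp_apply_apply, hpos, map_neg, map_add]
  simp
  ring


theorem norm_sq_schwartzL2 (g : 𝓢(Space n, ℂ)) : ‖schwartzL2 n g‖ ^ 2 = ∫ x, ‖g x‖ ^ 2 := by
  rw [← integral_norm_sq]
  refine integral_congr_ae ?_
  filter_upwards [coeFn_schwartzL2 g] with x hx
  rw [hx]

/-- Chirps have modulus 1, Plancherel takes care of `𝓕⁻`, and the normalizing constant offsets the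
Jacobian (√2 π)ⁿ of the dilation. -/
theorem norm_schwartzL2_rotationSchwartz (g : 𝓢(Space n, ℂ)) :
    ‖schwartzL2 n (rotationSchwartz n g)‖ = ‖schwartzL2 n g‖ := by
  have hF : ‖schwartzL2 n (𝓕⁻ (chirp n (-1) g))‖ = ‖schwartzL2 n (chirp n (-1) g)‖ := by
    have := SchwartzMap.norm_fourier_toL2_eq (𝓕⁻ (chirp n (-1) g))
    rw [FourierTransform.fourier_fourierInv_eq] at this
    exact this.symm
  have hchirp : ∀ h : 𝓢(Space n, ℂ), ‖schwartzL2 n (chirp n (-1) h)‖ = ‖schwartzL2 n h‖ := by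
    intro h
    rw [← sq_eq_sq₀ (norm_nonneg _) (norm_nonneg _), norm_sq_schwartzL2, norm_sq_schwartzL2]
    simp [chirp_apply, norm_chirpFun]
  have hdil : ∀ h : 𝓢(Space n, ℂ), ‖schwartzL2 n (dilate rotationScale_ne_zero h)‖ ^ 2 =
      (√2 * Real.pi) ^ n * ‖schwartzL2 n h‖ ^ 2 := by
    intro h
    rw [norm_sq_schwartzL2, norm_sq_schwartzL2]
    have := Measure.integral_comp_smul (volume : Measure (Space n)) (fun x => ‖h x‖ ^ 2)
      (√2 * Real.pi)⁻¹
    simp only [dilate_apply]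
    rw [this, finrank_euclideanSpace_fin, smul_eq_mul, inv_pow, inv_inv, abs_of_pos (by positivity)]
  rw [← sq_eq_sq₀ (norm_nonneg _) (norm_nonneg _), rotationSchwartz_eq, map_smul, norm_smul,
    mul_pow, hchirp, hdil, hF, hchirp, norm_real, Real.norm_of_nonneg (rotationConst_pos n).le,
    ← mul_assoc]
  have : ((√2 * Real.pi) ^ (-(n : ℝ) / 2)) ^ 2 * (√2 * Real.pi) ^ n = 1 := by
    have hp : 0 < √2 * Real.pi := by positivity
    rw [← Real.rpow_natCast, ← Real.rpow_mul hp.le, ← Real.rpow_natCast _ n,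
      ← Real.rpow_add hp]
    simp
  rw [this, one_mul]

/-- The unitary operator `U`. -/
def rotation (n : ℕ) : L2 n ≃ₗᵢ[ℂ] L2 n :=
  (rotationSchwartz n).extendOfIsometry (schwartzL2 n) (schwartzL2 n)
    denseRange_schwartzL2 denseRange_schwartzL2 norm_schwartzL2_rotationSchwartz

theorem rotation_schwartzL2 (g : 𝓢(Space n, ℂ)) :
    rotation n (schwartzL2 n g) = schwartzL2 n (rotationSchwartz n g) :=
  LinearEquiv.extendOfIsometry_eq (rotationSchwartz n) (schwartzL2 n).toLinearMap
    (schwartzL2 n).toLinearMap denseRange_schwartzL2 denseRange_schwartzL2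
    norm_schwartzL2_rotationSchwartz g

theorem rotationSchwartz_apply (g : 𝓢(Space n, ℂ)) (x : Space n) :
    rotationSchwartz n g x = rotationIntegral n g x := by
  rw [rotationSchwartz_eq, rotationIntegral, smul_apply, chirp_apply, dilate_apply,
    SchwartzMap.fourierInv_coe, Real.fourierInv_eq', smul_eq_mul, mul_assoc, chirpFun]
  congr 2
  · simp
  refine integral_congr_ae (Filter.Eventually.of_forall fun y => ?_)
  simp only [chirp_apply, chirpFun, smul_eq_mul, inner_smul_right, real_inner_comm y x]
  -- The phase of `𝓕⁻` is 2π⟨y, ξ⟩, here taken at ξ = x / (√2 π); this fixes the scale of the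
  -- dilation.
  have hs : 2 * Real.pi * ((√2 * Real.pi)⁻¹ * inner ℝ y x) = √2 * inner ℝ y x := by
    have h2 : √2 * √2 = 2 := Real.mul_self_sqrt (by norm_num)
    have h3 : √2 ≠ 0 := by positivity
    field_simp
    rw [sq, h2]
  rw [hs, ← mul_assoc]
  congr 3
  · ring
  · push_cast; ring

theorem rotation_toLp (f : 𝓢(Space n, ℂ)) :
    rotation n (f.toLp 2 volume) =ᵐ[volume] rotationIntegral n f := by
  rw [← schwartzL2_apply, rotation_schwartzL2]
  filter_upwards [coeFn_schwartzL2 (rotationSchwartz n f)] with x hx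
  rw [hx, rotationSchwartz_apply]

/-- Both graphs are characterized by duality with Schwartz functions, and U maps the Schwartz space
onto itself and intertwines the two expressions there. The domains therefore correspond without
further estimates. -/
theorem conjugates_rotation (n : ℕ) :
    Conjugates (rotation n) (shiftedDilation n) (maximalRealization n (freeExpr n 2)) := by
  intro u f
  rw [shiftedDilation, (isFormalAdjoint_dilationExpr n).mem_graph_iff,
    (isFormalAdjoint_freeExpr n 2).mem_graph_iff]
  refine Iff.trans ?_ (rotationSchwartz n).surjective.forall.symm
  simp only [freeSchwartz_rotationSchwartz, ← rotation_schwartzL2, LinearIsometryEquiv.inner_map_map]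

end Rotation

/-! ### Logarithmic coordinates on the orthants -/

section LogarithmicCoordinates

variable {n : ℕ}

theorem enorm_sq_eq_lintegral (u : L2 n) : ‖u‖ₑ ^ 2 = ∫⁻ x, ‖u x‖ₑ ^ 2 := by
  have h := eLpNorm_nnreal_pow_eq_lintegral (f := u) (μ := volume) (p := 2) (by norm_num)
  rw [Lp.enorm_def]
  simpa using h

theorem memLp_two_iff_lintegral {f : Space n → ℂ} (hf : AEStronglyMeasurable f volume) :
    MemLp f 2 volume ↔ ∫⁻ x, ‖f x‖ₑ ^ 2 < ⊤ := by
  have h := eLpNorm_nnreal_pow_eq_lintegral (f := f) (μ := volume) (p := 2) (by norm_num)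
  have h2 : eLpNorm f 2 volume ^ 2 = ∫⁻ x, ‖f x‖ₑ ^ 2 := by simpa using h
  rw [← h2, MemLp, and_iff_right hf]
  exact (ENNReal.pow_lt_top_iff (n := 2)).trans (by simp) |>.symm

/-- The chart `t ↦ (σᵢ e^{tᵢ})ᵢ` onto the orthant with signs `σ`. -/
def expChart (σ : Fin n → ℤˣ) (t : Space n) : Space n :=
  WithLp.toLp 2 fun i => ((σ i : ℤ) : ℝ) * Real.exp (t i)

/-- The common inverse of the charts `expChart σ`. -/
def logChart (x : Space n) : Space n := WithLp.toLp 2 fun i => Real.log (x i)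

/-- The open orthant with signs `σ`. -/
def orthant (σ : Fin n → ℤˣ) : Set (Space n) := {x | ∀ i, 0 < ((σ i : ℤ) : ℝ) * x i}

theorem sign_mul_self (s : ℤˣ) : ((s : ℤ) : ℝ) * ((s : ℤ) : ℝ) = 1 := by
  rcases Int.units_eq_one_or s with rfl | rfl <;> simp

theorem abs_sign (s : ℤˣ) : |((s : ℤ) : ℝ)| = 1 := by
  rcases Int.units_eq_one_or s with rfl | rfl <;> simp

theorem logChart_expChart (σ : Fin n → ℤˣ) (t : Space n) : logChart (expChart σ t) = t := by
  ext i
  simp only [logChart, expChart]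
  rw [← Real.log_abs, abs_mul, abs_sign, one_mul, Real.log_abs, Real.log_exp]

theorem expChart_mem_orthant (σ : Fin n → ℤˣ) (t : Space n) : expChart σ t ∈ orthant σ := by
  intro i
  simp only [expChart]
  rw [← mul_assoc, sign_mul_self, one_mul]
  exact Real.exp_pos _

theorem image_expChart (σ : Fin n → ℤˣ) : expChart σ '' Set.univ = orthant σ := by
  refine Set.Subset.antisymm ?_ fun x hx => ⟨logChart x, Set.mem_univ _, ?_⟩
  · rintro _ ⟨t, -, rfl⟩
    exact expChart_mem_orthant σ t
  · ext i
    have h := hx i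
    have h1 : |x i| = (σ i : ℤ) * x i := by
      rw [← abs_of_pos h, abs_mul, abs_sign, one_mul]
    have h2 : x i ≠ 0 := fun h0 => by simp [h0] at h
    simp only [expChart, logChart]
    rw [← Real.log_abs, Real.exp_log (abs_pos.mpr h2), h1, ← mul_assoc, sign_mul_self, one_mul]

theorem measurableSet_orthant (σ : Fin n → ℤˣ) : MeasurableSet (orthant σ) := by
  have : orthant σ = ⋂ i, {x : Space n | 0 < ((σ i : ℤ) : ℝ) * x i} := by
    ext x; simp [orthant]
  rw [this]
  exact MeasurableSet.iInter fun i => measurableSet_lt measurable_const (by fun_prop)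

theorem eq_of_mem_orthant {σ τ : Fin n → ℤˣ} {x : Space n} (hσ : x ∈ orthant σ)
    (hτ : x ∈ orthant τ) : σ = τ := by
  funext i
  have h1 := hσ i
  have h2 := hτ i
  rcases Int.units_eq_one_or (σ i) with h | h <;> rcases Int.units_eq_one_or (τ i) with h' | h' <;>
    rw [h, h'] <;> rw [h] at h1 <;> rw [h'] at h2 <;> simp at h1 h2 <;> linarith

theorem ae_mem_iUnion_orthant : ∀ᵐ x : Space n, x ∈ ⋃ σ : Fin n → ℤˣ, orthant σ := by
  have h : ∀ i : Fin n, ∀ᵐ x : Space n, x i ≠ 0 := by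
    intro i
    have hne : LinearMap.ker (EuclideanSpace.proj i : Space n →L[ℝ] ℝ).toLinearMap ≠ ⊤ := by
      intro htop
      have : EuclideanSpace.single i (1 : ℝ) ∈
          LinearMap.ker (EuclideanSpace.proj i : Space n →L[ℝ] ℝ).toLinearMap := by
        rw [htop]; trivial
      simp at this
    have := Measure.addHaar_submodule volume _ hne
    rw [ae_iff]
    refine measure_mono_null (fun x hx => ?_) this
    simpa using hx
  filter_upwards [ae_all_iff.mpr h] with x hx
  refine Set.mem_iUnion.mpr ⟨fun i => if 0 < x i then 1 else -1, fun i => ?_⟩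
  have := hx i
  by_cases h0 : 0 < x i
  · simp [h0]
  · have : x i < 0 := lt_of_le_of_ne (not_lt.mp h0) this
    simp [h0, this]

theorem sum_lintegral_orthant (F : Space n → ℝ≥0∞) :
    ∑ σ : Fin n → ℤˣ, ∫⁻ x in orthant σ, F x = ∫⁻ x, F x := by
  rw [← tsum_fintype (L := .unconditional _), ← lintegral_iUnion measurableSet_orthant]
  · conv_rhs => rw [← setLIntegral_univ F]
    exact setLIntegral_congr (Filter.eventuallyEq_univ.mpr ae_mem_iUnion_orthant)
  · intro σ τ hne
    exact Set.disjoint_left.mpr fun x h1 h2 => hne (eq_of_mem_orthant h1 h2)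

/-- The derivative of `expChart σ`. -/
def expChartDeriv (σ : Fin n → ℤˣ) (t : Space n) : Space n →L[ℝ] Space n :=
  LinearMap.toContinuousLinearMap
    { toFun := fun v => WithLp.toLp 2 fun i => ((σ i : ℤ) : ℝ) * Real.exp (t i) * v i
      map_add' := fun v w => by ext i; simp [mul_add]
      map_smul' := fun c v => by ext i; simp [mul_left_comm] }

theorem expChartDeriv_apply (σ : Fin n → ℤˣ) (t v : Space n) (i : Fin n) :
    expChartDeriv σ t v i = ((σ i : ℤ) : ℝ) * Real.exp (t i) * v i := rfl

theorem hasFDerivAt_expChart (σ : Fin n → ℤˣ) (t : Space n) :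
    HasFDerivAt (expChart σ) (expChartDeriv σ t) t := by
  rw [← hasFDerivWithinAt_univ, hasFDerivWithinAt_euclidean]
  intro i
  have h1 : HasFDerivAt (fun x : Space n => x i) (EuclideanSpace.proj i : Space n →L[ℝ] ℝ) t :=
    (EuclideanSpace.proj i : Space n →L[ℝ] ℝ).hasFDerivAt
  refine ((h1.exp.const_mul (((σ i : ℤ) : ℝ))).congr_fderiv ?_).hasFDerivWithinAt
  ext v
  simp [expChartDeriv_apply, mul_assoc]

theorem abs_det_expChartDeriv (σ : Fin n → ℤˣ) (t : Space n) :
    |(expChartDeriv σ t).det| = Real.exp (∑ i, t i) := by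
  rw [ContinuousLinearMap.det,
    ← LinearMap.det_toMatrix (EuclideanSpace.basisFun (Fin n) ℝ).toBasis]
  have : LinearMap.toMatrix (EuclideanSpace.basisFun (Fin n) ℝ).toBasis
      (EuclideanSpace.basisFun (Fin n) ℝ).toBasis (expChartDeriv σ t).toLinearMap =
      Matrix.diagonal fun i => ((σ i : ℤ) : ℝ) * Real.exp (t i) := by
    ext i j
    rw [LinearMap.toMatrix_apply]
    simp only [OrthonormalBasis.coe_toBasis, EuclideanSpace.basisFun_apply,
      OrthonormalBasis.coe_toBasis_repr_apply, EuclideanSpace.basisFun_repr]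
    change expChartDeriv σ t (EuclideanSpace.single j 1) i = _
    rw [expChartDeriv_apply, Matrix.diagonal_apply]
    by_cases h : i = j
    · subst h; simp
    · simp [h]
  rw [this, Matrix.det_diagonal, Finset.abs_prod, Real.exp_sum]
  refine Finset.prod_congr rfl fun i _ => ?_
  rw [abs_mul, abs_sign, one_mul, Real.abs_exp]

theorem lintegral_orthant (σ : Fin n → ℤˣ) (F : Space n → ℝ≥0∞) :
    ∫⁻ x in orthant σ, F x =
      ∫⁻ t : Space n, ENNReal.ofReal (Real.exp (∑ i, t i)) * F (expChart σ t) := by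
  have h := lintegral_image_eq_lintegral_abs_det_fderiv_mul volume MeasurableSet.univ
    (fun t _ => (hasFDerivAt_expChart σ t).hasFDerivWithinAt)
    ((Function.LeftInverse.injective (logChart_expChart σ)).injOn) F
  rw [image_expChart, setLIntegral_univ] at h
  simpa only [abs_det_expChartDeriv] using h

theorem continuous_expChart (σ : Fin n → ℤˣ) : Continuous (expChart σ) :=
  continuous_iff_continuousAt.mpr fun t => (hasFDerivAt_expChart σ t).continuousAt

theorem measurable_logChart : Measurable (logChart : Space n → Space n) := by
  unfold logChart
  fun_prop

/-- The Jacobian is strictly positive, so null sets pull back to null sets; without this the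
pullback would not be defined on L² classes. -/
theorem quasiMeasurePreserving_expChart (σ : Fin n → ℤˣ) :
    Measure.QuasiMeasurePreserving (expChart σ) volume volume := by
  refine ⟨(continuous_expChart σ).measurable, ?_⟩
  refine Measure.AbsolutelyContinuous.mk fun s hs h0 => ?_
  rw [Measure.map_apply (continuous_expChart σ).measurable hs]
  have h1 : ∫⁻ x in orthant σ, s.indicator 1 x = 0 := by
    refine le_antisymm ((setLIntegral_le_lintegral _ _).trans ?_) zero_le
    rw [lintegral_indicator_one hs, h0]
  rw [lintegral_orthant, lintegral_eq_zero_iff (by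
    refine Measurable.mul (by fun_prop) ?_
    exact (measurable_one.indicator hs).comp (continuous_expChart σ).measurable)] at h1
  have h2 : ∀ᵐ t : Space n, expChart σ t ∉ s := by
    filter_upwards [h1] with t ht hts
    have := Real.exp_pos (∑ i, t i)
    simp [hts, not_le.mpr this] at ht
  rw [ae_iff] at h2
  simp only [not_not] at h2
  exact h2

/-- The square root `e^{(t₁ + ⋯ + tₙ) / 2}` of the Jacobian of the charts. -/
def chartWeight (t : Space n) : ℝ := Real.exp ((∑ i, t i) / 2)

theorem chartWeight_pos (t : Space n) : 0 < chartWeight t := Real.exp_pos _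

theorem continuous_chartWeight : Continuous (chartWeight : Space n → ℝ) := by
  unfold chartWeight
  fun_prop

theorem enorm_mul_chartWeight_sq (z : ℂ) (t : Space n) :
    ‖z * (chartWeight t : ℂ)‖ₑ ^ 2 = ENNReal.ofReal (Real.exp (∑ i, t i)) * ‖z‖ₑ ^ 2 := by
  have h : ‖(chartWeight t : ℂ)‖ₑ = ENNReal.ofReal (chartWeight t) := by
    rw [← ofReal_norm, norm_real, Real.norm_of_nonneg (chartWeight_pos t).le]
  rw [enorm_mul, mul_pow, h, ← ENNReal.ofReal_pow (chartWeight_pos t).le, chartWeight,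
    ← Real.exp_nat_mul, mul_comm]
  congr 3
  push_cast
  ring

/-- The function `u` on an orthant in logarithmic coordinates. -/
def orthantPullback (σ : Fin n → ℤˣ) (u : Space n → ℂ) (t : Space n) : ℂ :=
  u (expChart σ t) * (chartWeight t : ℂ)

theorem lintegral_orthantPullback (σ : Fin n → ℤˣ) (u : Space n → ℂ) :
    ∫⁻ t, ‖orthantPullback σ u t‖ₑ ^ 2 = ∫⁻ x in orthant σ, ‖u x‖ₑ ^ 2 := by
  rw [lintegral_orthant]
  simp only [orthantPullback, enorm_mul_chartWeight_sq]

theorem orthantPullback_congr (σ : Fin n → ℤˣ) {u v : Space n → ℂ} (h : u =ᵐ[volume] v) :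
    orthantPullback σ u =ᵐ[volume] orthantPullback σ v := by
  filter_upwards [(quasiMeasurePreserving_expChart σ).ae h] with t ht
  rw [orthantPullback, ht, orthantPullback]

theorem memLp_orthantPullback (σ : Fin n → ℤˣ) {u : Space n → ℂ} (hu : MemLp u 2 volume) :
    MemLp (orthantPullback σ u) 2 volume := by
  have hm : AEStronglyMeasurable (orthantPullback σ u) volume :=
    (hu.1.comp_quasiMeasurePreserving (quasiMeasurePreserving_expChart σ)).mul
      (continuous_ofReal.comp continuous_chartWeight).aestronglyMeasurable
  rw [memLp_two_iff_lintegral hm, lintegral_orthantPullback]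
  exact (setLIntegral_le_lintegral _ _).trans_lt ((memLp_two_iff_lintegral hu.1).mp hu)

/-- The restriction of an `L²` function to an orthant, in logarithmic coordinates. -/
def orthantMap (σ : Fin n → ℤˣ) : L2 n →L[ℂ] L2 n :=
  LinearMap.mkContinuous
    { toFun := fun u => (memLp_orthantPullback σ (Lp.memLp u)).toLp _
      map_add' := fun u v => by
        refine Lp.ext ?_
        filter_upwards [MemLp.coeFn_toLp (memLp_orthantPullback σ (Lp.memLp (u + v))),
          MemLp.coeFn_toLp (memLp_orthantPullback σ (Lp.memLp u)),
          MemLp.coeFn_toLp (memLp_orthantPullback σ (Lp.memLp v)),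
          Lp.coeFn_add ((memLp_orthantPullback σ (Lp.memLp u)).toLp _)
            ((memLp_orthantPullback σ (Lp.memLp v)).toLp _),
          orthantPullback_congr σ (Lp.coeFn_add u v)] with t h1 h2 h3 h4 h5
        rw [h1, h4, Pi.add_apply, h2, h3, h5]
        simp only [orthantPullback, Pi.add_apply, add_mul]
      map_smul' := fun c u => by
        refine Lp.ext ?_
        filter_upwards [MemLp.coeFn_toLp (memLp_orthantPullback σ (Lp.memLp (c • u))),
          MemLp.coeFn_toLp (memLp_orthantPullback σ (Lp.memLp u)),
          Lp.coeFn_smul c ((memLp_orthantPullback σ (Lp.memLp u)).toLp _),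
          orthantPullback_congr σ (Lp.coeFn_smul c u)] with t h1 h2 h3 h4
        rw [RingHom.id_apply, h1, h3, Pi.smul_apply, h2, h4]
        simp only [orthantPullback, Pi.smul_apply, smul_eq_mul, mul_assoc] }
    1 (fun u => by
      rw [one_mul, ← enorm_le_iff_norm_le, ← ENNReal.pow_le_pow_left_iff two_ne_zero,
        enorm_sq_eq_lintegral, enorm_sq_eq_lintegral]
      refine le_trans (le_of_eq ?_) (setLIntegral_le_lintegral (orthant σ) _)
      rw [← lintegral_orthantPullback]
      refine lintegral_congr_ae ?_
      filter_upwards [MemLp.coeFn_toLp (memLp_orthantPullback σ (Lp.memLp u))] with t ht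
      exact congrArg (fun z => ‖z‖ₑ ^ 2) ht)

theorem coeFn_orthantMap (σ : Fin n → ℤˣ) (u : L2 n) :
    orthantMap σ u =ᵐ[volume] orthantPullback σ u :=
  MemLp.coeFn_toLp (memLp_orthantPullback σ (Lp.memLp u))

theorem sum_enorm_orthantMap_sq (u : L2 n) :
    ∑ σ : Fin n → ℤˣ, ‖orthantMap σ u‖ₑ ^ 2 = ‖u‖ₑ ^ 2 := by
  rw [enorm_sq_eq_lintegral, ← sum_lintegral_orthant]
  refine Finset.sum_congr rfl fun σ _ => ?_
  rw [enorm_sq_eq_lintegral, ← lintegral_orthantPullback]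
  refine lintegral_congr_ae ?_
  filter_upwards [coeFn_orthantMap σ u] with t ht
  rw [ht]

/-- The orthants are disjoint and each chart is a bijection onto its orthant, so arbitrary
components can be carried back and glued. -/
theorem exists_orthantMap_eq (g : (Fin n → ℤˣ) → L2 n) : ∃ u : L2 n, ∀ σ, orthantMap σ u = g σ := by
  set f : Space n → ℂ := fun x => ∑ σ, (orthant σ).indicator
    (fun x => g σ (logChart x) * ((chartWeight (logChart x))⁻¹ : ℝ)) x with hf
  have hfσ : ∀ σ, ∀ x ∈ orthant σ, f x = g σ (logChart x) * ((chartWeight (logChart x))⁻¹ : ℝ) := by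
    intro σ x hx
    rw [hf]
    simp only
    rw [Finset.sum_eq_single σ, Set.indicator_of_mem hx]
    · intro τ _ hne
      exact Set.indicator_of_notMem (fun hτ => hne (eq_of_mem_orthant hτ hx)) _
    · simp
  have hpull : ∀ σ t, orthantPullback σ f t = g σ t := by
    intro σ t
    have h0 : (chartWeight t : ℂ) ≠ 0 := ofReal_ne_zero.mpr (chartWeight_pos t).ne'
    rw [orthantPullback, hfσ σ _ (expChart_mem_orthant σ t), logChart_expChart, ofReal_inv,
      inv_mul_cancel_right₀ h0]
  have hm : StronglyMeasurable f := by
    refine Finset.stronglyMeasurable_fun_sum _ fun σ _ => StronglyMeasurable.indicator ?_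
      (measurableSet_orthant σ)
    refine ((Lp.stronglyMeasurable (g σ)).comp_measurable measurable_logChart).mul ?_
    refine Measurable.stronglyMeasurable ?_
    exact (measurable_ofReal.comp
      ((continuous_chartWeight.measurable.comp measurable_logChart).inv))
  have hL : MemLp f 2 volume := by
    rw [memLp_two_iff_lintegral hm.aestronglyMeasurable, ← sum_lintegral_orthant,
      ENNReal.sum_lt_top]
    intro σ _
    rw [← lintegral_orthantPullback]
    simp only [hpull]
    exact (memLp_two_iff_lintegral (Lp.aestronglyMeasurable _)).mp (Lp.memLp (g σ))
  refine ⟨hL.toLp f, fun σ => Lp.ext ?_⟩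
  filter_upwards [coeFn_orthantMap σ (hL.toLp f), orthantPullback_congr σ hL.coeFn_toLp]
    with t h1 h2
  rw [h1, h2, hpull]

end LogarithmicCoordinates

/-! ### Diagonalization of the dilation generator -/

section MellinTransform

variable {n : ℕ}

-- Integration by parts against a Schwartz function identifies the classical derivative with the
-- distributional one; square integrability of h and h' is all that the boundary behaviour requires.
open LineDeriv in
theorem toDist_eq_lineDerivOp {h h' : Space n → ℂ} (hh : MemLp h 2 volume)
    (hh' : MemLp h' 2 volume) {v : Space n} (hd : ∀ t, HasLineDerivAt ℝ h (h' t) t v) :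
    toDist n (hh'.toLp h') = ∂_{v} (toDist n (hh.toLp h)) := by
  ext φ
  rw [TemperedDistribution.lineDerivOp_apply_apply]
  have hint : ∀ (ψ : 𝓢(Space n, ℂ)) {k : Space n → ℂ} (hk : MemLp k 2 volume),
      toDist n (hk.toLp k) ψ = ∫ x, ψ x * k x := by
    intro ψ k hk
    change Lp.toTemperedDistribution (hk.toLp k) ψ = _
    rw [Lp.toTemperedDistribution_apply]
    refine integral_congr_ae ?_
    filter_upwards [hk.coeFn_toLp] with x hx
    rw [hx, smul_eq_mul]
  have hi : ∀ (ψ : 𝓢(Space n, ℂ)) {k : Space n → ℂ}, MemLp k 2 volume →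
      Integrable fun x => ψ x * k x := fun ψ k hk => (ψ.memLp 2 volume).integrable_mul hk
  rw [hint, hint]
  have hkey := integral_bilinear_hasLineDerivAt_right_eq_neg_left_of_integrable
    (μ := (volume : Measure (Space n))) (f := φ) (f' := ⇑(∂_{v} φ : 𝓢(Space n, ℂ)))
    (g := h) (g' := h') (v := v) (B := ContinuousLinearMap.mul ℝ ℂ)
    (hi _ hh) (hi _ hh') (hi _ hh)
    (fun x _ => by
      rw [SchwartzMap.lineDerivOp_apply_eq_fderiv]
      exact φ.differentiableAt.hasFDerivAt.hasLineDerivAt v)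
    (fun x _ => hd x)
  simp only [ContinuousLinearMap.mul_apply'] at hkey
  rw [hkey, ← integral_neg]
  simp

-- The multiplier is unbounded, so the right side is only known to be locally integrable. The
-- equality of distributions is therefore tested on smooth functions of compact support.
open LineDeriv in
theorem coeFn_fourier_of_lineDerivOp {u f : L2 n} {v : Space n}
    (h : toDist n f = ∂_{v} (toDist n u)) :
    (𝓕 f : L2 n) =ᵐ[volume] fun ξ => 2 * Real.pi * I * (inner ℝ ξ v : ℝ) * (𝓕 u : L2 n) ξ := by
  have hT : toDist n (𝓕 f) = (2 * Real.pi * I) •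
      TemperedDistribution.smulLeftCLM ℂ (fun ξ => (inner ℝ ξ v : ℝ)) (toDist n (𝓕 u)) := by
    have h1 := Lp.fourier_toTemperedDistribution_eq f
    have h2 := Lp.fourier_toTemperedDistribution_eq u
    change 𝓕 (toDist n f) = toDist n (𝓕 f) at h1
    change 𝓕 (toDist n u) = toDist n (𝓕 u) at h2
    rw [← h1, h, TemperedDistribution.fourier_lineDerivOp_eq, h2]
  have hloc : ∀ w : L2 n, LocallyIntegrable w volume := fun w =>
    (Lp.memLp w).locallyIntegrable (by norm_num)
  refine ae_eq_of_integral_contDiff_smul_eq (hloc _) ?_ fun g hg hgc => ?_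
  · rw [locallyIntegrable_iff]
    intro k hk
    have hc : ContinuousOn (fun ξ : Space n => 2 * Real.pi * I * ((inner ℝ ξ v : ℝ) : ℂ)) k := by
      fun_prop
    exact ((locallyIntegrable_iff.mp (hloc (𝓕 u))) k hk).continuousOn_mul hc hk
  · set G : Space n → ℂ := fun x => (g x : ℂ) with hG
    have hGc : HasCompactSupport G := hgc.comp_left ofReal_zero
    have hGs : ContDiff ℝ ∞ G := ofRealCLM.contDiff.comp hg
    have hev := congrArg (fun T : 𝓢'(Space n, ℂ) => T (hGc.toSchwartzMap hGs)) hT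
    simp only [smul_apply] at hev
    rw [TemperedDistribution.smulLeftCLM_apply_apply] at hev
    change Lp.toTemperedDistribution (𝓕 f) _ = _ • Lp.toTemperedDistribution (𝓕 u) _ at hev
    rw [Lp.toTemperedDistribution_apply, Lp.toTemperedDistribution_apply, ← integral_smul] at hev
    refine Eq.trans ?_ (hev.trans ?_)
    · refine integral_congr_ae (Filter.Eventually.of_forall fun x => ?_)
      change g x • _ = (g x : ℂ) • _
      simp
    · refine integral_congr_ae (Filter.Eventually.of_forall fun x => ?_)
      simp only
      change _ • (posOp v (hGc.toSchwartzMap hGs) x) • _ = _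
      rw [posOp_apply]
      change _ • (((inner ℝ x v : ℝ) : ℂ) * (g x : ℂ)) • _ = _
      simp only [smul_eq_mul, real_smul]
      ring

/-- The vector `(1, …, 1)`. -/
def diagonalVector (n : ℕ) : Space n := WithLp.toLp 2 fun _ => 1

theorem diagonalVector_apply (i : Fin n) : diagonalVector n i = 1 := rfl

/-- The generator `x · ∇ + n / 2` of the dilations on Schwartz functions. -/
def eulerSchwartz (g : 𝓢(Space n, ℂ)) : 𝓢(Space n, ℂ) := (I / 2) • (dilationSchwartz n g + g)

open LineDeriv in
theorem lineDerivOp_posOp_apply (v : Space n) (g : 𝓢(Space n, ℂ)) (x : Space n) :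
    (∂_{v} (posOp v g)) x = ((‖v‖ ^ 2 : ℝ) : ℂ) * g x + (inner ℝ x v : ℝ) * (∂_{v} g) x := by
  have h0 : ⇑(posOp v g) = fun x => ((inner ℝ x v : ℝ) : ℂ) * g x := funext fun x => posOp_apply v g x
  have h1 : HasFDerivAt (fun x : Space n => (inner ℝ x v : ℝ)) (innerSL ℝ v) x := by
    simp_rw [fun x => real_inner_comm v x]
    exact (innerSL ℝ v).hasFDerivAt
  have h2 := (ofRealCLM.hasFDerivAt.comp x h1).mul g.differentiableAt.hasFDerivAt
  rw [SchwartzMap.lineDerivOp_apply_eq_fderiv, h0]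
  have h3 := h2.fderiv
  simp only [Function.comp_def, ofRealCLM_apply] at h3
  change fderiv ℝ (fun x => ((inner ℝ x v : ℝ) : ℂ) * g x) x v = _
  erw [h3]
  simp [SchwartzMap.lineDerivOp_apply_eq_fderiv]
  ring

open LineDeriv in
theorem eulerSchwartz_apply (g : 𝓢(Space n, ℂ)) (x : Space n) :
    eulerSchwartz g x = fderiv ℝ g x x + n / 2 * g x := by
  have hx : ∑ j : Fin n, (x j : ℂ) * fderiv ℝ g x (EuclideanSpace.single j 1) = fderiv ℝ g x x := by
    refine Eq.trans ?_ (congrArg (fderiv ℝ g x) ((EuclideanSpace.basisFun (Fin n) ℝ).sum_repr x))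
    simp
  rw [eulerSchwartz, dilationSchwartz_eq]
  simp only [smul_apply, add_apply, sub_apply, sum_apply, lineDerivOp_posOp_apply, posOp_apply,
    EuclideanSpace.inner_single_right, smul_eq_mul]
  simp only [SchwartzMap.lineDerivOp_apply_eq_fderiv, Finset.sum_add_distrib, PiLp.norm_single, norm_one, one_pow, ofReal_one,
    one_mul, RCLike.conj_to_real]
  simp only [hx, Finset.sum_const, Finset.card_univ,
    Fintype.card_fin, nsmul_eq_mul]
  linear_combination (-(fderiv ℝ g x x) - n / 2 * g x) * I_sq

/-- In logarithmic coordinates x·∇ is the constant field ∂₁ + ⋯ + ∂ₙ, and the derivative of the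
weight along it supplies n/2. -/
theorem hasLineDerivAt_orthantPullback (σ : Fin n → ℤˣ) (g : 𝓢(Space n, ℂ)) (t : Space n) :
    HasLineDerivAt ℝ (orthantPullback σ g) (orthantPullback σ (eulerSchwartz g) t) t
      (diagonalVector n) := by
  have h1 : HasFDerivAt (fun t => g (expChart σ t))
      ((fderiv ℝ g (expChart σ t)).comp (expChartDeriv σ t)) t :=
    (g.differentiableAt (x := expChart σ t)).hasFDerivAt.comp t (hasFDerivAt_expChart σ t)
  have h2 : HasFDerivAt (fun t : Space n => (∑ i, t i) / 2)
      ((2⁻¹ : ℝ) • ∑ i, (EuclideanSpace.proj i : Space n →L[ℝ] ℝ)) t := by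
    have : (fun t : Space n => (∑ i, t i) / 2) =
        ⇑((2⁻¹ : ℝ) • ∑ i, (EuclideanSpace.proj i : Space n →L[ℝ] ℝ)) := by
      funext t
      simp [div_eq_inv_mul]
    rw [this]
    exact ContinuousLinearMap.hasFDerivAt _
  have h3 : HasFDerivAt (fun t : Space n => (chartWeight t : ℂ)) _ t :=
    ofRealCLM.hasFDerivAt.comp t h2.exp
  have h4 := (h1.mul h3).hasLineDerivAt (diagonalVector n)
  have hd : expChartDeriv σ t (diagonalVector n) = expChart σ t := by
    ext i
    rw [expChartDeriv_apply]
    simp [diagonalVector, expChart]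
  convert! h4 using 1
  rw [orthantPullback, eulerSchwartz_apply]
  simp [hd, diagonalVector_apply, chartWeight]
  ring

theorem coeFn_fourier_orthantMap_eulerSchwartz (σ : Fin n → ℤˣ) (g : 𝓢(Space n, ℂ)) :
    (𝓕 (orthantMap σ (schwartzL2 n (eulerSchwartz g))) : L2 n) =ᵐ[volume] fun ξ =>
      2 * Real.pi * I * (inner ℝ ξ (diagonalVector n) : ℝ) *
        (𝓕 (orthantMap σ (schwartzL2 n g)) : L2 n) ξ := by
  have hL : ∀ f : 𝓢(Space n, ℂ), MemLp (orthantPullback σ f) 2 volume := fun f =>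
    memLp_orthantPullback σ (f.memLp 2 volume)
  have heq : ∀ f : 𝓢(Space n, ℂ), orthantMap σ (schwartzL2 n f) = (hL f).toLp _ := by
    intro f
    refine Lp.ext ?_
    filter_upwards [coeFn_orthantMap σ (schwartzL2 n f),
      orthantPullback_congr σ (coeFn_schwartzL2 f), (hL f).coeFn_toLp] with t h1 h2 h3
    rw [h1, h2, h3]
  refine coeFn_fourier_of_lineDerivOp ?_
  rw [heq, heq]
  exact toDist_eq_lineDerivOp (hL g) (hL _) (hasLineDerivAt_orthantPullback σ g)

/-- The function diagonalizing the shifted dilation generator. -/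
def dilationSymbol (n : ℕ) (ξ : Space n) : ℝ :=
  4 * Real.pi * inner ℝ ξ (diagonalVector n) - 1

theorem coeFn_fourier_orthantMap_dilationSchwartz (σ : Fin n → ℤˣ) (g : 𝓢(Space n, ℂ)) :
    (𝓕 (orthantMap σ (schwartzL2 n (dilationSchwartz n g))) : L2 n) =ᵐ[volume] fun ξ =>
      (dilationSymbol n ξ : ℂ) * (𝓕 (orthantMap σ (schwartzL2 n g)) : L2 n) ξ := by
  -- D·x + x·D = -2i(x·∇ + n/2), so the multiplier 2πi(ξ₁ + ⋯ + ξₙ) becomes 4π(ξ₁ + ⋯ + ξₙ).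
  have h : dilationSchwartz n g = (-2 * I) • eulerSchwartz g - g := by
    rw [eulerSchwartz, smul_smul]
    have : -2 * I * (I / 2) = 1 := by linear_combination -I_sq
    rw [this, one_smul, add_sub_cancel_right]
  have h2 : (𝓕 (orthantMap σ (schwartzL2 n (dilationSchwartz n g))) : L2 n) =
      (-2 * I) • 𝓕 (orthantMap σ (schwartzL2 n (eulerSchwartz g))) -
        𝓕 (orthantMap σ (schwartzL2 n g)) := by
    change Lp.fourierTransformₗᵢ (Space n) ℂ _ = _ • Lp.fourierTransformₗᵢ (Space n) ℂ _ -
      Lp.fourierTransformₗᵢ (Space n) ℂ _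
    rw [h]
    simp only [map_sub, map_smul]
  rw [h2]
  filter_upwards [coeFn_fourier_orthantMap_eulerSchwartz σ g,
    Lp.coeFn_sub ((-2 * I) • 𝓕 (orthantMap σ (schwartzL2 n (eulerSchwartz g))) : L2 n)
      (𝓕 (orthantMap σ (schwartzL2 n g))),
    Lp.coeFn_smul (-2 * I) (𝓕 (orthantMap σ (schwartzL2 n (eulerSchwartz g))) : L2 n)]
    with ξ h3 h4 h5
  rw [h4, Pi.sub_apply, h5, Pi.smul_apply, h3, dilationSymbol, smul_eq_mul]
  push_cast
  linear_combination (-4 * Real.pi * (inner ℝ ξ (diagonalVector n) : ℝ) *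
    (𝓕 (orthantMap σ (schwartzL2 n g)) : L2 n) ξ) * I_sq

/-- The components of a unitary operator which diagonalizes `-Δ - ⟨x⟩²`. -/
def mellin (σ : Fin n → ℤˣ) : L2 n →L[ℂ] L2 n :=
  (Lp.fourierTransformₗᵢ (Space n) ℂ).toContinuousLinearEquiv.toContinuousLinearMap ∘L
    orthantMap σ ∘L (rotation n).symm.toContinuousLinearEquiv.toContinuousLinearMap

theorem mellin_apply (σ : Fin n → ℤˣ) (u : L2 n) :
    mellin σ u = 𝓕 (orthantMap σ ((rotation n).symm u)) := rfl

theorem sum_enorm_mellin_sq (u : L2 n) : ∑ σ : Fin n → ℤˣ, ‖mellin σ u‖ₑ ^ 2 = ‖u‖ₑ ^ 2 := by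
  have h : ∀ σ, ‖mellin σ u‖ₑ = ‖orthantMap σ ((rotation n).symm u)‖ₑ := fun σ =>
    (Lp.fourierTransformₗᵢ (Space n) ℂ).enorm_map _
  simp only [h, sum_enorm_orthantMap_sq]
  rw [(rotation n).symm.enorm_map]

theorem exists_mellin_eq (g : (Fin n → ℤˣ) → L2 n) : ∃ u : L2 n, ∀ σ, mellin σ u = g σ := by
  obtain ⟨u, hu⟩ := exists_orthantMap_eq fun σ => (Lp.fourierTransformₗᵢ (Space n) ℂ).symm (g σ)
  refine ⟨rotation n u, fun σ => ?_⟩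
  rw [mellin_apply, LinearIsometryEquiv.symm_apply_apply, hu]
  exact (Lp.fourierTransformₗᵢ (Space n) ℂ).apply_symm_apply (g σ)

theorem coeFn_mellin_freeSchwartz (σ : Fin n → ℤˣ) (g : 𝓢(Space n, ℂ)) :
    mellin σ (schwartzL2 n (freeSchwartz n 2 g)) =ᵐ[volume] fun ξ =>
      (dilationSymbol n ξ : ℂ) * mellin σ (schwartzL2 n g) ξ := by
  obtain ⟨h, rfl⟩ := (rotationSchwartz n).surjective g
  rw [freeSchwartz_rotationSchwartz, ← rotation_schwartzL2, ← rotation_schwartzL2, mellin_apply,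
    mellin_apply, LinearIsometryEquiv.symm_apply_apply, LinearIsometryEquiv.symm_apply_apply]
  exact coeFn_fourier_orthantMap_dilationSchwartz σ h

theorem continuous_dilationSymbol : Continuous (dilationSymbol n) := by
  unfold dilationSymbol
  fun_prop

theorem inner_diagonalVector_surjective (hn : 1 ≤ n) :
    Function.Surjective (innerSL ℝ (diagonalVector n)) := by
  intro c
  refine ⟨EuclideanSpace.single ⟨0, hn⟩ c, ?_⟩
  simp [diagonalVector_apply, EuclideanSpace.inner_single_right]

/-- For n ≥ 1 the symbol is a nonconstant affine function, and a surjective linear functional pushes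
Lebesgue measure to a (possibly infinite) multiple of Lebesgue measure. Absolute continuity of the
spectrum rests on this. -/
theorem dilationSymbol_preimage_null (hn : 1 ≤ n) {N : Set ℝ} (hN : volume N = 0) :
    volume (dilationSymbol n ⁻¹' N) = 0 := by
  have hpi := Real.pi_pos
  set a : ℝ → ℝ := fun t => 4 * Real.pi * t - 1 with ha
  have hN' : volume (a ⁻¹' N) = 0 := by
    have h1 : a ⁻¹' N = (fun t => (4 * Real.pi) * t) ⁻¹' ((fun t => -1 + t) ⁻¹' N) := by
      ext t
      simp only [ha, Set.mem_preimage]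
      rw [neg_add_eq_sub]
    rw [h1, Real.volume_preimage_mul_left (by positivity), measure_preimage_add, hN, mul_zero]
  obtain ⟨c, -, hc⟩ := (innerSL ℝ (diagonalVector n)).toLinearMap.exists_map_addHaar_eq_smul_addHaar
    volume volume (inner_diagonalVector_surjective hn)
  have h2 : Measure.map (innerSL ℝ (diagonalVector n)) volume (toMeasurable volume (a ⁻¹' N)) = 0 := by
    have h3 := congrArg (fun μ : Measure ℝ => μ (toMeasurable volume (a ⁻¹' N))) hc
    simp only [Measure.smul_apply, measure_toMeasurable, hN', smul_zero] at h3
    exact h3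
  rw [Measure.map_apply (innerSL ℝ (diagonalVector n)).continuous.measurable
    (measurableSet_toMeasurable _ _)] at h2
  refine measure_mono_null (fun ξ hξ => ?_) h2
  refine subset_toMeasurable _ _ ?_
  have h4 : a (innerSL ℝ (diagonalVector n) ξ) = dilationSymbol n ξ := by
    rw [dilationSymbol, real_inner_comm]
    rfl
  rw [Set.mem_preimage, h4]
  exact hξ

end MellinTransform

/-! ### Cut-offs of `L²` functions -/

section Cutoff

variable {n : ℕ}

open Classical in
/-- Multiplication by the indicator function of a measurable set. -/
def cutoff (s : Set (Space n)) : L2 n →L[ℂ] L2 n :=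
  if hs : MeasurableSet s then
    LinearMap.mkContinuous
      { toFun := fun u => ((Lp.memLp u).indicator hs).toLp _
        map_add' := fun u v => by
          refine Lp.ext ?_
          filter_upwards [((Lp.memLp (u + v)).indicator hs).coeFn_toLp,
            ((Lp.memLp u).indicator hs).coeFn_toLp, ((Lp.memLp v).indicator hs).coeFn_toLp,
            Lp.coeFn_add (((Lp.memLp u).indicator hs).toLp _) (((Lp.memLp v).indicator hs).toLp _),
            Lp.coeFn_add u v] with x h1 h2 h3 h4 h5
          rw [h1, h4, Pi.add_apply, h2, h3]
          by_cases hx : x ∈ s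
          · simp only [Set.indicator_of_mem hx, h5, Pi.add_apply]
          · simp only [Set.indicator_of_notMem hx, add_zero]
        map_smul' := fun c u => by
          refine Lp.ext ?_
          filter_upwards [((Lp.memLp (c • u)).indicator hs).coeFn_toLp,
            ((Lp.memLp u).indicator hs).coeFn_toLp,
            Lp.coeFn_smul c (((Lp.memLp u).indicator hs).toLp _), Lp.coeFn_smul c u]
            with x h1 h2 h3 h4
          rw [RingHom.id_apply, h1, h3, Pi.smul_apply, h2]
          by_cases hx : x ∈ s <;> simp [hx, h4] }
      1 (fun u => by
        rw [one_mul]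
        refine Lp.norm_le_norm_of_ae_le ?_
        filter_upwards [((Lp.memLp u).indicator hs).coeFn_toLp] with x h1
        change ‖(((Lp.memLp u).indicator hs).toLp _) x‖ ≤ _
        rw [h1]
        exact norm_indicator_le_norm_self _ _)
  else 0

theorem coeFn_cutoff {s : Set (Space n)} (hs : MeasurableSet s) (u : L2 n) :
    cutoff s u =ᵐ[volume] s.indicator u := by
  rw [cutoff, dif_pos hs]
  exact ((Lp.memLp u).indicator hs).coeFn_toLp

theorem cutoff_empty (u : L2 n) : cutoff ∅ u = 0 := by
  refine Lp.ext ?_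
  filter_upwards [coeFn_cutoff MeasurableSet.empty u, Lp.coeFn_zero ℂ 2 (volume : Measure (Space n))]
    with x h1 h2
  rw [h1, h2]; simp

theorem cutoff_univ (u : L2 n) : cutoff Set.univ u = u := by
  refine Lp.ext ?_
  filter_upwards [coeFn_cutoff MeasurableSet.univ u] with x h1
  rw [h1]; simp

theorem cutoff_cutoff {s t : Set (Space n)} (hs : MeasurableSet s) (ht : MeasurableSet t)
    (u : L2 n) : cutoff s (cutoff t u) = cutoff (s ∩ t) u := by
  refine Lp.ext ?_
  filter_upwards [coeFn_cutoff hs (cutoff t u), coeFn_cutoff ht u, coeFn_cutoff (hs.inter ht) u]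
    with x h1 h2 h3
  rw [h1, h3, ← Set.indicator_indicator]
  by_cases hx : x ∈ s <;> simp [hx, h2]

theorem cutoff_union {s t : Set (Space n)} (hs : MeasurableSet s) (ht : MeasurableSet t)
    (hst : Disjoint s t) (u : L2 n) : cutoff (s ∪ t) u = cutoff s u + cutoff t u := by
  refine Lp.ext ?_
  filter_upwards [coeFn_cutoff hs u, coeFn_cutoff ht u, coeFn_cutoff (hs.union ht) u,
    Lp.coeFn_add (cutoff s u) (cutoff t u)] with x h1 h2 h3 h4
  rw [h3, h4, Pi.add_apply, h1, h2, Set.indicator_union_of_disjoint hst]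

theorem inner_cutoff_left {s : Set (Space n)} (hs : MeasurableSet s) (u v : L2 n) :
    inner ℂ (cutoff s u) v = inner ℂ u (cutoff s v) := by
  rw [L2.inner_def, L2.inner_def]
  refine integral_congr_ae ?_
  filter_upwards [coeFn_cutoff hs u, coeFn_cutoff hs v] with x h1 h2
  rw [h1, h2]
  by_cases hx : x ∈ s <;> simp [hx]

theorem enorm_cutoff_sq {s : Set (Space n)} (hs : MeasurableSet s) (u : L2 n) :
    ‖cutoff s u‖ₑ ^ 2 = ∫⁻ x in s, ‖u x‖ₑ ^ 2 := by
  rw [enorm_sq_eq_lintegral, ← lintegral_indicator hs]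
  refine lintegral_congr_ae ?_
  filter_upwards [coeFn_cutoff hs u] with x h1
  rw [h1]
  by_cases hx : x ∈ s <;> simp [hx]

theorem norm_cutoff_sq {s : Set (Space n)} (hs : MeasurableSet s) (u : L2 n) :
    ‖cutoff s u‖ ^ 2 = ∫ x in s, ‖u x‖ ^ 2 := by
  rw [← integral_norm_sq, ← integral_indicator hs]
  refine integral_congr_ae ?_
  filter_upwards [coeFn_cutoff hs u] with x h1
  rw [h1]
  by_cases hx : x ∈ s <;> simp [hx]

theorem hasSum_cutoff {s : ℕ → Set (Space n)} (hs : ∀ k, MeasurableSet (s k))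
    (hd : Pairwise (Function.onFun Disjoint s)) (u : L2 n) :
    HasSum (fun k => cutoff (s k) u) (cutoff (⋃ k, s k) u) := by
  have hsum := hasSum_integral_iUnion hs hd (f := fun x => ‖u x‖ ^ 2)
    (integrable_norm_sq u).integrableOn
  have hfin : ∀ F : Finset ℕ, ∑ k ∈ F, cutoff (s k) u = cutoff (⋃ k ∈ F, s k) u := by
    intro F
    induction F using Finset.induction_on with
    | empty => simp [cutoff_empty]
    | insert k F hk ih =>
      rw [Finset.sum_insert hk, ih, Finset.set_biUnion_insert, cutoff_union (hs k)
        (F.measurableSet_biUnion fun j _ => hs j)]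
      rw [Set.disjoint_iUnion₂_right]
      intro j hj
      exact hd (fun h => hk (h ▸ hj))
  rw [HasSum, tendsto_iff_norm_sub_tendsto_zero]
  -- The remainder is the cut-off to B \ A, and its squared norm is the tail of a convergent scalar
  -- series.
  have hsq : ∀ F : Finset ℕ, ‖∑ k ∈ F, cutoff (s k) u - cutoff (⋃ k, s k) u‖ ^ 2 =
      (∫ x in ⋃ k, s k, ‖u x‖ ^ 2) - ∑ k ∈ F, ∫ x in s k, ‖u x‖ ^ 2 := by
    intro F
    set A := ⋃ k ∈ F, s k with hA
    set B := ⋃ k, s k with hB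
    have hAm : MeasurableSet A := F.measurableSet_biUnion fun j _ => hs j
    have hBm : MeasurableSet B := MeasurableSet.iUnion hs
    have hAB : A ⊆ B := Set.iUnion₂_subset fun k _ => Set.subset_iUnion s k
    have h1 : cutoff B u = cutoff A u + cutoff (B \ A) u := by
      rw [← cutoff_union hAm (hBm.diff hAm) Set.disjoint_sdiff_right, Set.union_sdiff_cancel hAB]
    rw [hfin, h1, sub_add_cancel_left, norm_neg, norm_cutoff_sq (hBm.diff hAm),
      setIntegral_sdiff hAm (integrable_norm_sq u).integrableOn hAB, hA,
      integral_biUnion_finset F (fun k _ => hs k) (hd.set_pairwise _)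
        (fun k _ => (integrable_norm_sq u).integrableOn)]
  have h0 := (hsum.const_sub (∫ x in ⋃ k, s k, ‖u x‖ ^ 2))
  rw [sub_self] at h0
  have h2 := (Real.continuous_sqrt.tendsto 0).comp h0
  rw [Real.sqrt_zero] at h2
  refine h2.congr fun F => ?_
  simp only [Function.comp_apply]
  rw [← hsq, Real.sqrt_sq (norm_nonneg _)]

end Cutoff

/-! ### Multiplication operators and their spectral measures -/

section Multiplication

open ComplexConjugate

variable {n : ℕ} {ι : Type*} [Fintype ι]

/-- The maps `W i` are the components of a unitary operator from `L²(ℝⁿ)` to a finite sum of copies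
of `L²(ℝⁿ)`. -/
structure IsUnitaryFamily (W : ι → L2 n →L[ℂ] L2 n) : Prop where
  sum_enorm_sq : ∀ u, ∑ i, ‖W i u‖ₑ ^ 2 = ‖u‖ₑ ^ 2
  surjective : ∀ g : ι → L2 n, ∃ u, ∀ i, W i u = g i

namespace IsUnitaryFamily

variable {W : ι → L2 n →L[ℂ] L2 n}

theorem sum_norm_sq (hW : IsUnitaryFamily W) (u : L2 n) : ∑ i, ‖W i u‖ ^ 2 = ‖u‖ ^ 2 := by
  have h := congrArg ENNReal.toReal (hW.sum_enorm_sq u)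
  rw [ENNReal.toReal_sum (fun i _ => by simp)] at h
  simpa using h

/-- The isometry with components `W i`. -/
def toPiLp (hW : IsUnitaryFamily W) : L2 n →ₗᵢ[ℂ] PiLp 2 (fun _ : ι => L2 n) where
  toFun u := WithLp.toLp 2 fun i => W i u
  map_add' u v := by ext1; simp
  map_smul' c u := by ext1; simp
  norm_map' u := by
    rw [← sq_eq_sq₀ (norm_nonneg _) (norm_nonneg _), PiLp.norm_sq_eq_of_L2]
    exact hW.sum_norm_sq u

theorem sum_inner (hW : IsUnitaryFamily W) (u v : L2 n) :
    ∑ i, inner ℂ (W i u) (W i v) = inner ℂ u v := by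
  rw [← hW.toPiLp.inner_map_map, PiLp.inner_apply]
  rfl

theorem ext (hW : IsUnitaryFamily W) {u v : L2 n} (h : ∀ i, W i u = W i v) : u = v := by
  rw [← sub_eq_zero, ← norm_eq_zero, ← sq_eq_zero_iff, ← hW.sum_norm_sq]
  simp [h]

theorem map_sum_adjoint (hW : IsUnitaryFamily W) (g : ι → L2 n) (j : ι) :
    W j (∑ i, (W i).adjoint (g i)) = g j := by
  obtain ⟨u, hu⟩ := hW.surjective g
  have : ∑ i, (W i).adjoint (g i) = u := by
    refine ext_inner_left ℂ fun v => ?_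
    rw [inner_sum, ← hW.sum_inner]
    simp only [ContinuousLinearMap.adjoint_inner_right, hu]
  rw [this, hu]

variable {m : Space n → ℝ}

variable (W m) in
/-- The spectral projection of the operator which is multiplication by `m` in the picture `W`. -/
def spectralProj (s : Set ℝ) : L2 n →L[ℂ] L2 n :=
  ∑ i, (W i).adjoint ∘L cutoff (m ⁻¹' s) ∘L W i

theorem map_spectralProj (hW : IsUnitaryFamily W) (s : Set ℝ) (u : L2 n) (i : ι) :
    W i (spectralProj W m s u) = cutoff (m ⁻¹' s) (W i u) := by
  have := hW.map_sum_adjoint (fun i => cutoff (m ⁻¹' s) (W i u)) i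
  simpa [spectralProj] using this

/-- The spectral measure of the operator which is multiplication by `m` in the picture `W`. -/
def projectionMeasure (hW : IsUnitaryFamily W) (hm : Measurable m) : ProjectionMeasure (L2 n) where
  proj := spectralProj W m
  isStarProjection s hs := by
    refine ⟨?_, ?_⟩
    · refine ContinuousLinearMap.ext fun u => hW.ext fun i => ?_
      rw [mul_apply_eq_comp, hW.map_spectralProj, hW.map_spectralProj,
        cutoff_cutoff (hm hs) (hm hs), Set.inter_self]
    · rw [ContinuousLinearMap.isSelfAdjoint_iff_isSymmetric]
      intro u v
      rw [← hW.sum_inner, ← hW.sum_inner]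
      refine Finset.sum_congr rfl fun i _ => ?_
      rw [ContinuousLinearMap.coe_coe, hW.map_spectralProj, hW.map_spectralProj,
        inner_cutoff_left (hm hs)]
  proj_empty := by
    refine ContinuousLinearMap.ext fun u => hW.ext fun i => ?_
    rw [hW.map_spectralProj, Set.preimage_empty, cutoff_empty]
    simp
  proj_univ := by
    refine ContinuousLinearMap.ext fun u => hW.ext fun i => ?_
    rw [hW.map_spectralProj, Set.preimage_univ, cutoff_univ]
    simp
  proj_inter s t hs ht := by
    refine ContinuousLinearMap.ext fun u => hW.ext fun i => ?_
    rw [mul_apply_eq_comp, hW.map_spectralProj, hW.map_spectralProj,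
      hW.map_spectralProj, cutoff_cutoff (hm hs) (hm ht), Set.preimage_inter]
  hasSum_proj s hs hd u := by
    simp only [spectralProj, sum_apply, ContinuousLinearMap.comp_apply, Set.preimage_iUnion]
    refine hasSum_sum fun i _ => ContinuousLinearMap.hasSum _ ?_
    exact hasSum_cutoff (fun k => hm (hs k)) (fun j k hjk => (hd hjk).preimage m) _

theorem measurable_enorm_sq (u : L2 n) : Measurable fun x => ‖u x‖ₑ ^ 2 :=
  (Lp.stronglyMeasurable u).measurable.enorm.pow_const 2

theorem scalarMeasure_eq (hW : IsUnitaryFamily W) (hm : Measurable m) (u : L2 n) :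
    (hW.projectionMeasure hm).scalarMeasure u =
      ∑ i, (volume.withDensity fun x => ‖W i u x‖ₑ ^ 2).map m := by
  ext s hs
  rw [ProjectionMeasure.scalarMeasure, Measure.ofMeasurable_apply s hs, Measure.finsetSum_apply]
  have h : ENNReal.ofReal (‖(hW.projectionMeasure hm).proj s u‖ ^ 2) =
      ‖spectralProj W m s u‖ₑ ^ 2 := by
    rw [ENNReal.ofReal_pow (norm_nonneg _), ofReal_norm]
    rfl
  rw [h, ← hW.sum_enorm_sq]
  refine Finset.sum_congr rfl fun i _ => ?_
  rw [hW.map_spectralProj, enorm_cutoff_sq (hm hs), Measure.map_apply hm hs,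
    withDensity_apply _ (hm hs)]

theorem scalarMeasure_absolutelyContinuous (hW : IsUnitaryFamily W) (hm : Measurable m)
    (hnull : ∀ N : Set ℝ, volume N = 0 → volume (m ⁻¹' N) = 0) (u : L2 n) :
    (hW.projectionMeasure hm).scalarMeasure u ≪ volume := by
  rw [scalarMeasure_eq]
  refine Measure.AbsolutelyContinuous.mk fun s hs h0 => ?_
  rw [Measure.finsetSum_apply]
  refine Finset.sum_eq_zero fun i _ => ?_
  rw [Measure.map_apply hm hs]
  exact withDensity_absolutelyContinuous _ _ (hnull s h0)

theorem lintegral_scalarMeasure (hW : IsUnitaryFamily W) (hm : Measurable m) (u : L2 n)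
    {g : ℝ → ℝ≥0∞} (hg : Measurable g) :
    ∫⁻ t, g t ∂(hW.projectionMeasure hm).scalarMeasure u =
      ∑ i, ∫⁻ x, ‖W i u x‖ₑ ^ 2 * g (m x) := by
  rw [scalarMeasure_eq, lintegral_finsetSum_measure]
  refine Finset.sum_congr rfl fun i _ => ?_
  rw [lintegral_map hg hm]
  exact lintegral_withDensity_eq_lintegral_mul _ (measurable_enorm_sq _) (hg.comp hm)

theorem memLp_mul_iff (hm : Measurable m) (v : L2 n) :
    MemLp (fun x => (m x : ℂ) * v x) 2 volume ↔
      ∫⁻ x, ‖v x‖ₑ ^ 2 * ENNReal.ofReal (m x ^ 2) < ⊤ := by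
  have hs : AEStronglyMeasurable (fun x => (m x : ℂ) * v x) volume :=
    (measurable_ofReal.comp hm).aestronglyMeasurable.mul (Lp.aestronglyMeasurable v)
  rw [memLp_two_iff_lintegral hs]
  have h : ∀ x, ‖(m x : ℂ) * v x‖ₑ ^ 2 = ‖v x‖ₑ ^ 2 * ENNReal.ofReal (m x ^ 2) := by
    intro x
    rw [enorm_mul, mul_pow, mul_comm, ← sq_abs, ENNReal.ofReal_pow (abs_nonneg _),
      ← Real.norm_eq_abs, ← norm_real, ofReal_norm]
  simp only [h]

theorem integral_scalarMeasure (hW : IsUnitaryFamily W) (hm : Measurable m) {u : L2 n}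
    (hu : ∀ i, MemLp (fun x => (m x : ℂ) * W i u x) 2 volume) :
    ∫ t, t ∂(hW.projectionMeasure hm).scalarMeasure u = ∑ i, ∫ x, ‖W i u x‖ ^ 2 * m x := by
  have hto : ∀ i x, (‖W i u x‖ₑ ^ 2).toReal • m x = ‖W i u x‖ ^ 2 * m x := by
    intro i x; simp
  have hlt : ∀ i, ∀ᵐ x : Space n, ‖W i u x‖ₑ ^ 2 < ⊤ := fun i =>
    Filter.Eventually.of_forall fun x => by simp
  have hint : ∀ i, Integrable (fun x => ‖W i u x‖ ^ 2 * m x) := by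
    intro i
    have h1 := (hu i).norm.integrable_mul (Lp.memLp (W i u)).norm
    refine h1.mono' ?_ (Filter.Eventually.of_forall fun x => ?_)
    · exact ((Lp.aestronglyMeasurable (W i u)).norm.pow 2).mul hm.aestronglyMeasurable
    · simp only [Pi.mul_apply, norm_mul, norm_real, norm_pow, norm_norm]
      refine le_of_eq ?_
      ring
  rw [scalarMeasure_eq, integral_finsetSum_measure]
  · refine Finset.sum_congr rfl fun i _ => ?_
    rw [integral_map (f := fun t : ℝ => t) hm.aemeasurable measurable_id'.aestronglyMeasurable,
      integral_withDensity_eq_integral_toReal_smul (measurable_enorm_sq _) (hlt i)]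
    simp only [hto]
  · intro i _
    rw [integrable_map_measure (g := fun t : ℝ => t) measurable_id'.aestronglyMeasurable hm.aemeasurable,
      integrable_withDensity_iff_integrable_smul' (measurable_enorm_sq _) (hlt i)]
    simp only [Function.comp_apply, hto]
    exact hint i

/-- μ_u is the image under m of the measure with density Σᵢ |W i u|². So ∫ t² dμ_u < ∞ says that
every m · W i u is in L², and surjectivity of W then produces A u. The equivalence in `hA` matters:
it makes the domain maximal. -/
theorem isSpectralMeasureOf (hW : IsUnitaryFamily W) (hm : Measurable m) {A : L2 n →ₗ.[ℂ] L2 n}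
    (hA : ∀ u f, (u, f) ∈ A.graph ↔ ∀ i, W i f =ᵐ[volume] fun x => (m x : ℂ) * W i u x) :
    IsSpectralMeasureOf (hW.projectionMeasure hm) A := by
  have hmem : ∀ u f, (u, f) ∈ A.graph → ∀ i, MemLp (fun x => (m x : ℂ) * W i u x) 2 volume :=
    fun u f h i => (memLp_congr_ae ((hA u f).mp h i)).mp (Lp.memLp _)
  refine ⟨fun u => ?_, fun u => ?_⟩
  · rw [hW.lintegral_scalarMeasure hm u (by fun_prop), ENNReal.sum_lt_top]
    constructor
    · intro hu i _
      exact (memLp_mul_iff hm _).mp (hmem u _ (A.mem_graph ⟨u, hu⟩) i)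
    · intro h
      have hL := fun i => (memLp_mul_iff hm (W i u)).mpr (h i (Finset.mem_univ i))
      obtain ⟨f, hf⟩ := hW.surjective fun i => (hL i).toLp _
      have hg : (u, f) ∈ A.graph := (hA u f).mpr fun i => by
        rw [hf]; exact (hL i).coeFn_toLp
      exact LinearPMap.mem_domain_of_mem_graph hg
  · have hg := A.mem_graph u
    rw [hW.integral_scalarMeasure hm (hmem _ _ hg), ← hW.sum_inner, ofReal_sum]
    refine Finset.sum_congr rfl fun i _ => ?_
    rw [L2.inner_def, ← integral_complex_ofReal]
    refine integral_congr_ae ?_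
    filter_upwards [(hA _ _).mp hg i] with x hx
    rw [hx, RCLike.inner_apply, mul_assoc, Complex.mul_conj, normSq_eq_norm_sq]
    push_cast
    ring

/-- In a single component of the picture W, take normalized indicators of pieces of m⁻¹(J k), with
disjoint intervals J k shrinking to t. Disjointness gives orthogonality, and |m - t| ≤ 1/(k + 1) on
the k-th piece gives the convergence. -/
theorem exists_singular_sequence (hW : IsUnitaryFamily W) [Nonempty ι] (hm : Continuous m)
    (hsurj : Function.Surjective m) {A : L2 n →ₗ.[ℂ] L2 n}
    (hA : ∀ u f, (u, f) ∈ A.graph ↔ ∀ i, W i f =ᵐ[volume] fun x => (m x : ℂ) * W i u x) (t : ℝ) :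
    ∃ u f : ℕ → L2 n, Orthonormal ℂ u ∧ (∀ k, (u k, f k) ∈ A.graph) ∧
      Filter.Tendsto (fun k => f k - (t : ℂ) • u k) Filter.atTop (nhds 0) := by
  classical
  set J : ℕ → Set ℝ := fun k => Set.Ioo (t + 1 / ((k : ℝ) + 1 + 1)) (t + 1 / ((k : ℝ) + 1)) with hJ
  have hJne : ∀ k, (J k).Nonempty := fun k => by
    refine Set.nonempty_Ioo.mpr ?_
    gcongr
    linarith
  have hJd : ∀ j k, j < k → Disjoint (J j) (J k) := by
    intro j k hjk
    rw [Set.disjoint_left]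
    intro x hx hx'
    have h1 : (j : ℝ) + 1 ≤ k := by exact_mod_cast hjk
    have h2 : 1 / ((k : ℝ) + 1) ≤ 1 / ((j : ℝ) + 1 + 1) := by
      gcongr
    linarith [hx.1, hx'.2]
  have hball : ∀ k, ∃ x : Space n, m x ∈ J k := fun k => by
    obtain ⟨c, hc⟩ := hJne k
    obtain ⟨x, rfl⟩ := hsurj c
    exact ⟨x, hc⟩
  choose x hx using hball
  -- The ball makes the measure finite; openness and the point x k make it positive.
  set S : ℕ → Set (Space n) := fun k => m ⁻¹' J k ∩ Metric.ball (x k) 1 with hS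
  have hSo : ∀ k, IsOpen (S k) := fun k => (isOpen_Ioo.preimage hm).inter Metric.isOpen_ball
  have hSfin : ∀ k, volume (S k) ≠ ⊤ := fun k =>
    ne_top_of_le_ne_top (measure_ball_lt_top (x := x k) (r := 1)).ne
      (measure_mono Set.inter_subset_right)
  have hSpos : ∀ k, volume (S k) ≠ 0 := fun k =>
    ((hSo k).measure_pos volume ⟨x k, hx k, Metric.mem_ball_self one_pos⟩).ne'
  set v : ℕ → L2 n := fun k => indicatorConstLp 2 (hSo k).measurableSet (hSfin k) (1 : ℂ) with hv
  have hvne : ∀ k, v k ≠ 0 := by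
    intro k h0
    have := norm_indicatorConstLp (p := 2) (hs := (hSo k).measurableSet) (hμs := hSfin k)
      (c := (1 : ℂ)) (by norm_num) (by norm_num)
    change ‖v k‖ = _ at this
    rw [h0, norm_zero, norm_one, one_mul, eq_comm, Real.rpow_eq_zero measureReal_nonneg (by norm_num),
      measureReal_eq_zero_iff (hSfin k)] at this
    exact hSpos k this
  set e : ℕ → L2 n := fun k => ((‖v k‖⁻¹ : ℝ) : ℂ) • v k with he
  have hsupp : ∀ k, ∀ᵐ y : Space n, y ∉ S k → e k y = 0 := by
    intro k
    filter_upwards [Lp.coeFn_smul ((‖v k‖⁻¹ : ℝ) : ℂ) (v k),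
      indicatorConstLp_coeFn (p := 2) (hs := (hSo k).measurableSet) (hμs := hSfin k) (c := (1 : ℂ))]
      with y h1 h2 hy
    change v k y = _ at h2
    rw [he]
    simp only
    rw [h1, Pi.smul_apply, h2, Set.indicator_of_notMem hy, smul_zero]
  have hen : ∀ k, ‖e k‖ = 1 := fun k => by
    rw [he]
    simp only
    rw [norm_smul, norm_real, norm_inv, norm_norm, inv_mul_cancel₀ (norm_ne_zero_iff.mpr (hvne k))]
  have horth : ∀ j k, j < k → inner ℂ (e j) (e k) = 0 := by
    intro j k hjk
    rw [L2.inner_def]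
    refine integral_eq_zero_of_ae ?_
    filter_upwards [hsupp j, hsupp k] with y h1 h2
    by_cases hy : y ∈ S j
    · have : y ∉ S k := fun hk => Set.disjoint_left.mp (hJd j k hjk) hy.1 hk.1
      rw [h2 this, inner_zero_right]; rfl
    · rw [h1 hy, inner_zero_left]; rfl
  have horthonormal : Orthonormal ℂ e := by
    refine ⟨hen, fun j k hjk => ?_⟩
    rcases lt_or_gt_of_ne hjk with h | h
    · exact horth j k h
    · exact inner_eq_zero_symm.mp (horth k j h)
  have hbound : ∀ k, ∀ᵐ y : Space n, ‖((m y - t : ℝ) : ℂ) * e k y‖ ≤ 1 / ((k : ℝ) + 1) * ‖e k y‖ := by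
    intro k
    filter_upwards [hsupp k] with y hy
    by_cases hyS : y ∈ S k
    · rw [norm_mul]
      refine mul_le_mul_of_nonneg_right ?_ (norm_nonneg _)
      have h1 := hyS.1.1
      have h2 := hyS.1.2
      have h3 : 0 < 1 / ((k : ℝ) + 1 + 1) := by positivity
      rw [norm_real, Real.norm_eq_abs, abs_le]
      constructor <;> linarith
    · simp [hy hyS]
  have hmem : ∀ k, MemLp (fun y => ((m y - t : ℝ) : ℂ) * e k y) 2 volume := fun k =>
    MemLp.of_le_mul (Lp.memLp (e k))
      (Continuous.aestronglyMeasurable (by fun_prop) |>.mul (Lp.aestronglyMeasurable _)) (hbound k)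
  let i₀ : ι := Classical.arbitrary ι
  choose u hu using fun k => hW.surjective fun i => if i = i₀ then e k else 0
  choose w hw using fun k => hW.surjective fun i => if i = i₀ then (hmem k).toLp _ else 0
  have hinner : ∀ j k, inner ℂ (u j) (u k) = inner ℂ (e j) (e k) := by
    intro j k
    rw [← hW.sum_inner, Finset.sum_eq_single i₀]
    · simp [hu]
    · intro i _ hi; simp [hu, hi]
    · simp
  refine ⟨u, fun k => w k + (t : ℂ) • u k, ?_, fun k => (hA _ _).mpr fun i => ?_, ?_⟩
  · rw [orthonormal_iff_ite] at horthonormal ⊢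
    intro j k
    rw [hinner, horthonormal]
  · rw [map_add, map_smul, hu, hw]
    by_cases hi : i = i₀
    · simp only [hi, if_true]
      filter_upwards [Lp.coeFn_add ((hmem k).toLp _) ((t : ℂ) • e k), Lp.coeFn_smul (t : ℂ) (e k),
        (hmem k).coeFn_toLp] with y h1 h2 h3
      rw [h1, Pi.add_apply, h2, Pi.smul_apply, h3, smul_eq_mul]
      push_cast
      ring
    · simp only [hi, if_false, smul_zero, add_zero]
      exact Filter.Eventually.of_forall fun y => by simp
  · simp only [add_sub_cancel_right]
    refine squeeze_zero_norm (fun k => ?_) tendsto_one_div_add_atTop_nhds_zero_nat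
    have h1 : ‖w k‖ = ‖(hmem k).toLp _‖ := by
      rw [← sq_eq_sq₀ (norm_nonneg _) (norm_nonneg _), ← hW.sum_norm_sq, Finset.sum_eq_single i₀]
      · simp [hw]
      · intro i _ hi; simp [hw, hi]
      · simp
    rw [h1]
    refine (Lp.norm_le_mul_norm_of_ae_le_mul (g := e k) (c := 1 / ((k : ℝ) + 1)) ?_).trans_eq
      (by rw [hen, mul_one])
    filter_upwards [(hmem k).coeFn_toLp, hbound k] with y h1 h2
    rw [h1]
    exact h2

end IsUnitaryFamily

end Multiplication

/-! ### The case `α = 2` -/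

section QuadraticCase

open ComplexConjugate

variable {n : ℕ}

theorem isUnitaryFamily_mellin : IsUnitaryFamily (mellin (n := n)) :=
  ⟨sum_enorm_mellin_sq, exists_mellin_eq⟩

theorem mem_graph_free_two_of_mellin {u f : L2 n}
    (h : ∀ σ, mellin σ f =ᵐ[volume] fun ξ => (dilationSymbol n ξ : ℂ) * mellin σ u ξ) :
    (u, f) ∈ (maximalRealization n (freeExpr n 2)).graph := by
  rw [(isFormalAdjoint_freeExpr n 2).mem_graph_iff]
  intro g
  rw [← isUnitaryFamily_mellin.sum_inner, ← isUnitaryFamily_mellin.sum_inner]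
  refine Finset.sum_congr rfl fun σ _ => ?_
  rw [L2.inner_def, L2.inner_def]
  refine integral_congr_ae ?_
  filter_upwards [h σ, coeFn_mellin_freeSchwartz σ g] with ξ h1 h2
  rw [h1, h2]
  simp only [RCLike.inner_apply, map_mul, conj_ofReal]
  ring

/-- From right to left this is duality with Schwartz functions. Conversely, division by m - i yields
(a, b) in the multiplication graph with b - i a = f - i u; then u - a satisfies the eigenvalue
equation for i in the maximal realization, hence vanishes. -/
theorem mem_graph_free_two_iff (u f : L2 n) :
    (u, f) ∈ (maximalRealization n (freeExpr n 2)).graph ↔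
      ∀ σ, mellin σ f =ᵐ[volume] fun ξ => (dilationSymbol n ξ : ℂ) * mellin σ u ξ := by
  refine ⟨fun h => ?_, mem_graph_free_two_of_mellin⟩
  set m := dilationSymbol n with hm
  have hmc : Continuous m := continuous_dilationSymbol
  have hne : ∀ ξ, (m ξ : ℂ) - I ≠ 0 := fun ξ h0 => by
    have := congrArg Complex.im h0
    simp at this
  have hge1 : ∀ ξ, 1 ≤ ‖(m ξ : ℂ) - I‖ := fun ξ => by
    have := Complex.abs_im_le_norm ((m ξ : ℂ) - I)
    simpa using this
  have hgem : ∀ ξ, ‖(m ξ : ℂ)‖ ≤ ‖(m ξ : ℂ) - I‖ := fun ξ => by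
    have := Complex.abs_re_le_norm ((m ξ : ℂ) - I)
    simpa using this
  have hφ : Continuous fun ξ => ((m ξ : ℂ) - I)⁻¹ := Continuous.inv₀ (by fun_prop) hne
  have hL1 : ∀ w : L2 n, MemLp (fun ξ => ((m ξ : ℂ) - I)⁻¹ * w ξ) 2 volume := fun w =>
    MemLp.of_le (Lp.memLp w) (hφ.aestronglyMeasurable.mul (Lp.aestronglyMeasurable w))
      (Filter.Eventually.of_forall fun ξ => by
        rw [norm_mul, norm_inv]
        exact mul_le_of_le_one_left (norm_nonneg _) (inv_le_one_of_one_le₀ (hge1 ξ)))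
  have hL2 : ∀ w : L2 n, MemLp (fun ξ => (m ξ : ℂ) * (((m ξ : ℂ) - I)⁻¹ * w ξ)) 2 volume := fun w =>
    MemLp.of_le (Lp.memLp w) (Continuous.aestronglyMeasurable (by fun_prop) |>.mul
      (hφ.aestronglyMeasurable.mul (Lp.aestronglyMeasurable w)))
      (Filter.Eventually.of_forall fun ξ => by
        rw [← mul_assoc, norm_mul, norm_mul, norm_inv]
        refine mul_le_of_le_one_left (norm_nonneg _) ?_
        rw [← div_eq_mul_inv]
        exact div_le_one_of_le₀ (hgem ξ) (norm_nonneg _))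
  obtain ⟨a, ha⟩ := exists_mellin_eq fun σ => (hL1 (mellin σ (f - I • u))).toLp _
  obtain ⟨b, hb⟩ := exists_mellin_eq fun σ => (hL2 (mellin σ (f - I • u))).toLp _
  have hab : ∀ σ, mellin σ b =ᵐ[volume] fun ξ => (m ξ : ℂ) * mellin σ a ξ := by
    intro σ
    rw [ha, hb]
    filter_upwards [(hL1 (mellin σ (f - I • u))).coeFn_toLp,
      (hL2 (mellin σ (f - I • u))).coeFn_toLp] with ξ h1 h2
    rw [h1, h2]
  have hba : b - I • a = f - I • u := by
    refine isUnitaryFamily_mellin.ext fun σ => ?_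
    rw [map_sub, map_smul, ha, hb]
    refine Lp.ext ?_
    filter_upwards [(hL1 (mellin σ (f - I • u))).coeFn_toLp,
      (hL2 (mellin σ (f - I • u))).coeFn_toLp,
      Lp.coeFn_sub ((hL2 (mellin σ (f - I • u))).toLp _)
        (I • (hL1 (mellin σ (f - I • u))).toLp _),
      Lp.coeFn_smul I ((hL1 (mellin σ (f - I • u))).toLp _)] with ξ h1 h2 h3 h4
    rw [h3, Pi.sub_apply, h4, Pi.smul_apply, h1, h2, smul_eq_mul]
    have := hne ξ
    field_simp
  have hsub := Submodule.sub_mem _ h (mem_graph_free_two_of_mellin hab)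
  have hfb : f - b = I • (u - a) := by
    rw [smul_sub, sub_eq_sub_iff_add_eq_add]
    have := sub_eq_sub_iff_add_eq_add.mp hba
    rw [add_comm f, add_comm (I • u)]
    exact (add_comm _ _).trans this.symm
  rw [Prod.mk_sub_mk, hfb] at hsub
  have hua := sub_eq_zero.mp
    (eq_zero_of_smul_mem_graph (α := 2) two_pos le_rfl I (by simp) (u - a) hsub)
  have hfb' : f = b := by
    rw [hua, sub_self, smul_zero] at hfb
    exact sub_eq_zero.mp hfb
  rw [hua, hfb']
  exact hab

theorem dilationSymbol_surjective (hn : 1 ≤ n) : Function.Surjective (dilationSymbol n) := by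
  intro c
  have hpi := Real.pi_pos
  obtain ⟨ξ, hξ⟩ := inner_diagonalVector_surjective hn ((c + 1) / (4 * Real.pi))
  refine ⟨ξ, ?_⟩
  rw [dilationSymbol, real_inner_comm]
  change 4 * Real.pi * innerSL ℝ (diagonalVector n) ξ - 1 = c
  rw [hξ]
  field_simp
  ring

theorem purelyAbsolutelyContinuous_free_two (hn : 1 ≤ n) :
    PurelyAbsolutelyContinuous (maximalRealization n (freeExpr n 2)) :=
  ⟨isUnitaryFamily_mellin.projectionMeasure continuous_dilationSymbol.measurable,
    isUnitaryFamily_mellin.isSpectralMeasureOf _ mem_graph_free_two_iff,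
    isUnitaryFamily_mellin.scalarMeasure_absolutelyContinuous _
      fun _ => dilationSymbol_preimage_null hn⟩

theorem exists_singular_sequence_two (hn : 1 ≤ n) (t : ℝ) :
    ∃ u f : ℕ → L2 n, Orthonormal ℂ u ∧
      (∀ k, (u k, f k) ∈ (maximalRealization n (freeExpr n 2)).graph) ∧
      Filter.Tendsto (fun k => f k - (t : ℂ) • u k) Filter.atTop (nhds 0) :=
  isUnitaryFamily_mellin.exists_singular_sequence continuous_dilationSymbol
    (dilationSymbol_surjective hn) mem_graph_free_two_iff t

end QuadraticCase

/-! ### Approximate eigenfunctions for `α < 2` -/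

section Phase

open Filter Topology

/-- Composition with θ makes a function that is smooth only for large arguments smooth on all of ℝ,
without changing it far out. -/
theorem exists_smooth_clamp (r : ℝ) : ∃ θ : ℝ → ℝ, ContDiff ℝ ∞ θ ∧ (∀ s, r ≤ θ s) ∧
    ∀ s, r + 1 ≤ s → θ s = s := by
  refine ⟨fun s => r + Real.smoothTransition (s - r) * (s - r), ?_, fun s => ?_, fun s hs => ?_⟩
  · have h : ContDiff ℝ ∞ fun s : ℝ => Real.smoothTransition (s - r) :=
      Real.smoothTransition.contDiff.comp (by fun_prop)
    fun_prop
  · rcases le_total s r with h | h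
    · simp [Real.smoothTransition.zero_of_nonpos (sub_nonpos.mpr h)]
    · have h1 := Real.smoothTransition.nonneg (s - r)
      have h2 : 0 ≤ s - r := sub_nonneg.mpr h
      nlinarith [mul_nonneg h1 h2]
  · simp only
    rw [Real.smoothTransition.one_of_one_le (by linarith)]
    ring

/-- With a = α/2 and s = |x|² this is the eikonal equation |∇G(|x|²)|² = ⟨x⟩^α + l. G' has the order
of s^((a - 1)/2), which tends to zero since a < 1. For a = 1 the limit would be 1/2, so α = 2 needs
another argument. -/
theorem exists_phase {a : ℝ} (ha : 0 < a) (ha1 : a < 1) (l : ℝ) :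
    ∃ (G : ℝ → ℝ) (s₁ : ℝ), 1 ≤ s₁ ∧ ContDiff ℝ ∞ G ∧
      (∀ s, s₁ ≤ s → 4 * s * deriv G s ^ 2 = (1 + s) ^ a + l) ∧
      (∀ s, s₁ ≤ s → 0 ≤ deriv G s) ∧
      (∀ s, s₁ ≤ s → |s * deriv (deriv G) s| ≤ 3 * deriv G s) ∧
      Tendsto (deriv G) atTop (𝓝 0) := by
  have hev : ∀ᶠ s : ℝ in atTop, 2 * |l| + 1 ≤ (1 + s) ^ a :=
    ((tendsto_rpow_atTop ha).comp (tendsto_atTop_add_const_left _ 1 tendsto_id)).eventually_ge_atTop _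
  obtain ⟨r₀, hr₀⟩ := eventually_atTop.mp hev
  set r := max r₀ 1 with hr
  have hr1 : 1 ≤ r := le_max_right _ _
  have hq : ∀ s, r ≤ s → 2 * |l| + 1 ≤ (1 + s) ^ a := fun s hs => hr₀ s ((le_max_left _ _).trans hs)
  have hlow : ∀ s, r ≤ s → (1 + s) ^ a / 2 ≤ (1 + s) ^ a + l := fun s hs => by
    have h1 := hq s hs
    have h2 := neg_abs_le l
    linarith
  have hupp : ∀ s, r ≤ s → (1 + s) ^ a + l ≤ 2 * (1 + s) ^ a := fun s hs => by
    have h1 := hq s hs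
    have h2 := le_abs_self l
    have h3 := abs_nonneg l
    linarith
  have hpow : ∀ s, r ≤ s → 0 < (1 + s) ^ a := fun s hs => Real.rpow_pos_of_pos (by linarith) a
  obtain ⟨θ, hθs, hθr, hθ⟩ := exists_smooth_clamp r
  set w : ℝ → ℝ := fun s => ((1 + s) ^ a + l) / (4 * s) with hw
  have hwpos : ∀ s, r ≤ s → 0 < w s := fun s hs => by
    have := hlow s hs
    have := hpow s hs
    exact div_pos (by linarith) (by linarith)
  set P : ℝ → ℝ := fun s => √(w (θ s)) with hP
  have hPs : ContDiff ℝ ∞ P := by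
    refine ContDiff.sqrt ?_ fun s => (hwpos _ (hθr s)).ne'
    refine ContDiff.div ?_ (by fun_prop) fun s => ?_
    · refine ContDiff.add (ContDiff.rpow_const_of_ne (by fun_prop) fun s => ?_) contDiff_const
      have := hθr s
      linarith
    · have := hθr s
      linarith
  have hPeq : ∀ s, r + 1 ≤ s → P s = √(w s) := fun s hs => by
    simp only [hP, hθ s hs]
  set G : ℝ → ℝ := fun s => ∫ y in (0 : ℝ)..s, P y with hG
  have hGd : ∀ s, HasDerivAt G (P s) s := fun s =>
    (hPs.continuous.integral_hasStrictDerivAt 0 s).hasDerivAt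
  have hderiv : deriv G = P := funext fun s => (hGd s).deriv
  refine ⟨G, r + 2, by linarith, ?_, fun s hs => ?_, fun s hs => ?_, fun s hs => ?_, ?_⟩
  · rw [contDiff_infty_iff_deriv, hderiv]
    exact ⟨fun s => (hGd s).differentiableAt, hPs⟩
  · rw [hderiv, hPeq s (by linarith), Real.sq_sqrt (hwpos s (by linarith)).le]
    have : s ≠ 0 := by linarith
    simp only [hw]
    field_simp
  · rw [hderiv]
    exact Real.sqrt_nonneg _
  · have hrs : r ≤ s := by linarith
    have hs0 : 0 < s := by linarith
    have hPev : P =ᶠ[𝓝 s] fun y => √(w y) := by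
      filter_upwards [lt_mem_nhds (by linarith : r + 1 < s)] with y hy
      exact hPeq y hy.le
    have h1 : HasDerivAt (fun y : ℝ => (1 + y) ^ a) (a * (1 + s) ^ (a - 1)) s := by
      have := (((hasDerivAt_id s).const_add 1).rpow_const (p := a) (Or.inl (by simp; linarith)))
      simpa using! this
    have h2 : HasDerivAt w ((a * (1 + s) ^ (a - 1) * (4 * s) - ((1 + s) ^ a + l) * 4) /
        (4 * s) ^ 2) s := by
      have h3 : HasDerivAt (fun y : ℝ => 4 * y) 4 s := by
        simpa using (hasDerivAt_id s).const_mul (4 : ℝ)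
      exact (h1.add_const l).div h3 (by linarith)
    have h4 := h2.sqrt (hwpos s hrs).ne'
    rw [hderiv, hPev.deriv_eq, h4.deriv, hPeq s (by linarith)]
    have hsq : 0 < √(w s) := Real.sqrt_pos.mpr (hwpos s hrs)
    have hws : √(w s) * √(w s) = w s := Real.mul_self_sqrt (hwpos s hrs).le
    have hpow1 : (1 + s) ^ (a - 1) * (1 + s) = (1 + s) ^ a := by
      rw [Real.rpow_sub_one (by linarith)]
      have : 1 + s ≠ 0 := by linarith
      field_simp
    have hq0 := hpow s hrs
    have hX0 : 0 ≤ (1 + s) ^ (a - 1) := Real.rpow_nonneg (by linarith) _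
    have hX : a * (1 + s) ^ (a - 1) * s ≤ (1 + s) ^ a := by
      rw [← hpow1, mul_comm a, mul_assoc]
      refine mul_le_mul_of_nonneg_left ?_ hX0
      nlinarith
    have hX' : 0 ≤ a * (1 + s) ^ (a - 1) * s := by positivity
    -- Since G' = √w, s G'' = s w' / (2√w); the claim |s G''| ≤ 3 G' thus amounts to |s w'| ≤ 6 w.
    have hnum : |s * ((a * (1 + s) ^ (a - 1) * (4 * s) - ((1 + s) ^ a + l) * 4) / (4 * s) ^ 2)| ≤
        6 * w s := by
      have hl := hlow s hrs
      have hu := hupp s hrs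
      have : s * ((a * (1 + s) ^ (a - 1) * (4 * s) - ((1 + s) ^ a + l) * 4) / (4 * s) ^ 2) =
          (a * (1 + s) ^ (a - 1) * s - ((1 + s) ^ a + l)) / (4 * s) := by
        field_simp
      rw [this, abs_div, abs_of_pos (by linarith : 0 < 4 * s), ← mul_div_assoc]
      refine div_le_div_of_nonneg_right ?_ (by linarith)
      rw [abs_le]
      constructor <;> linarith
    rw [← mul_div_assoc, abs_div, abs_of_pos (by linarith : 0 < 2 * √(w s)),
      div_le_iff₀ (by linarith)]
    refine hnum.trans (le_of_eq ?_)
    linear_combination -6 * hws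
  · rw [hderiv]
    have hw0 : Tendsto w atTop (𝓝 0) := by
      have h1 : Tendsto (fun s : ℝ => s ^ (-(1 - a))) atTop (𝓝 0) :=
        tendsto_rpow_neg_atTop (by linarith)
      refine squeeze_zero' ?_ ?_ (by simpa using h1.const_mul (2 ^ a / 2))
      · filter_upwards [eventually_ge_atTop r] with s hs using (hwpos s hs).le
      · filter_upwards [eventually_ge_atTop r] with s hs
        have hs0 : 0 < s := by linarith
        have h2 : (1 + s) ^ a ≤ 2 ^ a * s ^ a := by
          rw [← Real.mul_rpow (by norm_num) hs0.le]
          exact Real.rpow_le_rpow (by linarith) (by linarith) ha.le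
        have h3 : s ^ (a - 1) * s = s ^ a := by
          rw [← Real.rpow_add_one hs0.ne', sub_add_cancel]
        simp only [hw]
        rw [div_le_iff₀ (by linarith)]
        have := hupp s hs
        calc _ ≤ 2 * (2 ^ a * s ^ a) := by linarith
          _ = _ := by rw [← h3]; ring
    have h1 : Tendsto (fun s => √(w s)) atTop (𝓝 0) := by
      have := (Real.continuous_sqrt.tendsto 0).comp hw0
      rwa [Real.sqrt_zero] at this
    refine h1.congr' ?_
    filter_upwards [eventually_ge_atTop (r + 1)] with s hs using (hPeq s hs).symm

end Phase

/-! ### Radial Schwartz functions and their Laplacian. -/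

section Radial

variable {n : ℕ}

theorem hasCompactSupport_radial {F : ℝ → ℂ} (hF : HasCompactSupport F) :
    HasCompactSupport fun x : Space n => F (‖x‖ ^ 2) := by
  obtain ⟨b, hb⟩ := hF.isCompact.isBounded.subset_closedBall 0
  refine HasCompactSupport.intro (isCompact_closedBall (0 : Space n) (|b| + 1)) fun x hx => ?_
  refine image_eq_zero_of_notMem_tsupport fun h => hx ?_
  have h1 := hb h
  rw [mem_closedBall_zero_iff, Real.norm_of_nonneg (by positivity)] at h1
  rw [mem_closedBall_zero_iff]
  have h2 := le_abs_self b
  nlinarith [norm_nonneg x, abs_nonneg b]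

/-- The radial Schwartz function `x ↦ F (|x|²)`. -/
def radialSchwartz (n : ℕ) (F : ℝ → ℂ) (hF : ContDiff ℝ ∞ F) (hc : HasCompactSupport F) :
    𝓢(Space n, ℂ) :=
  (hasCompactSupport_radial hc).toSchwartzMap (hF.comp (contDiff_norm_sq ℝ))

theorem radialSchwartz_apply {F : ℝ → ℂ} (hF : ContDiff ℝ ∞ F) (hc : HasCompactSupport F)
    (x : Space n) : radialSchwartz n F hF hc x = F (‖x‖ ^ 2) := rfl

theorem hasFDerivAt_radial {F : ℝ → ℂ} {F' : ℂ} {x : Space n} (hF : HasDerivAt F F' (‖x‖ ^ 2)) :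
    HasFDerivAt (fun x : Space n => F (‖x‖ ^ 2))
      ((2 • innerSL ℝ x).smulRight F') x :=
  hF.hasFDerivAt.comp x (hasStrictFDerivAt_norm_sq x).hasFDerivAt |>.congr_fderiv (by ext v; simp; ring)

open LineDeriv in
theorem laplacian_radialSchwartz {F F₁ F₂ : ℝ → ℂ} (hF : ContDiff ℝ ∞ F)
    (hc : HasCompactSupport F) (h₁ : ∀ s, HasDerivAt F (F₁ s) s) (h₂ : ∀ s, HasDerivAt F₁ (F₂ s) s)
    (x : Space n) :
    (Δ (radialSchwartz n F hF hc)) x =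
      4 * ((‖x‖ ^ 2 : ℝ) : ℂ) * F₂ (‖x‖ ^ 2) + 2 * n * F₁ (‖x‖ ^ 2) := by
  have hd1 : ∀ v : Space n, ⇑(∂_{v} (radialSchwartz n F hF hc) : 𝓢(Space n, ℂ)) =
      fun x => ((2 * inner ℝ x v : ℝ) : ℂ) * F₁ (‖x‖ ^ 2) := by
    intro v
    funext x
    have h := hasFDerivAt_radial (h₁ (‖x‖ ^ 2))
    rw [SchwartzMap.lineDerivOp_apply_eq_fderiv]
    change fderiv ℝ (fun x : Space n => F (‖x‖ ^ 2)) x v = _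
    rw [h.fderiv]
    simp
  have hd2 : ∀ v : Space n, (∂_{v} (∂_{v} (radialSchwartz n F hF hc))) x =
      2 * ((‖v‖ ^ 2 : ℝ) : ℂ) * F₁ (‖x‖ ^ 2) + 4 * ((inner ℝ x v ^ 2 : ℝ) : ℂ) * F₂ (‖x‖ ^ 2) := by
    intro v
    rw [SchwartzMap.lineDerivOp_apply_eq_fderiv, hd1]
    have h3 : HasFDerivAt (fun x : Space n => (2 * inner ℝ x v : ℝ)) ((2 : ℝ) • innerSL ℝ v) x := by
      simp_rw [fun x => real_inner_comm v x]
      exact (innerSL ℝ v).hasFDerivAt.const_mul (2 : ℝ)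
    have h4 := (ofRealCLM.hasFDerivAt.comp x h3).mul (hasFDerivAt_radial (h₂ (‖x‖ ^ 2)))
    have h5 := h4.fderiv
    simp only [Function.comp_def, ofRealCLM_apply] at h5
    change fderiv ℝ (fun x : Space n => ((2 * inner ℝ x v : ℝ) : ℂ) * F₁ (‖x‖ ^ 2)) x v = _
    erw [h5]
    simp
    ring
  rw [SchwartzMap.laplacian_eq_sum (EuclideanSpace.basisFun (Fin n) ℝ), sum_apply]
  simp only [hd2, EuclideanSpace.basisFun_apply]
  rw [Finset.sum_add_distrib, ← Finset.sum_mul, ← Finset.sum_mul, ← Finset.mul_sum,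
    ← Finset.mul_sum, ← ofReal_sum, ← ofReal_sum]
  have h6 : ∑ i : Fin n, inner ℝ x (EuclideanSpace.single i (1 : ℝ)) ^ 2 = ‖x‖ ^ 2 := by
    rw [EuclideanSpace.real_norm_sq_eq]
    simp [EuclideanSpace.inner_single_right]
  rw [h6]
  simp
  ring

end Radial

/-! ### WKB quasimodes on expanding shells. -/

section WKB

open Filter Topology

variable {n : ℕ}

/-- A smooth function which is `1` on `[2, 3]` and has support `[1, 4]`. -/
def shellBump : ContDiffBump (5 / 2 : ℝ) := ⟨1 / 2, 3 / 2, by norm_num, by norm_num⟩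

theorem shellBump_eq_one {s : ℝ} (h1 : 2 ≤ s) (h2 : s ≤ 3) : shellBump s = 1 :=
  shellBump.one_of_mem_closedBall (by
    rw [Metric.mem_closedBall, Real.dist_eq, abs_le]
    change -(1 / 2) ≤ s - 5 / 2 ∧ s - 5 / 2 ≤ 1 / 2
    constructor <;> linarith)

theorem tsupport_shellBump : tsupport shellBump = Set.Icc 1 4 := by
  rw [shellBump.tsupport_eq, Real.closedBall_eq_Icc]
  change Set.Icc (5 / 2 - 3 / 2 : ℝ) (5 / 2 + 3 / 2) = _
  norm_num

theorem exists_shellBump_bound : ∃ C, 0 ≤ C ∧ ∀ s, |shellBump s| ≤ C ∧ |deriv shellBump s| ≤ C ∧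
    |deriv (deriv shellBump) s| ≤ C := by
  have hs : ContDiff ℝ ∞ shellBump := shellBump.contDiff
  have h1 := (contDiff_infty_iff_deriv.mp hs).2
  have h2 := (contDiff_infty_iff_deriv.mp h1).2
  have c0 := shellBump.hasCompactSupport
  obtain ⟨A, hA⟩ := c0.exists_bound_of_continuous hs.continuous
  obtain ⟨B, hB⟩ := c0.deriv.exists_bound_of_continuous h1.continuous
  obtain ⟨D, hD⟩ := c0.deriv.deriv.exists_bound_of_continuous h2.continuous
  refine ⟨max A (max B D), ?_, fun s => ⟨?_, ?_, ?_⟩⟩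
  · exact ((norm_nonneg _).trans (hA 0)).trans (le_max_left _ _)
  · exact (hA s).trans (le_max_left _ _)
  · exact (hB s).trans ((le_max_left _ _).trans (le_max_right _ _))
  · exact (hD s).trans ((le_max_right _ _).trans (le_max_right _ _))

variable {G : ℝ → ℝ} (hG : ContDiff ℝ ∞ G) {R : ℝ}

/-- The profile `χ(s / R) e^{i G(s)}`. -/
def wkbProfile (G : ℝ → ℝ) (R s : ℝ) : ℂ := (shellBump (s / R) : ℂ) * cexp (I * G s)

/-- The derivative of `wkbProfile`. -/
def wkbProfileDeriv (G : ℝ → ℝ) (R s : ℝ) : ℂ :=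
  ((deriv shellBump (s / R) / R : ℝ) + I * (deriv G s * shellBump (s / R) : ℝ)) * cexp (I * G s)

/-- The second derivative of `wkbProfile`. -/
def wkbProfileDeriv₂ (G : ℝ → ℝ) (R s : ℝ) : ℂ :=
  ((deriv (deriv shellBump) (s / R) / R ^ 2 - deriv G s ^ 2 * shellBump (s / R) : ℝ) +
    I * (2 * deriv G s * deriv shellBump (s / R) / R + deriv (deriv G) s * shellBump (s / R) : ℝ)) *
    cexp (I * G s)

theorem hasDerivAt_cexp_phase (hG : ContDiff ℝ ∞ G) (s : ℝ) :
    HasDerivAt (fun s => cexp (I * G s)) (cexp (I * G s) * (I * (deriv G s : ℝ))) s := by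
  have h1 : HasDerivAt G (deriv G s) s :=
    ((contDiff_infty_iff_deriv.mp hG).1 s).hasDerivAt
  exact (h1.ofReal_comp.const_mul I).cexp

theorem hasDerivAt_comp_div {f : ℝ → ℝ} (hf : ContDiff ℝ ∞ f) (R s : ℝ) :
    HasDerivAt (fun s => f (s / R)) (deriv f (s / R) / R) s := by
  have h1 : HasDerivAt f (deriv f (s / R)) (s / R) :=
    ((contDiff_infty_iff_deriv.mp hf).1 _).hasDerivAt
  have h2 : HasDerivAt (fun s : ℝ => s / R) (1 / R) s := (hasDerivAt_id s).div_const R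
  have h3 := h1.comp s h2
  rw [mul_one_div] at h3
  exact h3

theorem hasDerivAt_wkbProfile (hG : ContDiff ℝ ∞ G) (R s : ℝ) :
    HasDerivAt (wkbProfile G R) (wkbProfileDeriv G R s) s := by
  have h1 := (hasDerivAt_comp_div shellBump.contDiff R s).ofReal_comp.mul
    (hasDerivAt_cexp_phase hG s)
  convert! h1 using 1
  rw [wkbProfileDeriv]
  push_cast
  ring

theorem hasDerivAt_wkbProfileDeriv (hG : ContDiff ℝ ∞ G) (R s : ℝ) :
    HasDerivAt (wkbProfileDeriv G R) (wkbProfileDeriv₂ G R s) s := by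
  have hs : ContDiff ℝ ∞ shellBump := shellBump.contDiff
  have h1 := hasDerivAt_comp_div (contDiff_infty_iff_deriv.mp hs).2 R s
  have h2 := hasDerivAt_comp_div hs R s
  have h3 : HasDerivAt (deriv G) (deriv (deriv G) s) s :=
    ((contDiff_infty_iff_deriv.mp (contDiff_infty_iff_deriv.mp hG).2).1 s).hasDerivAt
  have h4 := ((h1.div_const R).ofReal_comp.add ((h3.mul h2).ofReal_comp.const_mul I)).mul
    (hasDerivAt_cexp_phase hG s)
  convert! h4 using 1
  rw [wkbProfileDeriv₂]
  simp only [Pi.add_apply, Pi.mul_apply]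
  push_cast
  linear_combination (-((deriv G s : ℝ) : ℂ) ^ 2 * ((shellBump (s / R) : ℝ) : ℂ) * cexp (I * G s)) * I_sq

theorem contDiff_wkbProfile (hG : ContDiff ℝ ∞ G) (R : ℝ) : ContDiff ℝ ∞ (wkbProfile G R) := by
  have h1 : ContDiff ℝ ∞ fun s : ℝ => shellBump (s / R) :=
    shellBump.contDiff.comp (by fun_prop)
  exact (ofRealCLM.contDiff.comp h1).mul (contDiff_const.mul (ofRealCLM.contDiff.comp hG)).cexp

theorem div_mem_of_mem_tsupport {f : ℝ → ℝ} (hf : tsupport f ⊆ Set.Icc 1 4) (hR : 0 < R) {s : ℝ}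
    (hs : ¬(R ≤ s ∧ s ≤ 4 * R)) : f (s / R) = 0 := by
  refine image_eq_zero_of_notMem_tsupport fun h => hs ?_
  have := hf h
  rw [Set.mem_Icc, le_div_iff₀ hR, div_le_iff₀ hR, one_mul] at this
  exact this

theorem shellBump_eq_zero (hR : 0 < R) {s : ℝ} (hs : ¬(R ≤ s ∧ s ≤ 4 * R)) :
    shellBump (s / R) = 0 ∧ deriv shellBump (s / R) = 0 ∧ deriv (deriv shellBump) (s / R) = 0 := by
  have h0 := tsupport_shellBump.le
  have h1 := (tsupport_deriv_subset (f := shellBump) (𝕜 := ℝ)).trans h0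
  have h2 := (tsupport_deriv_subset (f := deriv shellBump) (𝕜 := ℝ)).trans h1
  exact ⟨div_mem_of_mem_tsupport h0 hR hs, div_mem_of_mem_tsupport h1 hR hs,
    div_mem_of_mem_tsupport h2 hR hs⟩

theorem hasCompactSupport_wkbProfile (G : ℝ → ℝ) (hR : 0 < R) :
    HasCompactSupport (wkbProfile G R) :=
  HasCompactSupport.intro (isCompact_Icc (a := R) (b := 4 * R)) fun s hs => by
    rw [wkbProfile, (shellBump_eq_zero hR hs).1]
    simp

/-- The approximate eigenfunction `χ(|x|² / R) e^{i G(|x|²)}`. -/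
def wkb (n : ℕ) (hG : ContDiff ℝ ∞ G) (hR : 0 < R) : 𝓢(Space n, ℂ) :=
  radialSchwartz n (wkbProfile G R) (contDiff_wkbProfile hG R) (hasCompactSupport_wkbProfile G hR)

theorem wkb_apply (hG : ContDiff ℝ ∞ G) (hR : 0 < R) (x : Space n) :
    wkb n hG hR x = wkbProfile G R (‖x‖ ^ 2) := rfl

theorem norm_cexp_phase (t : ℝ) : ‖cexp (I * t)‖ = 1 := by
  rw [mul_comm, norm_exp_ofReal_mul_I]

theorem norm_wkb_eq_one (hG : ContDiff ℝ ∞ G) (hR : 0 < R) {x : Space n} (h1 : 2 * R ≤ ‖x‖ ^ 2)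
    (h2 : ‖x‖ ^ 2 ≤ 3 * R) : ‖wkb n hG hR x‖ = 1 := by
  rw [wkb_apply, wkbProfile, norm_mul, norm_cexp_phase, shellBump_eq_one]
  · simp
  · rwa [le_div_iff₀ hR]
  · rwa [div_le_iff₀ hR]

theorem wkb_eq_zero (hG : ContDiff ℝ ∞ G) (hR : 0 < R) {x : Space n}
    (hx : ¬(R ≤ ‖x‖ ^ 2 ∧ ‖x‖ ^ 2 ≤ 4 * R)) : wkb n hG hR x = 0 := by
  rw [wkb_apply, wkbProfile, (shellBump_eq_zero hR hx).1]
  simp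

theorem freeSchwartz_wkb_sub_apply (α l : ℝ) (hG : ContDiff ℝ ∞ G) (hR : 0 < R) (x : Space n) :
    (freeSchwartz n α (wkb n hG hR) - (l : ℂ) • wkb n hG hR) x =
      -(4 * ((‖x‖ ^ 2 : ℝ) : ℂ) * wkbProfileDeriv₂ G R (‖x‖ ^ 2) +
        2 * n * wkbProfileDeriv G R (‖x‖ ^ 2)) -
      (((1 + ‖x‖ ^ 2) ^ (α / 2) + l : ℝ) : ℂ) * wkbProfile G R (‖x‖ ^ 2) := by
  rw [freeSchwartz_eq, sub_apply, sub_apply, neg_apply, smul_apply, wkb,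
    laplacian_radialSchwartz _ _ (hasDerivAt_wkbProfile hG R) (hasDerivAt_wkbProfileDeriv hG R),
    SchwartzMap.smulLeftCLM_apply_apply (hasTemperateGrowth_japanese n α), radialSchwartz_apply,
    japanese]
  push_cast
  simp only [smul_eq_mul]
  ring

theorem freeSchwartz_wkb_sub_eq_zero (α l : ℝ) (hG : ContDiff ℝ ∞ G) (hR : 0 < R) {x : Space n}
    (hx : ¬(R ≤ ‖x‖ ^ 2 ∧ ‖x‖ ^ 2 ≤ 4 * R)) :
    (freeSchwartz n α (wkb n hG hR) - (l : ℂ) • wkb n hG hR) x = 0 := by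
  obtain ⟨h0, h1, h2⟩ := shellBump_eq_zero hR hx
  rw [freeSchwartz_wkb_sub_apply, wkbProfile, wkbProfileDeriv, wkbProfileDeriv₂, h0, h1, h2]
  simp

/-- The eikonal equation cancels the only term that does not become small. Each other term contains
1/R, G' or s G'', all of size ε, and s ≤ 4R absorbs the growth of the coefficients. The constant
collects 16 + 32 + 12 = 60 and 2n + 2n. -/
theorem norm_freeSchwartz_wkb_sub_le (α l : ℝ) (hG : ContDiff ℝ ∞ G) (hR : 1 ≤ R) {C ε : ℝ}
    (hC : 0 ≤ C) (hε : 1 / R ≤ ε)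
    (hχ : ∀ s, |shellBump s| ≤ C ∧ |deriv shellBump s| ≤ C ∧ |deriv (deriv shellBump) s| ≤ C)
    (hq : ∀ s, R ≤ s → 4 * s * deriv G s ^ 2 = (1 + s) ^ (α / 2) + l)
    (hG0 : ∀ s, R ≤ s → 0 ≤ deriv G s)
    (hG2 : ∀ s, R ≤ s → |s * deriv (deriv G) s| ≤ 3 * deriv G s)
    (hGε : ∀ s, R ≤ s → deriv G s ≤ ε) (x : Space n) (hx : R ≤ ‖x‖ ^ 2 ∧ ‖x‖ ^ 2 ≤ 4 * R) :
    ‖(freeSchwartz n α (wkb n hG (one_pos.trans_le hR)) -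
      (l : ℂ) • wkb n hG (one_pos.trans_le hR)) x‖ ≤ C * (60 + 4 * n) * ε := by
  have hR0 : 0 < R := one_pos.trans_le hR
  obtain ⟨hx1, hx2⟩ := hx
  rw [freeSchwartz_wkb_sub_apply, ← hq _ hx1, wkbProfile, wkbProfileDeriv, wkbProfileDeriv₂]
  have g0 := hG0 _ hx1
  have g2 := hG2 _ hx1
  have gε := hGε _ hx1
  obtain ⟨c0, c1, c2⟩ := hχ (‖x‖ ^ 2 / R)
  generalize ‖x‖ ^ 2 = s at *
  generalize shellBump (s / R) = χ at *
  generalize deriv shellBump (s / R) = χ₁ at *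
  generalize deriv (deriv shellBump) (s / R) = χ₂ at *
  generalize deriv (deriv G) s = p' at *
  generalize deriv G s = p at *
  have hs0 : 0 < s := hR0.trans_le hx1
  have hε0 : 0 < ε := lt_of_lt_of_le (by positivity) hε
  have key : -(4 * (s : ℂ) * (((χ₂ / R ^ 2 - p ^ 2 * χ : ℝ) +
      I * (2 * p * χ₁ / R + p' * χ : ℝ)) * cexp (I * G s)) +
      2 * n * (((χ₁ / R : ℝ) + I * (p * χ : ℝ)) * cexp (I * G s))) -
      ((4 * s * p ^ 2 : ℝ) : ℂ) * ((χ : ℂ) * cexp (I * G s)) =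
      (((-(4 * s * (χ₂ / R ^ 2) + 2 * n * (χ₁ / R)) : ℝ) : ℂ) +
        ((-(8 * p * (s / R) * χ₁ + 4 * (s * p') * χ + 2 * n * p * χ) : ℝ) : ℂ) * I) *
        cexp (I * G s) := by
    push_cast
    ring
  rw [key, norm_mul, norm_cexp_phase, mul_one]
  have hsR : s / R ≤ 4 := by rwa [div_le_iff₀ hR0]
  have hsR0 : 0 ≤ s / R := by positivity
  have hn : (0 : ℝ) ≤ n := n.cast_nonneg
  have e1 : |4 * s * (χ₂ / R ^ 2)| ≤ 16 * C * ε := by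
    have : 4 * s * (χ₂ / R ^ 2) = 4 * (s / R) * χ₂ * (1 / R) := by field_simp
    rw [this, abs_mul, abs_mul, abs_of_nonneg (by positivity : 0 ≤ 4 * (s / R)),
      abs_of_nonneg (by positivity : 0 ≤ 1 / R)]
    calc _ ≤ 4 * 4 * C * ε := by gcongr
      _ = _ := by ring
  have e2 : |2 * n * (χ₁ / R)| ≤ 2 * n * C * ε := by
    have : 2 * n * (χ₁ / R) = 2 * n * χ₁ * (1 / R) := by field_simp
    rw [this, abs_mul, abs_mul, abs_of_nonneg (by positivity : 0 ≤ 2 * (n : ℝ)),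
      abs_of_nonneg (by positivity : 0 ≤ 1 / R)]
    gcongr
  have e3 : |8 * p * (s / R) * χ₁| ≤ 32 * C * ε := by
    rw [abs_mul, abs_of_nonneg (by positivity : 0 ≤ 8 * p * (s / R))]
    calc _ ≤ 8 * ε * 4 * C := by gcongr
      _ = _ := by ring
  have e4 : |4 * (s * p') * χ| ≤ 12 * C * ε := by
    rw [abs_mul, abs_mul, abs_of_pos (by norm_num : (0 : ℝ) < 4)]
    calc _ ≤ 4 * (3 * ε) * C := by
          gcongr
          linarith
      _ = _ := by ring
  have e5 : |2 * n * p * χ| ≤ 2 * n * C * ε := by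
    rw [abs_mul, abs_of_nonneg (by positivity : 0 ≤ 2 * n * p)]
    calc _ ≤ 2 * n * ε * C := by gcongr
      _ = _ := by ring
  refine (norm_add_le _ _).trans ?_
  rw [norm_mul, norm_I, mul_one, norm_real, norm_real, Real.norm_eq_abs, Real.norm_eq_abs, abs_neg,
    abs_neg]
  have f1 := abs_add_le (4 * s * (χ₂ / R ^ 2)) (2 * n * (χ₁ / R))
  have f2 := abs_add_le (8 * p * (s / R) * χ₁ + 4 * (s * p') * χ) (2 * n * p * χ)
  have f3 := abs_add_le (8 * p * (s / R) * χ₁) (4 * (s * p') * χ)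
  linarith

theorem volume_shell {a b : ℝ} (hR : 0 < R) :
    volume.real {x : Space n | a * R ≤ ‖x‖ ^ 2 ∧ ‖x‖ ^ 2 ≤ b * R} =
      √R ^ n * volume.real {x : Space n | a ≤ ‖x‖ ^ 2 ∧ ‖x‖ ^ 2 ≤ b} := by
  have hsq : 0 < √R := Real.sqrt_pos.mpr hR
  have : {x : Space n | a * R ≤ ‖x‖ ^ 2 ∧ ‖x‖ ^ 2 ≤ b * R} =
      ((√R)⁻¹ • ·) ⁻¹' {x : Space n | a ≤ ‖x‖ ^ 2 ∧ ‖x‖ ^ 2 ≤ b} := by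
    ext x
    simp only [Set.mem_ofPred_eq, Set.mem_preimage]
    rw [norm_smul, mul_pow, norm_inv, Real.norm_of_nonneg hsq.le, inv_pow, Real.sq_sqrt hR.le,
      ← div_eq_inv_mul, le_div_iff₀ hR, div_le_iff₀ hR]
  rw [this, Measure.real, Measure.addHaar_preimage_smul volume (inv_ne_zero hsq.ne'),
    ENNReal.toReal_mul, finrank_euclideanSpace_fin, inv_pow, inv_inv, abs_of_pos (by positivity),
    ENNReal.toReal_ofReal (by positivity), Measure.real]

theorem measurableSet_shell (a b : ℝ) :
    MeasurableSet {x : Space n | a ≤ ‖x‖ ^ 2 ∧ ‖x‖ ^ 2 ≤ b} :=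
  measurableSet_Icc.preimage (t := Set.Icc a b) (f := fun x : Space n => ‖x‖ ^ 2) (by fun_prop)

theorem volume_shell_lt_top (a b : ℝ) :
    volume {x : Space n | a ≤ ‖x‖ ^ 2 ∧ ‖x‖ ^ 2 ≤ b} < ⊤ := by
  refine (measure_mono fun x hx => ?_).trans_lt
    (measure_closedBall_lt_top (x := (0 : Space n)) (r := |b| + 1))
  rw [mem_closedBall_zero_iff]
  have h2 := le_abs_self b
  have h3 := hx.2
  nlinarith [norm_nonneg x, abs_nonneg b]

theorem volume_shell_pos (hn : 1 ≤ n) :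
    0 < volume.real {x : Space n | 2 ≤ ‖x‖ ^ 2 ∧ ‖x‖ ^ 2 ≤ 3} := by
  rw [Measure.real, ENNReal.toReal_pos_iff]
  refine ⟨?_, volume_shell_lt_top 2 3⟩
  have hopen : IsOpen {x : Space n | 2 < ‖x‖ ^ 2 ∧ ‖x‖ ^ 2 < 3} :=
    (isOpen_Ioo (a := (2 : ℝ)) (b := 3)).preimage
      (by fun_prop : Continuous fun x : Space n => ‖x‖ ^ 2)
  refine (hopen.measure_pos volume ⟨EuclideanSpace.single ⟨0, hn⟩ √(5 / 2), ?_⟩).trans_le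
    (measure_mono fun x hx => ⟨hx.1.le, hx.2.le⟩)
  rw [Set.mem_ofPred_eq, PiLp.norm_single, Real.norm_eq_abs, sq_abs, Real.sq_sqrt (by norm_num)]
  norm_num

/-- The function has modulus 1 on an inner shell, and the error lives on a larger shell. Both
volumes scale like √Rⁿ, so a pointwise error bound controls the relative L² error uniformly in R. -/
theorem norm_freeSchwartz_wkb_le (α l : ℝ) (hn : 1 ≤ n) (hG : ContDiff ℝ ∞ G) (hR : 0 < R) {δ : ℝ}
    (h : ∀ x : Space n, R ≤ ‖x‖ ^ 2 ∧ ‖x‖ ^ 2 ≤ 4 * R →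
      ‖(freeSchwartz n α (wkb n hG hR) - (l : ℂ) • wkb n hG hR) x‖ ≤ δ) :
    ‖schwartzL2 n (wkb n hG hR)‖ ≠ 0 ∧
    ‖schwartzL2 n (freeSchwartz n α (wkb n hG hR) - (l : ℂ) • wkb n hG hR)‖ ^ 2 ≤
      δ ^ 2 * (volume.real {x : Space n | 1 ≤ ‖x‖ ^ 2 ∧ ‖x‖ ^ 2 ≤ 4} /
        volume.real {x : Space n | 2 ≤ ‖x‖ ^ 2 ∧ ‖x‖ ^ 2 ≤ 3}) *
        ‖schwartzL2 n (wkb n hG hR)‖ ^ 2 := by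
  have hpos := volume_shell_pos hn
  have hc : 0 < √R ^ n := pow_pos (Real.sqrt_pos.mpr hR) n
  have hint : ∀ f : 𝓢(Space n, ℂ), Integrable fun x => ‖f x‖ ^ 2 := fun f =>
    (f.memLp 2 volume).integrable_norm_pow (by norm_num)
  have hlow : √R ^ n * volume.real {x : Space n | 2 ≤ ‖x‖ ^ 2 ∧ ‖x‖ ^ 2 ≤ 3} ≤
      ‖schwartzL2 n (wkb n hG hR)‖ ^ 2 := by
    rw [norm_sq_schwartzL2, ← volume_shell hR]
    set S := {x : Space n | 2 * R ≤ ‖x‖ ^ 2 ∧ ‖x‖ ^ 2 ≤ 3 * R} with hS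
    have hSm : MeasurableSet S := measurableSet_shell _ _
    rw [← integral_indicator_one hSm]
    refine integral_mono ((integrable_indicator_iff hSm).mpr ?_) (hint _) fun x => ?_
    · exact integrableOn_const (volume_shell_lt_top _ _).ne
    · by_cases hx : x ∈ S
      · rw [Set.indicator_of_mem hx]
        simp only [norm_wkb_eq_one hG hR hx.1 hx.2]
        simp
      · rw [Set.indicator_of_notMem hx]
        positivity
  have hupp : ‖schwartzL2 n (freeSchwartz n α (wkb n hG hR) - (l : ℂ) • wkb n hG hR)‖ ^ 2 ≤
      δ ^ 2 * (√R ^ n * volume.real {x : Space n | 1 ≤ ‖x‖ ^ 2 ∧ ‖x‖ ^ 2 ≤ 4}) := by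
    rw [norm_sq_schwartzL2, ← volume_shell hR]
    set S := {x : Space n | 1 * R ≤ ‖x‖ ^ 2 ∧ ‖x‖ ^ 2 ≤ 4 * R} with hS
    have hSm : MeasurableSet S := measurableSet_shell _ _
    rw [← integral_indicator_one hSm, ← integral_const_mul]
    refine integral_mono (hint _) (((integrable_indicator_iff hSm).mpr ?_).const_mul _) fun x => ?_
    · exact integrableOn_const (volume_shell_lt_top _ _).ne
    · by_cases hx : x ∈ S
      · simp only [Set.indicator_of_mem hx, Pi.one_apply, mul_one]
        exact pow_le_pow_left₀ (norm_nonneg _) (h x ⟨by simpa using hx.1, hx.2⟩) 2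
      · simp only [Set.indicator_of_notMem hx, mul_zero]
        rw [freeSchwartz_wkb_sub_eq_zero α l hG hR (by simpa [hS] using hx)]
        simp
  constructor
  · intro h0
    rw [h0] at hlow
    have : 0 < √R ^ n * volume.real {x : Space n | 2 ≤ ‖x‖ ^ 2 ∧ ‖x‖ ^ 2 ≤ 3} := by positivity
    norm_num at hlow
    linarith
  · refine hupp.trans ?_
    rw [mul_assoc]
    refine mul_le_mul_of_nonneg_left ?_ (sq_nonneg δ)
    rw [div_mul_eq_mul_div, le_div_iff₀ hpos]
    calc _ = volume.real {x : Space n | 1 ≤ ‖x‖ ^ 2 ∧ ‖x‖ ^ 2 ≤ 4} *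
          (√R ^ n * volume.real {x : Space n | 2 ≤ ‖x‖ ^ 2 ∧ ‖x‖ ^ 2 ≤ 3}) := by ring
      _ ≤ _ := mul_le_mul_of_nonneg_left hlow measureReal_nonneg

theorem inner_wkb_eq_zero (hG : ContDiff ℝ ∞ G) {R' : ℝ} (hR : 0 < R) (hR' : 0 < R')
    (h : 4 * R < R') :
    inner ℂ (schwartzL2 n (wkb n hG hR)) (schwartzL2 n (wkb n hG hR')) = 0 := by
  rw [L2.inner_def]
  refine integral_eq_zero_of_ae ?_
  filter_upwards [coeFn_schwartzL2 (wkb n hG hR), coeFn_schwartzL2 (wkb n hG hR')] with x h1 h2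
  rw [h1, h2]
  by_cases hx : R ≤ ‖x‖ ^ 2 ∧ ‖x‖ ^ 2 ≤ 4 * R
  · rw [wkb_eq_zero hG hR' (fun hx' => by linarith [hx.2, hx'.1]), inner_zero_right]; rfl
  · rw [wkb_eq_zero hG hR hx, inner_zero_left]; rfl

theorem exists_singular_sequence_of_lt_two (hn : 1 ≤ n) {α : ℝ} (hα : 0 < α) (hα2 : α < 2) (t : ℝ) :
    ∃ u f : ℕ → L2 n, Orthonormal ℂ u ∧
      (∀ k, (u k, f k) ∈ (maximalRealization n (freeExpr n α)).graph) ∧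
      Tendsto (fun k => f k - (t : ℂ) • u k) atTop (𝓝 0) := by
  obtain ⟨G, s₁, hs₁, hG, hq, hG0, hG2, hGlim⟩ :=
    exists_phase (a := α / 2) (by linarith) (by linarith) t
  obtain ⟨C, hC, hχ⟩ := exists_shellBump_bound
  -- The k-th function lives where R k ≤ |x|² ≤ 4 R k, so any ratio above 4 makes the supports
  -- disjoint.
  set R : ℕ → ℝ := fun k => s₁ * 5 ^ k with hRdef
  have hRs : ∀ k, s₁ ≤ R k := fun k =>
    le_mul_of_one_le_right (by linarith) (one_le_pow₀ (by norm_num))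
  have hR1 : ∀ k, 1 ≤ R k := fun k => hs₁.trans (hRs k)
  have hR0 : ∀ k, 0 < R k := fun k => one_pos.trans_le (hR1 k)
  have hRlt : ∀ j k, j < k → 4 * R j < R k := fun j k hjk => by
    have h1 : (5 : ℝ) ^ (j + 1) ≤ 5 ^ k := pow_le_pow_right₀ (by norm_num) hjk
    have h2 : s₁ * 5 ^ (j + 1) ≤ s₁ * 5 ^ k := mul_le_mul_of_nonneg_left h1 (by linarith)
    have h3 := hR0 j
    simp only [hRdef] at h3 ⊢
    rw [pow_succ] at h2
    linarith
  have hRtop : Tendsto R atTop atTop :=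
    (tendsto_pow_atTop_atTop_of_one_lt (by norm_num)).const_mul_atTop (by linarith)
  set g : ℕ → 𝓢(Space n, ℂ) := fun k => wkb n hG (hR0 k) with hg
  set V := volume.real {x : Space n | 1 ≤ ‖x‖ ^ 2 ∧ ‖x‖ ^ 2 ≤ 4} /
        volume.real {x : Space n | 2 ≤ ‖x‖ ^ 2 ∧ ‖x‖ ^ 2 ≤ 3} with hV
  have hV0 : 0 ≤ V := div_nonneg measureReal_nonneg measureReal_nonneg
  have hne : ∀ k, ‖schwartzL2 n (g k)‖ ≠ 0 := by
    intro k
    -- Only the nonvanishing of the norm is wanted here, so any bound on the error will do.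
    obtain ⟨D, hD⟩ := (freeSchwartz n α (g k) - (t : ℂ) • g k).decay 0 0
    refine (norm_freeSchwartz_wkb_le α t hn hG (hR0 k) (δ := D) fun x _ => ?_).1
    have := hD.2 x
    simpa using this
  set u : ℕ → L2 n := fun k => ((‖schwartzL2 n (g k)‖⁻¹ : ℝ) : ℂ) • schwartzL2 n (g k) with hu
  set f : ℕ → L2 n := fun k =>
    ((‖schwartzL2 n (g k)‖⁻¹ : ℝ) : ℂ) • schwartzL2 n (freeSchwartz n α (g k)) with hf
  refine ⟨u, f, ⟨fun k => ?_, fun j k hjk => ?_⟩, fun k => ?_, ?_⟩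
  · simp only [hu]
    rw [norm_smul, norm_real, norm_inv, norm_norm, inv_mul_cancel₀ (hne k)]
  · change inner ℂ (u j) (u k) = 0
    simp only [hu]
    rw [inner_smul_left, inner_smul_right]
    rcases lt_or_gt_of_ne hjk with h | h
    · rw [inner_wkb_eq_zero hG (hR0 j) (hR0 k) (hRlt j k h), mul_zero, mul_zero]
    · rw [inner_eq_zero_symm.mp (inner_wkb_eq_zero hG (hR0 k) (hR0 j) (hRlt k j h)), mul_zero,
        mul_zero]
  · exact Submodule.smul_mem _ _ (schwartz_mem_graph_free α (g k))
  · rw [Metric.tendsto_atTop]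
    intro η hη
    -- The added 1 makes K positive whatever C and V are; with ε = η / (2K) the error is at most η /
    -- 2.
    set K := C * (60 + 4 * n) * √V + 1 with hK
    have hK0 : 0 < K := by positivity
    set ε := η / (2 * K) with hεd
    have hε : 0 < ε := by positivity
    have hev1 : ∀ᶠ s in atTop, deriv G s < ε :=
      hGlim.eventually (gt_mem_nhds hε)
    obtain ⟨S, hS⟩ := eventually_atTop.mp hev1
    have hev2 : ∀ᶠ k in atTop, max S (1 / ε) ≤ R k := hRtop.eventually_ge_atTop _
    obtain ⟨N, hN⟩ := eventually_atTop.mp hev2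
    refine ⟨N, fun k hk => ?_⟩
    have hk1 := hN k hk
    have hRS : S ≤ R k := (le_max_left _ _).trans hk1
    have hRε : 1 / R k ≤ ε := by
      rw [div_le_iff₀ (hR0 k)]
      have := (le_max_right S (1 / ε)).trans hk1
      rw [div_le_iff₀ hε] at this
      linarith
    have hb := norm_freeSchwartz_wkb_sub_le (n := n) α t hG (hR1 k) hC hRε hχ
      (fun s hs => hq s ((hRs k).trans hs)) (fun s hs => hG0 s ((hRs k).trans hs))
      (fun s hs => hG2 s ((hRs k).trans hs)) (fun s hs => (hS s (hRS.trans hs)).le)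
    have hb2 := (norm_freeSchwartz_wkb_le α t hn hG (hR0 k) hb).2
    change ‖schwartzL2 n (freeSchwartz n α (g k) - (t : ℂ) • g k)‖ ^ 2 ≤
      (C * (60 + 4 * n) * ε) ^ 2 * V * ‖schwartzL2 n (g k)‖ ^ 2 at hb2
    have hb3 : ‖schwartzL2 n (freeSchwartz n α (g k) - (t : ℂ) • g k)‖ ≤
        (C * (60 + 4 * n) * ε) * √V * ‖schwartzL2 n (g k)‖ := by
      refine le_of_sq_le_sq ?_ (by positivity)
      rw [mul_pow, mul_pow, Real.sq_sqrt hV0]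
      exact hb2
    have hdiff : f k - (t : ℂ) • u k = ((‖schwartzL2 n (g k)‖⁻¹ : ℝ) : ℂ) •
        schwartzL2 n (freeSchwartz n α (g k) - (t : ℂ) • g k) := by
      simp only [hu, hf]
      rw [map_sub, map_smul, smul_sub, smul_comm]
    rw [dist_zero_right, hdiff, norm_smul, norm_real, norm_inv, norm_norm]
    have hgp : 0 < ‖schwartzL2 n (g k)‖ := lt_of_le_of_ne (norm_nonneg _) (hne k).symm
    rw [inv_mul_lt_iff₀ hgp]
    refine hb3.trans_lt ?_
    rw [mul_comm ‖schwartzL2 n (g k)‖]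
    refine mul_lt_mul_of_pos_right ?_ hgp
    have h5 : C * (60 + 4 * n) * ε * √V ≤ K * ε := by
      have : 0 ≤ ε := hε.le
      rw [hK]
      nlinarith
    have h6 : K * ε = η / 2 := by
      rw [hεd]
      field_simp
    linarith

end WKB

end RepulsiveSchrodinger

end

theorem proposition2p6 (n : ℕ) (hn : 1 ≤ n) :
    (∀ α : ℝ, 0 < α → α < 2 →
      ∀ V : Space n → ℝ, AEMeasurable V volume →
        RelativelyCompact (freeHamiltonian n α) (mulOp n V) →
        opSpectrum (hamiltonian n α V) = Set.range ((↑) : ℝ → ℂ)) ∧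
    PurelyAbsolutelyContinuous (freeHamiltonian n 2) ∧
    (∃ U : L2 n ≃ₗᵢ[ℂ] L2 n,
      (∀ f : 𝓢(Space n, ℂ), U (f.toLp 2 volume) =ᵐ[volume] rotationIntegral n f) ∧
      Conjugates U (shiftedDilation n) (freeHamiltonian n 2)) ∧
    (∀ V : Space n → ℝ, AEMeasurable V volume →
      RelativelyCompact (freeHamiltonian n 2) (mulOp n V) →
      opSpectrum (hamiltonian n 2 V) = Set.range ((↑) : ℝ → ℂ)) := by
  -- Self-adjointness, diagonalization and singular sequences are all proved for the maximal
  -- realization, to which the closure is identified.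
  rw [freeHamiltonian_eq two_pos le_rfl]
  refine ⟨fun α hα hα2 V _ hV => ?_, purelyAbsolutelyContinuous_free_two hn,
    ⟨rotation n, rotation_toLp, conjugates_rotation n⟩, fun V _ hV => ?_⟩
  · rw [hamiltonian]
    rw [freeHamiltonian_eq hα hα2.le] at hV ⊢
    exact (isSelfAdjointOp_maximalRealization_free hα hα2.le).opSpectrum_add
      (isSymmetricGraph_mulOp V) hV (exists_singular_sequence_of_lt_two hn hα hα2)
  · rw [hamiltonian, freeHamiltonian_eq two_pos le_rfl]
    exact (isSelfAdjointOp_maximalRealization_free two_pos le_rfl).opSpectrum_add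
      (isSymmetricGraph_mulOp V) hV (exists_singular_sequence_two hn)
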